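/- **Setting.** Let $D\in\{2,4\}$ and let $M$ be an oriented smooth $D$-dimensional manifold (Hausdorff, $\sigma$-compact, without boundary). Let $\mathcal F=\exp\!\big(-\tfrac{i\lambda}{2}\Theta^{\alpha\beta}X_\alpha\otimes X_\beta\big)$ be an Abelian twist: $X_\alpha$ are finitely many mutually commuting real vector fields and $\Theta$ is a constant real antisymmetric matrix. Everything is extended to formal power series in $\lambda$, with $\lambda$ real. For a bilinear operation $B$ put $B_\star:=B\circ\mathcal F^{-1}$, where the $X_\alpha$ act by Lie derivatives; this defines the $\star$-product of functions, the product $\wedge_\star$ of differential forms (also of matrix-valued ones) and the $\star$-contraction $\iota^\star_v(\omega)$ of vector fields with one-forms. Let $\eta=\mathrm{diag}(1,-1,\dots,-1)$ and $\gamma^a=\eta^{ab}\gamma_b$. For $D=2$ let $N=2$, $\gamma_0=\begin{pmatrix}0&1\\1&0\end{pmatrix}$, $\gamma_1=\begin{pmatrix}0&-1\\1&0\end{pmatrix}$, $\gamma_3=\gamma_0\gamma_1$. For $D=4$ let $N=4$ and let $\gamma_a$ be any complex $4\times4$-matrices with $\gamma_a\gamma_b+\gamma_b\gamma_a=2\eta_{ab}$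 and $\gamma_a^\dagger=\gamma_0\gamma_a\gamma_0$; put $\gamma_5=i\gamma_0\gamma_1\gamma_2\gamma_3$ and $\gamma_{ab}=\tfrac12[\gamma_a,\gamma_b]$. A *noncommutative Cartan geometry* is a pair $(V,\Omega)$ of matrix-valued one-forms with $V^\dagger=\gamma_0V\gamma_0$ and $\Omega^\dagger=-\gamma_0\Omega\gamma_0$ such that * for $D=2$: $V=V^a\gamma_a$ and $\Omega=\omega\gamma_3+\tilde\omega 1$ with $\tilde\omega|_{\lambda=0}=0$; * for $D=4$: $V=V^a\gamma_a+\tilde V^a\gamma_a\gamma_5$ and $\Omega=\tfrac14\omega^{ab}\gamma_{ab}+i\omega1+\tilde\omega\gamma_5$ with $\tilde V^a|_{\lambda=0}=\omega|_{\lambda=0}=\tilde\omega|_{\lambda=0}=0$; and such that the classical vielbein $V^a_{(0)}:=V^a|_{\lambda=0}$ is invertible, i.e. $(V^a_{(0)})_a$ is a global coframe; let $(E_a)_a$ be the dual frame and $\Omega_{(0)}:=\Omega|_{\lambda=0}$. For Dirac fields $\psi\in C^\infty(M,\mathbb C^N)[[\lambda]]$ let $\overline\psi=\psi^\dagger\gamma_0$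 and $\mathrm d_\Omega\psi=\mathrm d\psi-\Omega\star\psi$. Put $$\langle\psi_1,\psi_2\rangle=\int_M\mathrm{Tr}\big(\psi_2\star\overline{\psi_1}\star V\wedge_\star V\gamma_3\big)\ (D=2),\qquad \langle\psi_1,\psi_2\rangle=i\int_M\mathrm{Tr}\big(\psi_2\star\overline{\psi_1}\star V\wedge_\star V\wedge_\star V\wedge_\star V\gamma_5\big)\ (D=4).$$ The *Aschieri–Castellani operator* $\mathrm D^{\rm AC}$ is the map $C^\infty(M,\mathbb C^N)[[\lambda]]\to C^\infty(M,\mathbb C^N)[[\lambda]]$ with, for all $\psi_2$ and all compactly supported $\psi_1$, $$\langle\psi_1,\mathrm D^{\rm AC}\psi_2\rangle=2i\int_M\mathrm{Tr}\big((\mathrm d_\Omega\psi_2)\star\overline{\psi_1}\wedge_\star V\gamma_3\big)\ (D=2),$$ $$\langle\psi_1,\mathrm D^{\rm AC}\psi_2\rangle=-4\int_M\mathrm{Tr}\big((\mathrm d_\Omega\psi_2)\star\overline{\psi_1}\wedge_\star V\wedge_\star V\wedge_\star V\gamma_5\big)\ (D=4).$$ **Statement.** For every noncommutative Cartan geometry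 $(V,\Omega)$ on $(M,\mathcal F)$, exactly one such operator $\mathrm D=\mathrm D^{\rm AC}$ exists. It is a noncommutative Dirac operator, that is, $\mathrm D=\sum_n\lambda^n\mathrm D_n$ with linear differential operators $\mathrm D_n$ of finite order, and 1. $\mathrm D$ is a first-order noncommutative differential operator: for every $\psi$ there is a spinor-valued vector field $Q_\psi$ (which is moreover unique) such that $\mathrm D(\psi\star a)=\mathrm D(\psi)\star a+\iota^\star_{Q_\psi}(\mathrm da)$ for all $a\in C^\infty(M)[[\lambda]]$; 2. $\mathrm D$ is geometric, i.e. constructed from $V$ and $\mathrm d_\Omega$ by the operations of twisted noncommutative geometry. This means: there is a finite system of equations, between expressions or between integrals $\int_M$ of expressions of degree $D$, in a given Dirac field $\psi$, an unknown Dirac field $\chi$, finitely many unknown matrix-valued vector fields and a test Dirac field $\varphi$, where expressions are formed from these fields, $V$ and constant elements of the Clifford algebra by linear combinations, $\star$- and $\wedge_\star$-products, $\mathrm d_\Omega$ of Dirac fields, Dirac adjoints, traces and $\star$-contractions, such that for every $\psi$ exactly one choice of the unknowns satisfies the system for all compactly supported $\varphi$, and this choice has $\chi=\mathrm D\psi$.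 Moreover, one system (depending only on $D$ and the matrices $\gamma_a$) serves for all $M,\mathcal F,V,\Omega$; 3. at $\lambda=0$ it is the classical Dirac operator: $(\mathrm D\psi)|_{\lambda=0}=i\gamma^a\big(E_a(\psi|_{\lambda=0})-\Omega_{(0)}(E_a)\,\psi|_{\lambda=0}\big)$. -/

import Mathlib

open scoped Manifold ContDiff Topology

noncomputable section

namespace TwistedDirac

universe u

/-- Formal power series in the deformation parameter `λ` with coefficients in a vector space `W`:
`w : FS W` stands for `∑ₙ λⁿ w n`. -/
abbrev FS (W : Type*) : Type _ := ℕ → W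

/-! ### Vector fields and differential forms over an algebra of smooth functions -/

section Calculus

variable (A : Type u) [CommRing A] [Algebra ℂ A]

/-- Complex vector fields, as the `ℂ`-linear derivations of the algebra `A = C^∞(M)`. -/
abbrev VF : Type u := Derivation ℂ A A

/-- Complex differential `k`-forms, as the alternating `C^∞(M)`-multilinear maps which send
`k` vector fields to a function. -/
abbrev Form (k : ℕ) : Type u := VF A [⋀^Fin k]→ₗ[A] A

variable {A}

/-- A function, seen as a `0`-form. -/
def zeroForm (f : A) : Form A 0 := AlternatingMap.constOfIsEmpty _ _ _ f

/-- The differential of a function, `(df)(Y) = Y(f)`. -/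
def dFn (f : A) : Form A 1 :=
  AlternatingMap.ofSubsingleton (A) (VF A) (A) (0 : Fin 1)
    { toFun := fun Y => Y f
      map_add' := fun _ _ => rfl
      map_smul' := fun _ _ => rfl }

/-- The contraction `ι_Y α = α(Y)` of a vector field with a one-form. -/
def contr (Y : VF A) (α : Form A 1) : A := α ![Y]

/-- The wedge product
`(α ∧ β)(Y₁, …) = 1 / (k! l!) ∑_σ sign(σ) α(Y_{σ 1}, …, Y_{σ k}) β(Y_{σ (k+1)}, …)`. -/
def wedge {k l : ℕ} (α : Form A k) (β : Form A l) : Form A (k + l) :=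
  ((k.factorial * l.factorial : ℂ)⁻¹) •
    MultilinearMap.alternatization
      (((LinearMap.mul' (A) (A)).compMultilinearMap
        (MultilinearMap.domCoprod α.toMultilinearMap β.toMultilinearMap)).domDomCongr
          finSumFinEquiv)

theorem update_lie_update {k : ℕ} (X : VF A) (Y : Fin k → VF A) {i j : Fin k} (h : j ≠ i)
    (Z : VF A) :
    Function.update (Function.update Y i Z) j ⁅X, Function.update Y i Z j⁆ =
      Function.update (Function.update Y j ⁅X, Y j⁆) i Z := by
  rw [Function.update_of_ne h, Function.update_comm h]

/-- The Lie derivative of a differential form,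
`(L_X α)(Y₁, …, Y_k) = X(α(Y₁, …, Y_k)) - ∑ᵢ α(Y₁, …, [X, Yᵢ], …, Y_k)`. -/
def lieForm (X : VF A) {k : ℕ} (α : Form A k) : Form A k where
  toFun Y := X (α Y) - ∑ i, α (Function.update Y i ⁅X, Y i⁆)
  map_update_add' Y i y z := by
    rename_i inst
    obtain rfl : inst = instDecidableEqFin k := Subsingleton.elim _ _
    have key : ∀ j, α (Function.update (Function.update Y i (y + z)) j
          ⁅X, Function.update Y i (y + z) j⁆) =
        α (Function.update (Function.update Y i y) j ⁅X, Function.update Y i y j⁆) +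
        α (Function.update (Function.update Y i z) j ⁅X, Function.update Y i z j⁆) := by
      intro j
      rcases eq_or_ne j i with rfl | h
      · simp only [Function.update_self, Function.update_idem]
        rw [← AlternatingMap.map_update_add]
        exact congrArg (fun Z => α (Function.update Y j Z)) (lie_add X y z)
      · simp only [update_lie_update X Y h, AlternatingMap.map_update_add]
    rw [Finset.sum_congr rfl fun j _ => key j, Finset.sum_add_distrib,
      AlternatingMap.map_update_add, map_add]
    abel
  map_update_smul' Y i f y := by
    rename_i inst
    obtain rfl : inst = instDecidableEqFin k := Subsingleton.elim _ _
    have key : ∀ j, α (Function.update (Function.update Y i (f • y)) j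
          ⁅X, Function.update Y i (f • y) j⁆) =
        f • α (Function.update (Function.update Y i y) j ⁅X, Function.update Y i y j⁆) +
        if j = i then X f • α (Function.update Y i y) else 0 := by
      intro j
      rcases eq_or_ne j i with rfl | h
      · simp
      · simp only [update_lie_update X Y h, AlternatingMap.map_update_smul, if_neg h, add_zero]
    rw [Finset.sum_congr rfl fun j _ => key j, Finset.sum_add_distrib,
      AlternatingMap.map_update_smul, smul_eq_mul, Derivation.leibniz, ← Finset.smul_sum]
    simp only [Finset.sum_ite_eq', Finset.mem_univ, if_true, smul_eq_mul]
    ring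
  map_eq_zero_of_eq' Y i j hY hij := by
    have h0 : α Y = 0 := α.map_eq_zero_of_eq Y hY hij
    have hrest : ∀ m, m ≠ i ∧ m ≠ j → α (Function.update Y m ⁅X, Y m⁆) = 0 := by
      rintro m ⟨hi, hj⟩
      refine α.map_eq_zero_of_eq _ ?_ hij
      rw [Function.update_of_ne hi.symm, Function.update_of_ne hj.symm, hY]
    have hswap : α (Function.update Y j ⁅X, Y j⁆) = -α (Function.update Y i ⁅X, Y i⁆) := by
      rw [← α.map_swap _ hij]
      congr 1
      ext1 m
      rcases eq_or_ne m i with rfl | hi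
      · simp [Function.update_of_ne hij, Function.update_of_ne hij.symm, hY]
      rcases eq_or_ne m j with rfl | hj
      · simp [hY]
      · simp [Equiv.swap_apply_of_ne_of_ne hi hj, Function.update_of_ne hi,
          Function.update_of_ne hj]
    rw [h0, map_zero, Finset.sum_eq_add i j hij (fun m _ h => hrest m h) (by simp) (by simp), hswap]
    simp

end Calculus

/-! ### Abelian twists and the deformed products -/

section Twist

variable (A : Type u) [CommRing A] [Algebra ℂ A]

/-- The data of the Abelian Drinfeld twist `exp(-(iλ/2) Θ^{αβ} X_α ⊗ X_β)`: a constant real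
antisymmetric matrix `Θ` and mutually commuting vector fields `X_α`. (Reality of the `X_α` is
imposed in `ManifoldTwist`.) -/
structure Twist where
  /-- the number of vector fields -/
  m : ℕ
  /-- the vector fields `X_α` -/
  X : Fin m → VF A
  /-- the matrix `Θ^{αβ}` -/
  Θ : Matrix (Fin m) (Fin m) ℝ
  antisymm : Θ.transpose = -Θ
  commute : ∀ α β, ⁅X α, X β⁆ = 0

variable {A}
variable (T : Twist A)

/-- `B ∘ (Θ^{αβ} X_α ⊗ X_β)^n` for a bilinear operation `B : P × Q → R`, where a vector field `X`
acts on `P` and `Q` by `actP X` and `actQ X`. -/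
def Twist.term {P Q R : Type*} [AddCommMonoid R] [Module ℂ R] (actP : VF A → P → P)
    (actQ : VF A → Q → Q) (B : P → Q → R) : ℕ → P → Q → R
  | 0, p, q => B p q
  | n + 1, p, q => ∑ α, ∑ β, (T.Θ α β : ℂ) •
      Twist.term actP actQ B n (actP (T.X α) p) (actQ (T.X β) q)

/-- The deformation `B ∘ F⁻¹` of `B`, where `F⁻¹ = exp((iλ/2) Θ^{αβ} X_α ⊗ X_β)`, extended
`λ`-adically to formal power series. The coefficient of `λⁿ` is the sum over `j + k + l = n` of
`(i/2)^j / j! · B ∘ (Θ^{αβ} X_α ⊗ X_β)^j` applied to the coefficients of order `k` and `l`. -/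
def Twist.deform {P Q R : Type*} [AddCommMonoid R] [Module ℂ R] (actP : VF A → P → P)
    (actQ : VF A → Q → Q) (B : P → Q → R) (p : FS P) (q : FS Q) : FS R :=
  fun n => ∑ a ∈ Finset.HasAntidiagonal.antidiagonal n, ∑ b ∈ Finset.HasAntidiagonal.antidiagonal a.2,
    ((Complex.I / 2) ^ a.1 / (a.1.factorial : ℂ)) • T.term actP actQ B a.1 (p b.1) (q b.2)

/-- The `⋆`-product of functions. -/
def Twist.starFn (f g : FS A) : FS A :=
  T.deform (fun X f => X f) (fun X f => X f) (fun f g => f * g) f g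

/-- The `∧_⋆`-product of differential forms; vector fields act by Lie derivatives. -/
def Twist.starWedge {k l : ℕ} (α : FS (Form A k)) (β : FS (Form A l)) : FS (Form A (k + l)) :=
  T.deform (fun X α => lieForm X α) (fun X α => lieForm X α) wedge α β

/-- The `⋆`-contraction `ι^⋆_Y(α)` of a vector field with a one-form. -/
def Twist.starContr (Y : FS (VF A)) (α : FS (Form A 1)) : FS A :=
  T.deform (fun X Y => ⁅X, Y⁆) (fun X α => lieForm X α) contr Y α

variable (A)

/-- `r × c`-matrices of formal power series of `k`-forms. -/
abbrev MForm (k r c : ℕ) : Type u := Matrix (Fin r) (Fin c) (FS (Form A k))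

/-- Dirac fields with `N` components. -/
abbrev Spinor (N : ℕ) : Type u := Fin N → FS A

variable {A}

/-- The matrix product of matrix-valued forms, with entries multiplied by `∧_⋆`. -/
def Twist.mmul {k l r s c : ℕ} (P : MForm A k r s) (Q : MForm A l s c) : MForm A (k + l) r c :=
  Matrix.of fun i j => ∑ t, T.starWedge (P i t) (Q t j)

/-- A constant matrix, as a matrix of `0`-forms of order `λ⁰`. -/
def constM {r c : ℕ} (C : Matrix (Fin r) (Fin c) ℂ) : MForm A 0 r c :=
  Matrix.of fun i j => Pi.single 0 (zeroForm (algebraMap ℂ A (C i j)))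

/-- A Dirac field, as a column of `0`-forms. -/
def col {N : ℕ} (ψ : Spinor A N) : MForm A 0 N 1 := Matrix.of fun i _ n => zeroForm (ψ i n)

/-- The right `⋆`-product `ψ ⋆ a` of a Dirac field with a function. -/
def Twist.spinorMul {N : ℕ} (ψ : Spinor A N) (a : FS A) : Spinor A N := fun i => T.starFn (ψ i) a

/-- The `⋆`-contraction `ι^⋆_Q(α)` of a spinor-valued vector field with a one-form. -/
def Twist.spinorContr {N : ℕ} (Q : Fin N → FS (VF A)) (α : FS (Form A 1)) : Spinor A N :=
  fun i => T.starContr (Q i) α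

/-- The `⋆`-contraction of a matrix-valued vector field with a matrix-valued one-form. -/
def Twist.mcontr {r s c : ℕ} (Q : Matrix (Fin r) (Fin s) (FS (VF A))) (P : MForm A 1 s c) :
    MForm A 0 r c :=
  Matrix.of fun i j n => zeroForm (∑ t, T.starContr (Q i t) (P t j) n)

/-- The `⋆`-covariant differential `d_Ω ψ = dψ - Ω ⋆ ψ` of a column of functions
(as `0`-forms). -/
def Twist.covDiff {N : ℕ} (Om : MForm A 1 N N) (S : MForm A 0 N 1) : MForm A 1 N 1 :=
  (Matrix.of fun i j n => dFn (S i j n ![])) - T.mmul Om S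

end Twist

/-! ### Differential operators -/

section DiffOp

variable {A : Type u} [CommRing A] [Algebra ℂ A] {N : ℕ}

/-- Differential operators of order at most `k` on `C^∞(M, ℂ^N)`: those of order `0` are
`C^∞(M)`-linear, and `P` has order at most `k + 1` if all commutators `[P, f]` with functions `f`
have order at most `k`. -/
def HasOrderLE : ℕ → Module.End ℂ (Fin N → A) → Prop
  | 0, P => ∀ (f : A) (ψ : Fin N → A), P (f • ψ) = f • P ψ
  | k + 1, P => ∀ f : A, HasOrderLE k
      (P * Algebra.lsmul ℂ ℂ (Fin N → A) f - Algebra.lsmul ℂ ℂ (Fin N → A) f * P)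

/-- Formal differential operators `∑ₙ λⁿ Pₙ`, where each `Pₙ` is a linear differential operator of
finite order. -/
def IsDiffOp (Dop : Spinor A N → Spinor A N) : Prop :=
  ∃ P : ℕ → Module.End ℂ (Fin N → A), (∀ n, ∃ k, HasOrderLE k (P n)) ∧
    ∀ ψ n, (fun i => Dop ψ i n) =
      ∑ a ∈ Finset.HasAntidiagonal.antidiagonal n, P a.1 (fun i => ψ i a.2)

/-- First-order noncommutative differential operators: for every `ψ` there is a spinor-valued
vector field `Q_ψ` with `D(ψ ⋆ a) = D(ψ) ⋆ a + ι^⋆_{Q_ψ}(da)` for all functions `a`. -/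
def IsFirstOrderNC (T : Twist A) (Dop : Spinor A N → Spinor A N) : Prop :=
  IsDiffOp Dop ∧ ∀ ψ, ∃ Q : Fin N → FS (VF A), ∀ a : FS A,
    Dop (T.spinorMul ψ a) = T.spinorMul (Dop ψ) a + T.spinorContr Q (fun n => dFn (a n))

end DiffOp

/-! ### Smooth functions and integration on an oriented manifold -/

section Manifold

variable (D : ℕ) (M : Type u) [TopologicalSpace M] [ChartedSpace (EuclideanSpace ℝ (Fin D)) M]

/-- The algebra of smooth complex-valued functions on the `D`-dimensional manifold `M`. -/
def smoothFunctions : Subalgebra ℂ (M → ℂ) where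
  carrier := {f | ContMDiff (𝓡 D) 𝓘(ℝ, ℂ) ∞ f}
  mul_mem' hf hg :=
    (contDiff_fst.mul contDiff_snd : ContDiff ℝ ∞ fun p : ℂ × ℂ => p.1 * p.2).comp_contMDiff
      (hf.prodMk_space hg)
  add_mem' hf hg :=
    (contDiff_fst.add contDiff_snd : ContDiff ℝ ∞ fun p : ℂ × ℂ => p.1 + p.2).comp_contMDiff
      (hf.prodMk_space hg)
  algebraMap_mem' _ := contMDiff_const

/-- The type `C^∞(M)`. -/
def Fn : Type u := smoothFunctions D M

instance : CommRing (Fn D M) := inferInstanceAs (CommRing (smoothFunctions D M))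

instance : Algebra ℂ (Fn D M) := inferInstanceAs (Algebra ℂ (smoothFunctions D M))

instance : CoeFun (Fn D M) fun _ => M → ℂ := ⟨fun f => f.1⟩

/-- The charts of the given atlas define an orientation: all transition maps have positive
Jacobian determinant. -/
def IsOriented : Prop :=
  ∀ e ∈ atlas (EuclideanSpace ℝ (Fin D)) M, ∀ e' ∈ atlas (EuclideanSpace ℝ (Fin D)) M,
    ∀ y ∈ (e.symm.trans e').source, 0 < (fderiv ℝ (e.symm.trans e') y).det

variable {D M}

/-- Pointwise complex conjugation of functions. -/
def conjFn (f : Fn D M) : Fn D M :=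
  ⟨fun x => (starRingEnd ℂ) (f x), (Complex.conjCLE.contDiff (n := ∞)).comp_contMDiff f.2⟩

/-- A vector field is real if it commutes with complex conjugation. -/
def IsRealVF (Y : VF (Fn D M)) : Prop := ∀ f, Y (conjFn f) = conjFn (Y f)

/-- The coefficient of a top-degree form at the point `p` in the chart `e`: the number `z` with
`α = z dx¹ ∧ … ∧ dx^D` at `p`, that is `α(Y₁, …, Y_D)(p) = z · det(Yᵢ(xʲ)(p))` for all vector
fields. Here `xʲ` is represented by any globally defined smooth function that agrees with the
`j`-th coordinate of `e` near `p`. -/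
def chartCoeff (e : OpenPartialHomeomorph M (EuclideanSpace ℝ (Fin D))) (α : Form (Fn D M) D)
    (p : M) : ℂ :=
  Classical.epsilon fun z : ℂ => ∀ (Y : Fin D → VF (Fn D M)) (x : Fin D → Fn D M),
    (∀ j, ∀ᶠ q in 𝓝 p, x j q = ((e q j : ℝ) : ℂ)) →
      α Y p = z * Matrix.det (Matrix.of fun i j => (Y i (x j)) p)

variable [IsManifold (𝓡 D) ∞ M] [T2Space M] [SigmaCompactSpace M]

variable (D M) in
/-- A smooth partition of unity subordinate to the chart domains. -/
def chartPartition : SmoothPartitionOfUnity M (𝓡 D) M Set.univ :=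
  (SmoothPartitionOfUnity.exists_isSubordinate_chartAt_source (𝓡 D) M).choose

/-- The integral `∫_M α` of a (compactly supported) top-degree form over the manifold, oriented
by its atlas: the sum over a partition of unity of the integrals in charts. -/
def integral (α : Form (Fn D M) D) : ℂ :=
  ∑ᶠ i : M, ∫ y in (chartAt (EuclideanSpace ℝ (Fin D)) i).target,
    ((chartPartition D M i ((chartAt (EuclideanSpace ℝ (Fin D)) i).symm y) : ℝ) : ℂ) *
      chartCoeff (chartAt (EuclideanSpace ℝ (Fin D)) i) α
        ((chartAt (EuclideanSpace ℝ (Fin D)) i).symm y)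

/-- The integral, order by order in `λ`. -/
def integralFS (α : FS (Form (Fn D M) D)) : FS ℂ := fun n => integral (α n)

end Manifold

/-! ### Twisted manifolds, Clifford conventions and Dirac adjoints -/

section Geometry

variable (D : ℕ) (M : Type u) [TopologicalSpace M] [ChartedSpace (EuclideanSpace ℝ (Fin D)) M]

/-- An Abelian Drinfeld twist on the manifold `M`, generated by real vector fields. -/
structure ManifoldTwist extends Twist (Fn D M) where
  real : ∀ α, IsRealVF (X α)

variable {D M}

/-- The matrix at the point `x` of the coefficient of `λⁿ` of `P(Y)`. -/
def evalAt {r c : ℕ} (P : MForm (Fn D M) 1 r c) (n : ℕ) (Y : VF (Fn D M)) (x : M) :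
    Matrix (Fin r) (Fin c) ℂ :=
  Matrix.of fun i j => contr Y (P i j n) x

/-- The condition `P† = s γ₀ P γ₀` for a matrix-valued one-form (`λ` is real; a one-form and its
complex conjugate are compared on real vector fields). -/
def RealityCondition {N : ℕ} (g0 : Matrix (Fin N) (Fin N) ℂ) (s : ℂ) (P : MForm (Fn D M) 1 N N) :
    Prop :=
  ∀ n Y x, IsRealVF Y → (evalAt P n Y x).conjTranspose = s • (g0 * evalAt P n Y x * g0)

/-- `θ ⊗ C` for a scalar one-form `θ` and a constant matrix `C`. -/
def formTimes {N : ℕ} (θ : FS (Form (Fn D M) 1)) (C : Matrix (Fin N) (Fin N) ℂ) :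
    MForm (Fn D M) 1 N N :=
  Matrix.of fun i j => C i j • θ

/-- The vector fields `E_a` are the inverse of the one-forms `θ^a`: `θ^b(E_a) = δ_a^b` and
`Y = θ^a(Y) E_a` for every vector field `Y`. -/
def IsInverseFrame (θ : Fin D → Form (Fn D M) 1) (E : Fin D → VF (Fn D M)) : Prop :=
  (∀ a b, contr (E a) (θ b) = if a = b then 1 else 0) ∧ ∀ Y, Y = ∑ a, contr Y (θ a) • E a

/-- The Minkowski metric `η = diag(1, -1, …, -1)`. -/
def eta {D : ℕ} (a b : Fin D) : ℂ := if a = b then (if a.val = 0 then 1 else -1) else 0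

/-- The gamma-matrices in two dimensions. -/
def gamma2 : Fin 2 → Matrix (Fin 2) (Fin 2) ℂ := ![!![0, 1; 1, 0], !![0, -1; 1, 0]]

/-- `γ₃ = γ₀ γ₁` in two dimensions. -/
def gamma2chir : Matrix (Fin 2) (Fin 2) ℂ := gamma2 0 * gamma2 1

/-- A choice of gamma-matrices in four dimensions: `{γ_a, γ_b} = 2 η_{ab}` and
`γ_a† = γ₀ γ_a γ₀`. -/
structure Gamma4 where
  /-- the matrices `γ_a` -/
  γ : Fin 4 → Matrix (Fin 4) (Fin 4) ℂ
  clifford : ∀ a b, γ a * γ b + γ b * γ a = (2 * eta a b) • (1 : Matrix (Fin 4) (Fin 4) ℂ)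
  herm : ∀ a, (γ a).conjTranspose = γ 0 * γ a * γ 0

/-- `γ₅ = i γ₀ γ₁ γ₂ γ₃`. -/
def Gamma4.chir (g : Gamma4) : Matrix (Fin 4) (Fin 4) ℂ :=
  Complex.I • (g.γ 0 * g.γ 1 * g.γ 2 * g.γ 3)

/-- `γ_{ab} = [γ_a, γ_b] / 2`. -/
def Gamma4.gg (g : Gamma4) (a b : Fin 4) : Matrix (Fin 4) (Fin 4) ℂ :=
  (1 / 2 : ℂ) • (g.γ a * g.γ b - g.γ b * g.γ a)

/-- The Dirac adjoint `ψ† γ₀` of a column of functions (as `0`-forms). -/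
def diracAdjoint {N : ℕ} (g0 : Matrix (Fin N) (Fin N) ℂ) (S : MForm (Fn D M) 0 N 1) :
    MForm (Fn D M) 0 1 N :=
  Matrix.of fun _ j n => zeroForm (∑ i, g0 i j • conjFn (S i 0 n ![]))

/-- Dirac fields with compact support (of every coefficient in `λ`). -/
def CompactSpinor {N : ℕ} (ψ : Spinor (Fn D M) N) : Prop :=
  ∀ i n, HasCompactSupport (ψ i n : M → ℂ)

/-- The classical Dirac operator `ψ ↦ i γ^a (E_a(ψ) - Ω_a ψ)` with `Ω_a = Ω(E_a)` and
`γ^a = η^{ab} γ_b`, for an inverse vielbein `E_a` and an undeformed spin connection `Ω`. -/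
def classicalDirac {N : ℕ} (γ : Fin D → Matrix (Fin N) (Fin N) ℂ) (E : Fin D → VF (Fn D M))
    (Om : Matrix (Fin N) (Fin N) (Form (Fn D M) 1)) (ψ : Fin N → Fn D M) : Fin N → Fn D M :=
  fun i => ∑ a, ∑ j, (Complex.I * ∑ b, eta a b * γ b i j) •
    (E a (ψ j) - ∑ l, contr (E a) (Om j l) * ψ l)

end Geometry

/-! ### Geometric operators

An operator `D` is geometric if it is constructed from the vielbein `V` and the `⋆`-covariant
differential `d_Ω` by means of the operations of twisted noncommutative geometry. Such a
construction is a finite system of equations between expressions which are built from these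
objects and operations, a Dirac field `ψ`, an unknown Dirac field `χ`, finitely many unknown
matrix-valued vector fields, and a compactly supported test Dirac field `φ`; the system is required
to hold for all `φ` and to have exactly one solution, whose component `χ` is `D ψ`. -/

section Geometric

/-- Expressions for matrix-valued differential forms. `sh i` is the shape of the `i`-th unknown
vector field. -/
inductive MTerm (N : ℕ) {p : ℕ} (sh : Fin p → ℕ × ℕ) : ℕ → ℕ → ℕ → Type
  /-- the argument `ψ` -/
  | arg : MTerm N sh 0 N 1
  /-- the unknown value `χ` -/
  | val : MTerm N sh 0 N 1
  /-- the test field `φ` -/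
  | test : MTerm N sh 0 N 1
  /-- the vielbein `V` -/
  | vielbein : MTerm N sh 1 N N
  /-- a constant element of the Clifford algebra -/
  | cliff (C : Matrix (Fin N) (Fin N) ℂ) : MTerm N sh 0 N N
  /-- the constant function `1` -/
  | one : MTerm N sh 0 1 1
  | add {k r c : ℕ} (s t : MTerm N sh k r c) : MTerm N sh k r c
  | smul {k r c : ℕ} (z : ℂ) (t : MTerm N sh k r c) : MTerm N sh k r c
  /-- the `⋆`- or `∧_⋆`-product -/
  | mul {k l r s c : ℕ} (t : MTerm N sh k r s) (t' : MTerm N sh l s c) : MTerm N sh (k + l) r c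
  /-- the `⋆`-covariant differential `d_Ω` -/
  | cov (t : MTerm N sh 0 N 1) : MTerm N sh 1 N 1
  /-- the Dirac adjoint -/
  | adj (t : MTerm N sh 0 N 1) : MTerm N sh 0 1 N
  /-- the matrix trace -/
  | tr {k : ℕ} (t : MTerm N sh k N N) : MTerm N sh k 1 1
  /-- the `⋆`-contraction with the `i`-th unknown vector field -/
  | contract {c : ℕ} (i : Fin p) (t : MTerm N sh 1 (sh i).2 c) : MTerm N sh 0 (sh i).1 c

/-- Equations between expressions, or between integrals of top-degree expressions. -/
inductive GeoEqn (D N : ℕ) {p : ℕ} (sh : Fin p → ℕ × ℕ) : Type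
  | pointwise {k r c : ℕ} (s t : MTerm N sh k r c) : GeoEqn D N sh
  | integrated (s t : MTerm N sh D 1 1) : GeoEqn D N sh

/-- Finite systems of equations. -/
structure GeoSystem (D N : ℕ) where
  /-- the number of unknown vector fields -/
  p : ℕ
  /-- their shapes -/
  sh : Fin p → ℕ × ℕ
  /-- the equations -/
  eqs : List (GeoEqn D N sh)

variable {D N : ℕ} {M : Type u} [TopologicalSpace M] [ChartedSpace (EuclideanSpace ℝ (Fin D)) M]

/-- The value of an expression. -/
def MTerm.eval (T : ManifoldTwist D M) (g0 : Matrix (Fin N) (Fin N) ℂ)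
    (V Om : MForm (Fn D M) 1 N N) (ψ χ φ : Spinor (Fn D M) N) {p : ℕ} {sh : Fin p → ℕ × ℕ}
    (Q : ∀ i, Matrix (Fin (sh i).1) (Fin (sh i).2) (FS (VF (Fn D M)))) {k r c : ℕ} :
    MTerm N sh k r c → MForm (Fn D M) k r c
  | .arg => col ψ
  | .val => col χ
  | .test => col φ
  | .vielbein => V
  | .cliff C => constM C
  | .one => constM 1
  | .add s t => s.eval T g0 V Om ψ χ φ Q + t.eval T g0 V Om ψ χ φ Q
  | .smul z t => z • t.eval T g0 V Om ψ χ φ Q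
  | .mul s t => T.mmul (s.eval T g0 V Om ψ χ φ Q) (t.eval T g0 V Om ψ χ φ Q)
  | .cov t => T.covDiff Om (t.eval T g0 V Om ψ χ φ Q)
  | .adj t => diracAdjoint g0 (t.eval T g0 V Om ψ χ φ Q)
  | .tr t => Matrix.of fun _ _ => (t.eval T g0 V Om ψ χ φ Q).trace
  | .contract i t => T.mcontr (Q i) (t.eval T g0 V Om ψ χ φ Q)

variable [IsManifold (𝓡 D) ∞ M] [T2Space M] [SigmaCompactSpace M]

/-- Validity of an equation. -/
def GeoEqn.Holds (T : ManifoldTwist D M) (g0 : Matrix (Fin N) (Fin N) ℂ)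
    (V Om : MForm (Fn D M) 1 N N) (ψ χ φ : Spinor (Fn D M) N) {p : ℕ} {sh : Fin p → ℕ × ℕ}
    (Q : ∀ i, Matrix (Fin (sh i).1) (Fin (sh i).2) (FS (VF (Fn D M)))) : GeoEqn D N sh → Prop
  | .pointwise s t => s.eval T g0 V Om ψ χ φ Q = t.eval T g0 V Om ψ χ φ Q
  | .integrated s t => integralFS (s.eval T g0 V Om ψ χ φ Q 0 0) =
      integralFS (t.eval T g0 V Om ψ χ φ Q 0 0)

/-- The system `S` constructs the operator `Dop`: for every `ψ` it has exactly one solution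
`(Q, χ)`, and `χ = Dop ψ`. -/
def GeoSystem.Constructs (S : GeoSystem D N) (T : ManifoldTwist D M)
    (g0 : Matrix (Fin N) (Fin N) ℂ) (V Om : MForm (Fn D M) 1 N N)
    (Dop : Spinor (Fn D M) N → Spinor (Fn D M) N) : Prop :=
  ∀ ψ, ∃ Q : ∀ i, Matrix (Fin (S.sh i).1) (Fin (S.sh i).2) (FS (VF (Fn D M))), ∀ Q' χ,
    (∀ φ, CompactSpinor φ → ∀ e ∈ S.eqs, e.Holds T g0 V Om ψ χ φ Q') ↔ (Q' = Q ∧ χ = Dop ψ)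

/-- Geometric noncommutative differential operators. -/
def IsGeometricNC (T : ManifoldTwist D M) (g0 : Matrix (Fin N) (Fin N) ℂ)
    (V Om : MForm (Fn D M) 1 N N) (Dop : Spinor (Fn D M) N → Spinor (Fn D M) N) : Prop :=
  IsDiffOp Dop ∧ ∃ S : GeoSystem D N, S.Constructs T g0 V Om Dop

/-- Noncommutative Dirac operators for the vielbein `V` and the spin connection `Om`, where `E` is
the inverse of the vielbein at order `λ⁰`. -/
structure IsNCDirac [NeZero D] (T : ManifoldTwist D M) (γ : Fin D → Matrix (Fin N) (Fin N) ℂ)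
    (V Om : MForm (Fn D M) 1 N N) (E : Fin D → VF (Fn D M))
    (Dop : Spinor (Fn D M) N → Spinor (Fn D M) N) : Prop where
  firstOrder : IsFirstOrderNC T.toTwist Dop
  geometric : IsGeometricNC T (γ 0) V Om Dop
  classicalLimit : ∀ ψ, (fun i => Dop ψ i 0) =
    classicalDirac γ E (fun i j => Om i j 0) (fun i => ψ i 0)

end Geometric

/-! ### Dimension two -/

section Two

variable {M : Type u} [TopologicalSpace M] [ChartedSpace (EuclideanSpace ℝ (Fin 2)) M]

variable (M) in
/-- Noncommutative Cartan geometries on a two-dimensional manifold: components of the vielbein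
`V = V^a γ_a` and the spin connection `Ω = ω γ₃ + ω̃ 1`, with the reality conditions, with
`ω̃ = 0` at order `λ⁰`, and with a vielbein which is invertible at order `λ⁰`. -/
structure Cartan2 where
  /-- `V^a` -/
  Vc : Fin 2 → FS (Form (Fn 2 M) 1)
  /-- `ω` -/
  w : FS (Form (Fn 2 M) 1)
  /-- `ω̃` -/
  wt : FS (Form (Fn 2 M) 1)
  /-- the inverse vielbein at order `λ⁰` -/
  E : Fin 2 → VF (Fn 2 M)
  inverse : IsInverseFrame (fun a => Vc a 0) E
  realV : RealityCondition (gamma2 0) 1 (∑ a, formTimes (Vc a) (gamma2 a))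
  realOm : RealityCondition (gamma2 0) (-1) (formTimes w gamma2chir + formTimes wt 1)
  limit : wt 0 = 0

/-- The noncommutative vielbein `V = V^a γ_a`. -/
def Cartan2.V (G : Cartan2 M) : MForm (Fn 2 M) 1 2 2 := ∑ a, formTimes (G.Vc a) (gamma2 a)

/-- The noncommutative spin connection `Ω = ω γ₃ + ω̃ 1`. -/
def Cartan2.Om (G : Cartan2 M) : MForm (Fn 2 M) 1 2 2 :=
  formTimes G.w gamma2chir + formTimes G.wt 1

variable [IsManifold (𝓡 2) ∞ M] [T2Space M] [SigmaCompactSpace M]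

/-- The inner product `⟨ψ₁, ψ₂⟩ = ∫ Tr(ψ₂ ⋆ ψ̄₁ ⋆ V ∧_⋆ V γ₃)`. -/
def inner2 (T : ManifoldTwist 2 M) (G : Cartan2 M) (ψ₁ ψ₂ : Spinor (Fn 2 M) 2) : FS ℂ :=
  integralFS (D := 2) (Matrix.trace (T.mmul (col ψ₂) (T.mmul (diracAdjoint (gamma2 0) (col ψ₁))
    (T.mmul (T.mmul G.V G.V) (constM gamma2chir)))))

/-- The defining equation of the Aschieri–Castellani operator:
`⟨ψ₁, D ψ₂⟩ = 2i ∫ Tr((d_Ω ψ₂) ⋆ ψ̄₁ ∧_⋆ V γ₃)` for all `ψ₂` and all `ψ₁` of compact support. -/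
def IsAC2 (T : ManifoldTwist 2 M) (G : Cartan2 M)
    (Dop : Spinor (Fn 2 M) 2 → Spinor (Fn 2 M) 2) : Prop :=
  ∀ ψ₁ ψ₂, CompactSpinor ψ₁ → inner2 T G ψ₁ (Dop ψ₂) =
    (2 * Complex.I) • integralFS (D := 2) (Matrix.trace (T.mmul (T.covDiff G.Om (col ψ₂))
      (T.mmul (diracAdjoint (gamma2 0) (col ψ₁)) (T.mmul G.V (constM gamma2chir)))))

end Two

/-! ### Dimension four -/

section Four

variable {M : Type u} [TopologicalSpace M] [ChartedSpace (EuclideanSpace ℝ (Fin 4)) M]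

/-- `V = V^a γ_a + Ṽ^a γ_a γ₅`. -/
def vielbein4 (g : Gamma4) (Vc Vt : Fin 4 → FS (Form (Fn 4 M) 1)) : MForm (Fn 4 M) 1 4 4 :=
  ∑ a, (formTimes (Vc a) (g.γ a) + formTimes (Vt a) (g.γ a * g.chir))

/-- `Ω = (1/4) ω^{ab} γ_{ab} + i ω 1 + ω̃ γ₅`. -/
def connection4 (g : Gamma4) (wc : Fin 4 → Fin 4 → FS (Form (Fn 4 M) 1))
    (w wt : FS (Form (Fn 4 M) 1)) : MForm (Fn 4 M) 1 4 4 :=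
  (1 / 4 : ℂ) • (∑ a, ∑ b, formTimes (wc a b) (g.gg a b)) +
    formTimes w (Complex.I • 1) + formTimes wt g.chir

variable (M) in
/-- Noncommutative Cartan geometries on a four-dimensional manifold: components of the vielbein
and the spin connection, with the reality conditions, with `Ṽ^a = ω = ω̃ = 0` at order `λ⁰`, and
with a vielbein which is invertible at order `λ⁰`. -/
structure Cartan4 (g : Gamma4) where
  /-- `V^a` -/
  Vc : Fin 4 → FS (Form (Fn 4 M) 1)
  /-- `Ṽ^a` -/
  Vt : Fin 4 → FS (Form (Fn 4 M) 1)
  /-- `ω^{ab}` -/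
  wc : Fin 4 → Fin 4 → FS (Form (Fn 4 M) 1)
  /-- `ω` -/
  w : FS (Form (Fn 4 M) 1)
  /-- `ω̃` -/
  wt : FS (Form (Fn 4 M) 1)
  /-- the inverse vielbein at order `λ⁰` -/
  E : Fin 4 → VF (Fn 4 M)
  inverse : IsInverseFrame (fun a => Vc a 0) E
  realV : RealityCondition (g.γ 0) 1 (vielbein4 g Vc Vt)
  realOm : RealityCondition (g.γ 0) (-1) (connection4 g wc w wt)
  limit_Vt : ∀ a, Vt a 0 = 0
  limit_w : w 0 = 0
  limit_wt : wt 0 = 0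

variable {g : Gamma4}

/-- The noncommutative vielbein. -/
def Cartan4.V (G : Cartan4 M g) : MForm (Fn 4 M) 1 4 4 := vielbein4 g G.Vc G.Vt

/-- The noncommutative spin connection. -/
def Cartan4.Om (G : Cartan4 M g) : MForm (Fn 4 M) 1 4 4 := connection4 g G.wc G.w G.wt

variable [IsManifold (𝓡 4) ∞ M] [T2Space M] [SigmaCompactSpace M]

/-- The inner product `⟨ψ₁, ψ₂⟩ = i ∫ Tr(ψ₂ ⋆ ψ̄₁ ⋆ V ∧_⋆ V ∧_⋆ V ∧_⋆ V γ₅)`. -/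
def inner4 (T : ManifoldTwist 4 M) (G : Cartan4 M g) (ψ₁ ψ₂ : Spinor (Fn 4 M) 4) : FS ℂ :=
  Complex.I • integralFS (D := 4) (Matrix.trace (T.mmul (col ψ₂)
    (T.mmul (diracAdjoint (g.γ 0) (col ψ₁))
      (T.mmul (T.mmul (T.mmul (T.mmul G.V G.V) G.V) G.V) (constM g.chir)))))

/-- The defining equation of the Aschieri–Castellani operator:
`⟨ψ₁, D ψ₂⟩ = -4 ∫ Tr((d_Ω ψ₂) ⋆ ψ̄₁ ∧_⋆ V ∧_⋆ V ∧_⋆ V γ₅)` for all `ψ₂` and all `ψ₁` of compact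
support. -/
def IsAC4 (T : ManifoldTwist 4 M) (G : Cartan4 M g)
    (Dop : Spinor (Fn 4 M) 4 → Spinor (Fn 4 M) 4) : Prop :=
  ∀ ψ₁ ψ₂, CompactSpinor ψ₁ → inner4 T G ψ₁ (Dop ψ₂) =
    (-4 : ℂ) • integralFS (D := 4) (Matrix.trace (T.mmul (T.covDiff G.Om (col ψ₂))
      (T.mmul (diracAdjoint (g.γ 0) (col ψ₁))
        (T.mmul (T.mmul (T.mmul G.V G.V) G.V) (constM g.chir)))))

end Four

/-- For every `ψ` the spinor-valued vector field `Q_ψ` in the first-order property exists and is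
unique. -/
def UniqueSymbol {A : Type u} [CommRing A] [Algebra ℂ A] {N : ℕ} (T : Twist A)
    (Dop : Spinor A N → Spinor A N) : Prop :=
  ∀ ψ, ∃! Q : Fin N → FS (VF A), ∀ a : FS A,
    Dop (T.spinorMul ψ a) = T.spinorMul (Dop ψ) a + T.spinorContr Q (fun n => dFn (a n))

end TwistedDirac

end

/-! The integral can be stripped from the defining equation. As the X_α commute, composing with the
inverse twist keeps associative products associative and the Leibniz rule for d intact
(`Twist.deform_assoc`, `Twist.dFn_starFn`). As Θ is antisymmetric and the integral of a Lie
derivative of a compactly supported top form vanishes, every positive power of the twist disappears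
under the integral (`Twist.IsIntegral.term_succ`), which is therefore graded cyclic. Let W be the
product of D copies of V with the chirality matrix, and U the same with D - 1 copies. Moving ψ₂,
respectively d_Ω ψ₂, cyclically to the right and testing against all rows ψ̄₁ turns the weak
equation into c W ⋆ Dψ = c' (-1)^(D-1) U ∧_⋆ d_Ω ψ, where c and c' are the constants of the weak
equation (`Twist.IsIntegral.weak_iff_strong`). All compactly supported rows occur, because γ₀² = 1.

At λ = 0 the value of W on the frame E is a nonzero scalar matrix w · 1, with w = 2 for D = 2 and w
= -24i for D = 4. A top form is determined by its value on E, and χ ↦ (W ⋆ χ)(E) is a power series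
of differential operators with constant coefficient w; so it has a two-sided inverse among such
series (`exists_series_solution`). This gives existence, uniqueness and the form of D as a series of
differential operators. The defining equation itself is the required geometric system, with no
auxiliary unknowns.

For the first-order property put ψ ⋆ a into the strong equation. By the Leibniz rule and
associativity the defect D(ψ ⋆ a) - D(ψ) ⋆ a is κ(da), where κ(α) solves c W ⋆ κ(α) = c' (-1)^(D-1)
U ∧_⋆ (ψ ⋆ α). The map κ is right ⋆-linear, and the undeformed coframe still spans the one-forms as
a right ⋆-module, so κ is a ⋆-contraction (`exists_symbol`); uniqueness of Q follows order by order
in λ.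

The classical limit is the λ⁰ part of the strong equation on E: the wedge product with a one-form is
a Laplace expansion, and the product of all gamma matrices but γ_p with the chirality matrix is a
multiple of γ^p.

The analytic input, collected in `IsInverseFrame.isIntegral`, is linearity, Stokes' theorem and
nondegeneracy for the integral given by charts and a partition of unity. The global frame makes all
derivations of C^∞(M) local first-order operators, which makes the chart coefficients well defined;
orientation makes the chart integrals independent of the chart. -/

open scoped Manifold ContDiff Topology

noncomputable section

namespace TwistedDirac

universe u

open Finset.HasAntidiagonal (antidiagonal)

set_option linter.unusedSectionVars false

/-! ### Deformation of equivariant bilinear maps by an Abelian twist -/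

section AbstractTwist

variable {A : Type u} [CommRing A] [Algebra ℂ A] (T : Twist A)
variable {P Q R S S' Z : Type*}
  [AddCommGroup P] [Module ℂ P] [AddCommGroup Q] [Module ℂ Q] [AddCommGroup R] [Module ℂ R]
  [AddCommGroup S] [Module ℂ S] [AddCommGroup S'] [Module ℂ S'] [AddCommGroup Z] [Module ℂ Z]

/-- The vector fields of the twist act by commuting linear maps. -/
structure Twist.IsAct (act : VF A → P → P) : Prop where
  add : ∀ X p q, act X (p + q) = act X p + act X q
  smul : ∀ X (c : ℂ) p, act X (c • p) = c • act X p
  comm : ∀ α β p, act (T.X α) (act (T.X β) p) = act (T.X β) (act (T.X α) p)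

/-- `B` is bilinear and compatible with the actions of the vector fields of the twist. -/
structure Twist.IsEquivariant (actP : VF A → P → P) (actQ : VF A → Q → Q) (actR : VF A → R → R)
    (B : P → Q → R) : Prop where
  add_left : ∀ p p' q, B (p + p') q = B p q + B p' q
  add_right : ∀ p q q', B p (q + q') = B p q + B p q'
  smul_left : ∀ (c : ℂ) p q, B (c • p) q = c • B p q
  smul_right : ∀ (c : ℂ) p q, B p (c • q) = c • B p q
  leibniz : ∀ α p q, actR (T.X α) (B p q) = B (actP (T.X α) p) q + B p (actQ (T.X α) q)

variable {T}
variable {actP : VF A → P → P} {actQ : VF A → Q → Q} {actR : VF A → R → R} {actS : VF A → S → S}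
  {actS' : VF A → S' → S'} {actZ : VF A → Z → Z}

theorem Twist.IsAct.sum (h : T.IsAct actP) (X : VF A) {ι : Type*} (s : Finset ι) (f : ι → P) :
    actP X (∑ i ∈ s, f i) = ∑ i ∈ s, actP X (f i) :=
  map_sum (AddMonoidHom.mk' (actP X) (h.add X)) f s

theorem Twist.IsEquivariant.sum_left {B : P → Q → R} (h : T.IsEquivariant actP actQ actR B)
    {ι : Type*} (s : Finset ι) (f : ι → P) (q : Q) :
    B (∑ i ∈ s, f i) q = ∑ i ∈ s, B (f i) q :=
  map_sum (AddMonoidHom.mk' (fun p => B p q) fun p p' => h.add_left p p' q) f s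

theorem Twist.IsEquivariant.sum_right {B : P → Q → R} (h : T.IsEquivariant actP actQ actR B)
    {ι : Type*} (s : Finset ι) (f : ι → Q) (p : P) :
    B p (∑ i ∈ s, f i) = ∑ i ∈ s, B p (f i) :=
  map_sum (AddMonoidHom.mk' (B p) (h.add_right p)) f s

/-- This is where commutativity of the twist is used: moving X_γ past the X_α and X_β that already
act keeps the Leibniz rule true after any number of applications of Θ^{αβ} X_α ⊗ X_β. -/
theorem Twist.IsEquivariant.term {B : P → Q → R} (hP : T.IsAct actP) (hQ : T.IsAct actQ)
    (hR : T.IsAct actR) (h : T.IsEquivariant actP actQ actR B) (n : ℕ) :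
    T.IsEquivariant actP actQ actR (T.term actP actQ B n) := by
  induction n with
  | zero => exact h
  | succ n ih =>
    refine ⟨fun p p' q => ?_, fun p q q' => ?_, fun c p q => ?_, fun c p q => ?_,
      fun γ p q => ?_⟩
    · simp only [Twist.term, hP.add, ih.add_left, smul_add, Finset.sum_add_distrib]
    · simp only [Twist.term, hQ.add, ih.add_right, smul_add, Finset.sum_add_distrib]
    · simp only [Twist.term, hP.smul, ih.smul_left, Finset.smul_sum, smul_comm c]
    · simp only [Twist.term, hQ.smul, ih.smul_right, Finset.smul_sum, smul_comm c]
    · simp only [Twist.term, hR.sum, hR.smul, ih.leibniz, smul_add, Finset.sum_add_distrib,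
        hP.comm γ, hQ.comm γ]

/-- The coefficients of the exponential series of the twist. -/
def twistCoeff (n : ℕ) : ℂ := (Complex.I / 2) ^ n / (n.factorial : ℂ)

theorem Twist.deform_apply {P Q R : Type*} [AddCommMonoid R] [Module ℂ R] {actP : VF A → P → P}
    {actQ : VF A → Q → Q} (B : P → Q → R) (p : FS P) (q : FS Q) (n : ℕ) :
    T.deform actP actQ B p q n =
      ∑ a ∈ antidiagonal n, ∑ b ∈ antidiagonal a.2,
        twistCoeff a.1 • T.term actP actQ B a.1 (p b.1) (q b.2) := rfl

theorem Twist.term_add_fun (B B' : P → Q → R) (n : ℕ) (p : P) (q : Q) :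
    T.term actP actQ (fun p q => B p q + B' p q) n p q =
      T.term actP actQ B n p q + T.term actP actQ B' n p q := by
  induction n generalizing p q with
  | zero => rfl
  | succ n ih => simp only [Twist.term, ih, smul_add, Finset.sum_add_distrib]

/-- An equivariant map in the first argument, an equivariant map in the second argument and a
linear map of the values can be moved through the twist. -/
theorem Twist.map_term {P' Q' : Type*} {actP' : VF A → P' → P'} {actQ' : VF A → Q' → Q'}
    (B : P → Q → R) (B' : P' → Q' → S) (f : P → P') (g : Q → Q') (l : R →ₗ[ℂ] S)
    (hf : ∀ α p, f (actP (T.X α) p) = actP' (T.X α) (f p))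
    (hg : ∀ α q, g (actQ (T.X α) q) = actQ' (T.X α) (g q))
    (hB : ∀ p q, l (B p q) = B' (f p) (g q)) (n : ℕ) (p : P) (q : Q) :
    l (T.term actP actQ B n p q) = T.term actP' actQ' B' n (f p) (g q) := by
  induction n generalizing p q with
  | zero => exact hB p q
  | succ n ih => simp only [Twist.term, map_sum, map_smul, ih, hf, hg]

theorem Twist.map_deform {P' Q' : Type*} {actP' : VF A → P' → P'} {actQ' : VF A → Q' → Q'}
    (B : P → Q → R) (B' : P' → Q' → S) (f : P → P') (g : Q → Q') (l : R →ₗ[ℂ] S)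
    (hf : ∀ α p, f (actP (T.X α) p) = actP' (T.X α) (f p))
    (hg : ∀ α q, g (actQ (T.X α) q) = actQ' (T.X α) (g q))
    (hB : ∀ p q, l (B p q) = B' (f p) (g q)) (p : FS P) (q : FS Q) (n : ℕ) :
    l (T.deform actP actQ B p q n) =
      T.deform actP' actQ' B' (fun n => f (p n)) (fun n => g (q n)) n := by
  simp only [Twist.deform_apply, map_sum, map_smul,
    Twist.map_term (actP' := actP') (actQ' := actQ') B B' f g l hf hg hB]

theorem Twist.deform_add_fun (B B' : P → Q → R) (p : FS P) (q : FS Q) :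
    T.deform actP actQ (fun p q => B p q + B' p q) p q =
      T.deform actP actQ B p q + T.deform actP actQ B' p q := by
  funext n
  simp only [Pi.add_apply, Twist.deform_apply, Twist.term_add_fun, smul_add,
    Finset.sum_add_distrib]

section Linear

variable {B : P → Q → R} (hP : T.IsAct actP) (hQ : T.IsAct actQ)
  (hR : T.IsAct actR) (h : T.IsEquivariant actP actQ actR B)
include hP hQ hR h

theorem Twist.IsEquivariant.deform_add_left (p p' : FS P) (q : FS Q) :
    T.deform actP actQ B (p + p') q = T.deform actP actQ B p q + T.deform actP actQ B p' q := by
  funext n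
  simp only [Pi.add_apply, Twist.deform_apply, (h.term hP hQ hR _).add_left, smul_add,
    Finset.sum_add_distrib]

theorem Twist.IsEquivariant.deform_add_right (p : FS P) (q q' : FS Q) :
    T.deform actP actQ B p (q + q') = T.deform actP actQ B p q + T.deform actP actQ B p q' := by
  funext n
  simp only [Pi.add_apply, Twist.deform_apply, (h.term hP hQ hR _).add_right, smul_add,
    Finset.sum_add_distrib]

theorem Twist.IsEquivariant.deform_smul_left (c : ℂ) (p : FS P) (q : FS Q) :
    T.deform actP actQ B (c • p) q = c • T.deform actP actQ B p q := by
  funext n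
  simp only [Pi.smul_apply, Twist.deform_apply, (h.term hP hQ hR _).smul_left, Finset.smul_sum,
    smul_comm c]

theorem Twist.IsEquivariant.deform_sum_left {ι : Type*} (s : Finset ι) (p : ι → FS P) (q : FS Q) :
    T.deform actP actQ B (∑ i ∈ s, p i) q = ∑ i ∈ s, T.deform actP actQ B (p i) q :=
  map_sum (AddMonoidHom.mk' (fun p => T.deform actP actQ B p q)
    fun p p' => h.deform_add_left hP hQ hR p p' q) p s

theorem Twist.IsEquivariant.deform_sum_right {ι : Type*} (s : Finset ι) (p : FS P)
    (q : ι → FS Q) :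
    T.deform actP actQ B p (∑ i ∈ s, q i) = ∑ i ∈ s, T.deform actP actQ B p (q i) :=
  map_sum (AddMonoidHom.mk' (fun q => T.deform actP actQ B p q)
    fun q q' => h.deform_add_right hP hQ hR p q q') q s

end Linear

/-! #### Associativity -/

section Assoc

/-- The operators `C ↦ ∑ Θ^{αβ} C(X_α p, X_β q, r)` on functions of three variables. -/
def Twist.leg12 (T : Twist A) (actP : VF A → P → P) (actQ : VF A → Q → Q) :
    Module.End ℂ (P → Q → R → Z) where
  toFun C p q r := ∑ α, ∑ β, (T.Θ α β : ℂ) • C (actP (T.X α) p) (actQ (T.X β) q) r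
  map_add' C C' := by
    funext p q r
    simp only [Pi.add_apply, smul_add, Finset.sum_add_distrib]
  map_smul' c C := by
    funext p q r
    simp only [Pi.smul_apply, Finset.smul_sum, smul_comm c, RingHom.id_apply]

/-- The operators `C ↦ ∑ Θ^{αβ} C(X_α p, q, X_β r)` on functions of three variables. -/
def Twist.leg13 (T : Twist A) (actP : VF A → P → P) (actR : VF A → R → R) :
    Module.End ℂ (P → Q → R → Z) where
  toFun C p q r := ∑ α, ∑ β, (T.Θ α β : ℂ) • C (actP (T.X α) p) q (actR (T.X β) r)
  map_add' C C' := by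
    funext p q r
    simp only [Pi.add_apply, smul_add, Finset.sum_add_distrib]
  map_smul' c C := by
    funext p q r
    simp only [Pi.smul_apply, Finset.smul_sum, smul_comm c, RingHom.id_apply]

/-- The operators `C ↦ ∑ Θ^{αβ} C(p, X_α q, X_β r)` on functions of three variables. -/
def Twist.leg23 (T : Twist A) (actQ : VF A → Q → Q) (actR : VF A → R → R) :
    Module.End ℂ (P → Q → R → Z) where
  toFun C p q r := ∑ α, ∑ β, (T.Θ α β : ℂ) • C p (actQ (T.X α) q) (actR (T.X β) r)
  map_add' C C' := by
    funext p q r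
    simp only [Pi.add_apply, smul_add, Finset.sum_add_distrib]
  map_smul' c C := by
    funext p q r
    simp only [Pi.smul_apply, Finset.smul_sum, smul_comm c, RingHom.id_apply]

theorem sum_sum_sum_sum_comm {M ι κ : Type*} [AddCommMonoid M] [Fintype ι] [Fintype κ]
    (f : ι → ι → κ → κ → M) :
    ∑ a, ∑ b, ∑ c, ∑ d, f a b c d = ∑ c, ∑ d, ∑ a, ∑ b, f a b c d := by
  have h := Finset.sum_comm (s := (Finset.univ : Finset (ι × ι)))
    (t := (Finset.univ : Finset (κ × κ))) (f := fun x y => f x.1 x.2 y.1 y.2)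
  simpa only [Fintype.sum_prod_type] using h

/-- Two legs share exactly one of the three arguments, here the first; they commute because the
vector fields commute there. The next two lemmas treat the other shared arguments. -/
theorem Twist.leg12_commute_leg13 (hP : T.IsAct actP) :
    Commute (T.leg12 actP actQ : Module.End ℂ (P → Q → R → Z)) (T.leg13 actP actR) := by
  refine LinearMap.ext fun C => ?_
  funext p q r
  simp only [Module.End.mul_apply, Twist.leg12, Twist.leg13, LinearMap.coe_mk, AddHom.coe_mk,
    Finset.smul_sum]
  rw [sum_sum_sum_sum_comm]
  simp only [smul_comm (T.Θ _ _ : ℂ) (T.Θ _ _ : ℂ)]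
  refine Finset.sum_congr rfl fun a _ => Finset.sum_congr rfl fun b _ =>
    Finset.sum_congr rfl fun c _ => Finset.sum_congr rfl fun d _ => ?_
  rw [hP.comm, smul_comm]

theorem Twist.leg12_commute_leg23 (hQ : T.IsAct actQ) :
    Commute (T.leg12 actP actQ : Module.End ℂ (P → Q → R → Z)) (T.leg23 actQ actR) := by
  refine LinearMap.ext fun C => ?_
  funext p q r
  simp only [Module.End.mul_apply, Twist.leg12, Twist.leg23, LinearMap.coe_mk, AddHom.coe_mk,
    Finset.smul_sum]
  rw [sum_sum_sum_sum_comm]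
  refine Finset.sum_congr rfl fun a _ => Finset.sum_congr rfl fun b _ =>
    Finset.sum_congr rfl fun c _ => Finset.sum_congr rfl fun d _ => ?_
  rw [hQ.comm, smul_comm]

theorem Twist.leg13_commute_leg23 (hR : T.IsAct actR) :
    Commute (T.leg13 actP actR : Module.End ℂ (P → Q → R → Z)) (T.leg23 actQ actR) := by
  refine LinearMap.ext fun C => ?_
  funext p q r
  simp only [Module.End.mul_apply, Twist.leg13, Twist.leg23, LinearMap.coe_mk, AddHom.coe_mk,
    Finset.smul_sum]
  rw [sum_sum_sum_sum_comm]
  refine Finset.sum_congr rfl fun a _ => Finset.sum_congr rfl fun b _ =>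
    Finset.sum_congr rfl fun c _ => Finset.sum_congr rfl fun d _ => ?_
  rw [hR.comm, smul_comm]

/-- By the Leibniz rule a vector field on B₁(p, q) acts on p or on q, so the bidifferential operator
between S and R becomes the sum of the legs 13 and 23; the inner deformation contributes powers of
the leg 12. -/
theorem Twist.term_term_left {B₁ : P → Q → S} {B₂ : S → R → Z} (hP : T.IsAct actP)
    (hQ : T.IsAct actQ) (hR : T.IsAct actR) (hS : T.IsAct actS) (hZ : T.IsAct actZ)
    (h₁ : T.IsEquivariant actP actQ actS B₁) (h₂ : T.IsEquivariant actS actR actZ B₂) (n m : ℕ) :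
    (fun p q r => T.term actS actR B₂ n (T.term actP actQ B₁ m p q) r) =
      ((T.leg13 actP actR + T.leg23 actQ actR) ^ n * T.leg12 actP actQ ^ m :
        Module.End ℂ (P → Q → R → Z)) fun p q r => B₂ (B₁ p q) r := by
  have hm : (fun p q r => B₂ (T.term actP actQ B₁ m p q) r) =
      (T.leg12 actP actQ ^ m : Module.End ℂ (P → Q → R → Z)) fun p q r => B₂ (B₁ p q) r := by
    induction m with
    | zero => rfl
    | succ m ih =>
      rw [pow_succ', Module.End.mul_apply, ← ih]
      funext p q r
      simp only [Twist.term, h₂.sum_left, h₂.smul_left]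
      rfl
  rw [Module.End.mul_apply, ← hm]
  have hB := h₁.term hP hQ hS m
  generalize T.term actP actQ B₁ m = B at hB
  clear hm
  induction n with
  | zero => rfl
  | succ n ih =>
    rw [pow_succ', Module.End.mul_apply, ← ih]
    funext p q r
    simp only [Twist.term, hB.leibniz, (h₂.term hS hR hZ n).add_left, smul_add,
      Finset.sum_add_distrib]
    rfl

/-- The mirror image: a vector field on B₃(q, r) splits over q and r, so the outer deformation acts
by the legs 12 and 13 and the inner one by the leg 23. -/
theorem Twist.term_term_right {B₃ : Q → R → S'} {B₄ : P → S' → Z} (hP : T.IsAct actP)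
    (hQ : T.IsAct actQ) (hR : T.IsAct actR) (hS' : T.IsAct actS') (hZ : T.IsAct actZ)
    (h₃ : T.IsEquivariant actQ actR actS' B₃) (h₄ : T.IsEquivariant actP actS' actZ B₄)
    (n m : ℕ) :
    (fun p q r => T.term actP actS' B₄ n p (T.term actQ actR B₃ m q r)) =
      ((T.leg12 actP actQ + T.leg13 actP actR) ^ n * T.leg23 actQ actR ^ m :
        Module.End ℂ (P → Q → R → Z)) fun p q r => B₄ p (B₃ q r) := by
  have hm : (fun p q r => B₄ p (T.term actQ actR B₃ m q r)) =
      (T.leg23 actQ actR ^ m : Module.End ℂ (P → Q → R → Z)) fun p q r => B₄ p (B₃ q r) := by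
    induction m with
    | zero => rfl
    | succ m ih =>
      rw [pow_succ', Module.End.mul_apply, ← ih]
      funext p q r
      simp only [Twist.term, h₄.sum_right, h₄.smul_right]
      rfl
  rw [Module.End.mul_apply, ← hm]
  have hB := h₃.term hQ hR hS' m
  generalize T.term actQ actR B₃ m = B at hB
  clear hm
  induction n with
  | zero => rfl
  | succ n ih =>
    rw [pow_succ', Module.End.mul_apply, ← ih]
    funext p q r
    simp only [Twist.term, hB.leibniz, (h₄.term hP hS' hZ n).add_right, smul_add,
      Finset.sum_add_distrib]
    rfl

/-- The degree-j part of exp(x) exp(y) = exp(x + y) for commuting x and y, with the factors (i/2)^n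
/ n! of the twist. -/
theorem twistCoeff_smul_add_pow {E : Type*} [Ring E] [Algebra ℂ E] {x y : E} (h : Commute x y)
    (j : ℕ) :
    ∑ a ∈ antidiagonal j, (twistCoeff a.1 * twistCoeff a.2) • (x ^ a.1 * y ^ a.2) =
      twistCoeff j • (x + y) ^ j := by
  rw [h.add_pow', Finset.smul_sum]
  refine Finset.sum_congr rfl fun a ha => ?_
  rw [← Nat.cast_smul_eq_nsmul ℂ, smul_smul]
  congr 1
  obtain rfl := Finset.HasAntidiagonal.mem_antidiagonal.mp ha
  have := Nat.add_choose_mul_factorial_mul_factorial a.1 a.2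
  have h1 : ((a.1).factorial : ℂ) ≠ 0 := by exact_mod_cast a.1.factorial_ne_zero
  have h2 : ((a.2).factorial : ℂ) ≠ 0 := by exact_mod_cast a.2.factorial_ne_zero
  have h3 : ((a.1 + a.2).factorial : ℂ) ≠ 0 := by exact_mod_cast (a.1 + a.2).factorial_ne_zero
  have h4 : ((a.1 + a.2).choose a.1 : ℂ) * (a.1).factorial * (a.2).factorial =
    (a.1 + a.2).factorial := by
    rw [← this]
    push_cast
    rw [Nat.choose_symm_add]
  unfold twistCoeff
  rw [pow_add, ← h4]
  have h5 : ((a.1 + a.2).choose a.1 : ℂ) ≠ 0 := by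
    intro h0
    rw [h0] at h4
    simp at h4
    exact h3 h4.symm
  field_simp

/-- Reindexing for an iterated deformation: x and y count the powers of the outer and inner twist,
b, c, d the orders of the three arguments. Afterwards the powers with a given total form an inner
sum, ready for the binomial theorem. The next lemma does it for the other bracketing. -/
theorem sum_antidiagonal_regroup_left {W : Type*} [AddCommMonoid W]
    (H : ℕ → ℕ → ℕ → ℕ → ℕ → W) (n : ℕ) :
    ∑ x ∈ antidiagonal n, ∑ y ∈ antidiagonal x.2,
      ∑ z ∈ antidiagonal y.1, ∑ w ∈ antidiagonal z.2, H x.1 z.1 w.1 w.2 y.2 =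
    ∑ x ∈ antidiagonal n, ∑ z ∈ antidiagonal x.2,
      ∑ w ∈ antidiagonal z.2, ∑ y ∈ antidiagonal x.1, H y.1 y.2 z.1 w.1 w.2 := by
  simp only [Finset.sum_sigma']
  refine Finset.sum_bij'
    (fun ⟨x, y, z, w⟩ _ => ⟨(x.1 + z.1, w.1 + (w.2 + y.2)), (w.1, w.2 + y.2), (w.2, y.2),
      (x.1, z.1)⟩)
    (fun ⟨_, z, w, y⟩ _ => ⟨(y.1, y.2 + (z.1 + w.1) + w.2), (y.2 + (z.1 + w.1), w.2),
      (y.2, z.1 + w.1), (z.1, w.1)⟩) ?_ ?_ ?_ ?_ ?_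
  · rintro ⟨⟨a, b⟩, ⟨c, d⟩, ⟨e, f⟩, ⟨g, h⟩⟩ hx
    simp only [Finset.mem_sigma, Finset.HasAntidiagonal.mem_antidiagonal] at hx ⊢
    refine ⟨?_, trivial, trivial, trivial⟩
    omega
  · rintro ⟨⟨a, b⟩, ⟨c, d⟩, ⟨e, f⟩, ⟨g, h⟩⟩ hx
    simp only [Finset.mem_sigma, Finset.HasAntidiagonal.mem_antidiagonal] at hx ⊢
    refine ⟨?_, trivial, trivial, trivial⟩
    omega
  · rintro ⟨⟨a, b⟩, ⟨c, d⟩, ⟨e, f⟩, ⟨g, h⟩⟩ hx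
    simp only [Finset.mem_sigma, Finset.HasAntidiagonal.mem_antidiagonal] at hx
    obtain ⟨h1, h2, h3, h4⟩ := hx
    subst h4 h3 h2 h1
    simp [add_assoc]
  · rintro ⟨⟨a, b⟩, ⟨c, d⟩, ⟨e, f⟩, ⟨g, h⟩⟩ hx
    simp only [Finset.mem_sigma, Finset.HasAntidiagonal.mem_antidiagonal] at hx
    obtain ⟨h1, h2, h3, h4⟩ := hx
    subst h4 h3 h2 h1
    simp
  · rintro ⟨⟨a, b⟩, ⟨c, d⟩, ⟨e, f⟩, ⟨g, h⟩⟩ hx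
    rfl

theorem sum_antidiagonal_regroup_right {W : Type*} [AddCommMonoid W]
    (H : ℕ → ℕ → ℕ → ℕ → ℕ → W) (n : ℕ) :
    ∑ x ∈ antidiagonal n, ∑ y ∈ antidiagonal x.2,
      ∑ z ∈ antidiagonal y.2, ∑ w ∈ antidiagonal z.2, H x.1 z.1 y.1 w.1 w.2 =
    ∑ x ∈ antidiagonal n, ∑ z ∈ antidiagonal x.2,
      ∑ w ∈ antidiagonal z.2, ∑ y ∈ antidiagonal x.1, H y.1 y.2 z.1 w.1 w.2 := by
  simp only [Finset.sum_sigma']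
  refine Finset.sum_bij'
    (fun ⟨x, y, z, w⟩ _ => ⟨(x.1 + z.1, y.1 + (w.1 + w.2)), (y.1, w.1 + w.2), (w.1, w.2),
      (x.1, z.1)⟩)
    (fun ⟨_, z, w, y⟩ _ => ⟨(y.1, z.1 + (y.2 + (w.1 + w.2))), (z.1, y.2 + (w.1 + w.2)),
      (y.2, w.1 + w.2), (w.1, w.2)⟩) ?_ ?_ ?_ ?_ ?_
  · rintro ⟨⟨a, b⟩, ⟨c, d⟩, ⟨e, f⟩, ⟨g, h⟩⟩ hx
    simp only [Finset.mem_sigma, Finset.HasAntidiagonal.mem_antidiagonal] at hx ⊢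
    refine ⟨?_, trivial, trivial, trivial⟩
    omega
  · rintro ⟨⟨a, b⟩, ⟨c, d⟩, ⟨e, f⟩, ⟨g, h⟩⟩ hx
    simp only [Finset.mem_sigma, Finset.HasAntidiagonal.mem_antidiagonal] at hx ⊢
    refine ⟨?_, trivial, trivial, trivial⟩
    omega
  · rintro ⟨⟨a, b⟩, ⟨c, d⟩, ⟨e, f⟩, ⟨g, h⟩⟩ hx
    simp only [Finset.mem_sigma, Finset.HasAntidiagonal.mem_antidiagonal] at hx
    obtain ⟨h1, h2, h3, h4⟩ := hx
    subst h4 h3 h2 h1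
    simp
  · rintro ⟨⟨a, b⟩, ⟨c, d⟩, ⟨e, f⟩, ⟨g, h⟩⟩ hx
    simp only [Finset.mem_sigma, Finset.HasAntidiagonal.mem_antidiagonal] at hx
    obtain ⟨h1, h2, h3, h4⟩ := hx
    subst h4 h3 h2 h1
    simp
  · rintro ⟨⟨a, b⟩, ⟨c, d⟩, ⟨e, f⟩, ⟨g, h⟩⟩ hx
    rfl

/-- Deforming by the twist preserves associativity. -/
theorem Twist.deform_assoc {B₁ : P → Q → S} {B₂ : S → R → Z} {B₃ : Q → R → S'} {B₄ : P → S' → Z}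
    (hP : T.IsAct actP) (hQ : T.IsAct actQ) (hR : T.IsAct actR) (hS : T.IsAct actS)
    (hS' : T.IsAct actS') (hZ : T.IsAct actZ)
    (h₁ : T.IsEquivariant actP actQ actS B₁) (h₂ : T.IsEquivariant actS actR actZ B₂)
    (h₃ : T.IsEquivariant actQ actR actS' B₃) (h₄ : T.IsEquivariant actP actS' actZ B₄)
    (hassoc : ∀ p q r, B₂ (B₁ p q) r = B₄ p (B₃ q r)) (p : FS P) (q : FS Q) (r : FS R) :
    T.deform actS actR B₂ (T.deform actP actQ B₁ p q) r =
      T.deform actP actS' B₄ p (T.deform actQ actR B₃ q r) := by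
  funext n
  let C : P → Q → R → Z := fun p q r => B₂ (B₁ p q) r
  let a12 : Module.End ℂ (P → Q → R → Z) := T.leg12 actP actQ
  let a13 : Module.End ℂ (P → Q → R → Z) := T.leg13 actP actR
  let a23 : Module.End ℂ (P → Q → R → Z) := T.leg23 actQ actR
  have hC : (fun p q r => B₄ p (B₃ q r)) = C := by
    funext p q r
    exact (hassoc p q r).symm
  have hl : ∀ i j p q r, T.term actS actR B₂ i (T.term actP actQ B₁ j p q) r =
      ((a13 + a23) ^ i * a12 ^ j) C p q r := fun i j p q r =>
    congrFun (congrFun (congrFun (Twist.term_term_left hP hQ hR hS hZ h₁ h₂ i j) p) q) r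
  have hr : ∀ i j p q r, T.term actP actS' B₄ i p (T.term actQ actR B₃ j q r) =
      ((a12 + a13) ^ i * a23 ^ j) C p q r := fun i j p q r => by
    have := congrFun (congrFun (congrFun
      (Twist.term_term_right hP hQ hR hS' hZ h₃ h₄ i j) p) q) r
    rw [hC] at this
    exact this
  -- After regrouping, the two bracketings become the series exp(13 + 23) exp(12) and exp(12 + 13)
  -- exp(23) applied to the same undeformed triple product C.
  have e1 := sum_antidiagonal_regroup_left (fun x y b c d => (twistCoeff x * twistCoeff y) •
    ((a13 + a23) ^ x * a12 ^ y) C (p b) (q c) (r d)) n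
  have e2 := sum_antidiagonal_regroup_right (fun x y b c d => (twistCoeff x * twistCoeff y) •
    ((a12 + a13) ^ x * a23 ^ y) C (p b) (q c) (r d)) n
  have hcoef : ∀ (x y : Module.End ℂ (P → Q → R → Z)) (j : ℕ) p q r, Commute x y →
      ∑ y_1 ∈ antidiagonal j, (twistCoeff y_1.1 * twistCoeff y_1.2) •
        (x ^ y_1.1 * y ^ y_1.2) C p q r = twistCoeff j • ((x + y) ^ j) C p q r := by
    intro x y j p q r hxy
    have := congrArg (fun F : Module.End ℂ (P → Q → R → Z) => F C p q r)
      (twistCoeff_smul_add_pow hxy j)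
    simpa only [LinearMap.sum_apply, Finset.sum_apply, LinearMap.smul_apply, Pi.smul_apply]
      using this
  have c1 : Commute (a13 + a23) a12 :=
    ((Twist.leg12_commute_leg13 hP).symm).add_left (Twist.leg12_commute_leg23 hQ).symm
  have c2 : Commute (a12 + a13) a23 :=
    (Twist.leg12_commute_leg23 hQ).add_left (Twist.leg13_commute_leg23 hR)
  simp only [hcoef _ _ _ _ _ _ c1] at e1
  simp only [hcoef _ _ _ _ _ _ c2] at e2
  -- All legs commute, so both series are the exponential of the sum of the three legs.
  have hsum : a13 + a23 + a12 = a12 + a13 + a23 := by abel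
  rw [hsum] at e1
  simp only [Twist.deform_apply, (h₂.term hS hR hZ _).sum_left, (h₂.term hS hR hZ _).smul_left,
    (h₄.term hP hS' hZ _).sum_right, (h₄.term hP hS' hZ _).smul_right, hl, hr,
    Finset.smul_sum, smul_smul]
  rw [e1, e2]

end Assoc

end AbstractTwist

/-! ### Lie derivative and wedge product of forms on derivations -/

section FormCalculus

variable {A : Type u} [CommRing A] [Algebra ℂ A]

theorem wedge_apply {k l : ℕ} (α : Form A k) (β : Form A l) (Y : Fin (k + l) → VF A) :
    wedge α β Y = ((k.factorial * l.factorial : ℂ)⁻¹) •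
      ∑ σ : Equiv.Perm (Fin (k + l)), Equiv.Perm.sign σ •
        (α (fun i => Y (σ (Fin.castAdd l i))) * β (fun j => Y (σ (Fin.natAdd k j)))) := by
  simp [wedge, MultilinearMap.alternatization_apply]

theorem lieForm_apply (X : VF A) {k : ℕ} (α : Form A k) (Y : Fin k → VF A) :
    lieForm X α Y = X (α Y) - ∑ i, α (Function.update Y i ⁅X, Y i⁆) := rfl

theorem lieForm_add (X : VF A) {k : ℕ} (α β : Form A k) :
    lieForm X (α + β) = lieForm X α + lieForm X β := by
  ext Y
  simp only [lieForm_apply, AlternatingMap.add_apply, map_add, Finset.sum_add_distrib]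
  ring

theorem lieForm_smul (X : VF A) {k : ℕ} (c : ℂ) (α : Form A k) :
    lieForm X (c • α) = c • lieForm X α := by
  ext Y
  simp only [lieForm_apply, AlternatingMap.smul_apply, Derivation.map_smul, smul_sub, Finset.smul_sum]

theorem lieForm_fun_smul (X : VF A) {k : ℕ} (f : A) (α : Form A k) :
    lieForm X (f • α) = X f • α + f • lieForm X α := by
  ext Y
  simp only [lieForm_apply, AlternatingMap.smul_apply, AlternatingMap.add_apply, smul_eq_mul,
    Derivation.leibniz, mul_sub, Finset.mul_sum]
  ring

theorem lie_lie_comm {X X' : VF A} (h : ⁅X, X'⁆ = 0) (Y : VF A) : ⁅X, ⁅X', Y⁆⁆ = ⁅X', ⁅X, Y⁆⁆ := by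
  rw [leibniz_lie, h, zero_lie, zero_add]

theorem apply_apply_comm {X X' : VF A} (h : ⁅X, X'⁆ = 0) (f : A) : X (X' f) = X' (X f) := by
  have := congrArg (fun Z : VF A => Z f) h
  simpa [Derivation.commutator_apply, sub_eq_zero] using this

/-- In the double sum over slots the terms with two different slots are symmetric in X and X'; in a
single slot ad X and ad X' commute by the Jacobi identity and [X, X'] = 0. -/
theorem lieForm_comm {X X' : VF A} (h : ⁅X, X'⁆ = 0) {k : ℕ} (α : Form A k) :
    lieForm X (lieForm X' α) = lieForm X' (lieForm X α) := by
  ext Y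
  simp only [lieForm_apply, map_sub, map_sum, Finset.sum_sub_distrib]
  rw [apply_apply_comm h]
  have key : ∑ i, ∑ j, α (Function.update (Function.update Y i ⁅X, Y i⁆) j
        ⁅X', Function.update Y i ⁅X, Y i⁆ j⁆) =
      ∑ i, ∑ j, α (Function.update (Function.update Y i ⁅X', Y i⁆) j
        ⁅X, Function.update Y i ⁅X', Y i⁆ j⁆) := by
    rw [Finset.sum_comm]
    refine Finset.sum_congr rfl fun i _ => Finset.sum_congr rfl fun j _ => ?_
    rcases eq_or_ne i j with rfl | hij
    · simp only [Function.update_self, Function.update_idem, lie_lie_comm h]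
    · rw [Function.update_of_ne hij, Function.update_of_ne hij.symm, Function.update_comm hij]
  rw [key]
  ring

theorem wedge_add_left {k l : ℕ} (α α' : Form A k) (β : Form A l) :
    wedge (α + α') β = wedge α β + wedge α' β := by
  ext Y
  simp only [wedge_apply, AlternatingMap.add_apply, add_mul, smul_add, Finset.sum_add_distrib]

theorem wedge_add_right {k l : ℕ} (α : Form A k) (β β' : Form A l) :
    wedge α (β + β') = wedge α β + wedge α β' := by
  ext Y
  simp only [wedge_apply, AlternatingMap.add_apply, mul_add, smul_add, Finset.sum_add_distrib]

theorem wedge_smul_left {k l : ℕ} (f : A) (α : Form A k) (β : Form A l) :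
    wedge (f • α) β = f • wedge α β := by
  ext Y
  simp only [wedge_apply, AlternatingMap.smul_apply, smul_eq_mul, mul_smul_comm, Finset.mul_sum,
    mul_assoc]

theorem wedge_smul_right {k l : ℕ} (f : A) (α : Form A k) (β : Form A l) :
    wedge α (f • β) = f • wedge α β := by
  ext Y
  simp only [wedge_apply, AlternatingMap.smul_apply, smul_eq_mul, mul_smul_comm, Finset.mul_sum,
    mul_left_comm f]

theorem form_smul_algebraMap {k : ℕ} (c : ℂ) (α : Form A k) : algebraMap ℂ A c • α = c • α := by
  ext Y
  simp [Algebra.smul_def]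

theorem form_smul_smul {k : ℕ} (c : ℂ) (f : A) (α : Form A k) : (c • f) • α = c • f • α := by
  ext Y
  exact smul_mul_assoc c f (α Y)

theorem lieForm_wedge (X : VF A) {k l : ℕ} (α : Form A k) (β : Form A l) :
    lieForm X (wedge α β) = wedge (lieForm X α) β + wedge α (lieForm X β) := by
  ext Y
  rw [lieForm_apply, AlternatingMap.add_apply]
  simp only [wedge_apply]
  rw [Derivation.map_smul, map_sum, ← Finset.smul_sum, Finset.sum_comm, ← smul_sub, ← smul_add,
    ← Finset.sum_sub_distrib, ← Finset.sum_add_distrib]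
  congr 1
  refine Finset.sum_congr rfl fun σ _ => ?_
  have hs : ∀ x : A, X (Equiv.Perm.sign σ • x) = Equiv.Perm.sign σ • X x := fun x => by
    rw [Units.smul_def, Units.smul_def, map_zsmul]
  rw [← Finset.smul_sum, hs, ← smul_sub, ← smul_add]
  congr 1
  -- Numbering the slots through σ separates those fed to α from those fed to β, and each bracket
  -- then changes only one factor.
  rw [← Equiv.sum_comp σ, Fin.sum_univ_add]
  have h1 : ∀ i : Fin k, (fun x => Function.update Y (σ (Fin.castAdd l i))
      ⁅X, Y (σ (Fin.castAdd l i))⁆ (σ (Fin.castAdd l x))) =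
      Function.update (fun x => Y (σ (Fin.castAdd l x))) i ⁅X, Y (σ (Fin.castAdd l i))⁆ := by
    intro i
    funext x
    rcases eq_or_ne x i with rfl | h
    · simp
    · rw [Function.update_of_ne h, Function.update_of_ne]
      exact fun h' => h (Fin.castAdd_injective k l (σ.injective h'))
  have h2 : ∀ i : Fin k, (fun x => Function.update Y (σ (Fin.castAdd l i))
      ⁅X, Y (σ (Fin.castAdd l i))⁆ (σ (Fin.natAdd k x))) = fun x => Y (σ (Fin.natAdd k x)) := by
    intro i
    funext x
    rw [Function.update_of_ne]
    intro h'
    have := congrArg Fin.val (σ.injective h')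
    simp at this
    omega
  have h3 : ∀ i : Fin l, (fun x => Function.update Y (σ (Fin.natAdd k i))
      ⁅X, Y (σ (Fin.natAdd k i))⁆ (σ (Fin.castAdd l x))) = fun x => Y (σ (Fin.castAdd l x)) := by
    intro i
    funext x
    rw [Function.update_of_ne]
    intro h'
    have := congrArg Fin.val (σ.injective h')
    simp at this
    omega
  have h4 : ∀ i : Fin l, (fun x => Function.update Y (σ (Fin.natAdd k i))
      ⁅X, Y (σ (Fin.natAdd k i))⁆ (σ (Fin.natAdd k x))) =
      Function.update (fun x => Y (σ (Fin.natAdd k x))) i ⁅X, Y (σ (Fin.natAdd k i))⁆ := by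
    intro i
    funext x
    rcases eq_or_ne x i with rfl | h
    · simp
    · rw [Function.update_of_ne h, Function.update_of_ne]
      exact fun h' => h (Fin.natAdd_injective l k (σ.injective h'))
  simp only [h1, h2, h3, h4, lieForm_apply, Derivation.leibniz, smul_eq_mul, ← Finset.sum_mul,
    ← Finset.mul_sum]
  ring

theorem wedge_zeroForm_right {k : ℕ} (α : Form A k) (f : A) : wedge α (zeroForm f) = f • α := by
  ext Y
  rw [wedge_apply]
  have h : ∀ σ : Equiv.Perm (Fin k), Equiv.Perm.sign σ • (α (fun i => Y (σ i)) * f) = α Y * f := by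
    intro σ
    have := α.map_perm Y σ
    rw [show (fun i => Y (σ i)) = Y ∘ σ from rfl, this, ← smul_mul_assoc, smul_smul,
      Int.units_mul_self, one_smul]
  have h' : ∀ σ : Equiv.Perm (Fin (k + 0)), Equiv.Perm.sign σ •
      (α (fun i => Y (σ (Fin.castAdd 0 i))) * (zeroForm f) (fun j => Y (σ (Fin.natAdd k j)))) =
      α Y * f := h
  rw [Finset.sum_congr rfl fun σ _ => h' σ, Finset.sum_const, Finset.card_univ, Fintype.card_perm,
    Fintype.card_fin, ← Nat.cast_smul_eq_nsmul ℂ, smul_smul]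
  have : (k.factorial : ℂ) ≠ 0 := by exact_mod_cast k.factorial_ne_zero
  simp [this, mul_comm]

/-- All k! permutations contribute equally. As 0 + k and k agree only propositionally, the identity
is stated on values with recast indices. -/
theorem wedge_zeroForm_left {k : ℕ} (f : A) (α : Form A k) (Y : Fin (0 + k) → VF A) :
    wedge (zeroForm f) α Y = f * α (fun i => Y (Fin.cast (zero_add k).symm i)) := by
  rw [wedge_apply]
  have h' : ∀ σ : Equiv.Perm (Fin (0 + k)), Equiv.Perm.sign σ •
      ((zeroForm f) (fun i => Y (σ (Fin.castAdd k i))) * α (fun j => Y (σ (Fin.natAdd 0 j)))) =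
      f * α (fun i => Y (Fin.cast (zero_add k).symm i)) := by
    intro σ
    let τ : Equiv.Perm (Fin k) := (finCongr (zero_add k)).permCongr σ
    have h1 : (fun j => Y (σ (Fin.natAdd 0 j))) =
        (fun i => Y (Fin.cast (zero_add k).symm i)) ∘ τ := by
      funext j
      simp only [Function.comp_apply, τ, Equiv.permCongr_apply]
      congr 1
      apply Fin.ext
      simp only [finCongr_symm, finCongr_apply, Fin.val_cast]
      congr 2
      apply Fin.ext
      simp
    have h2 : Equiv.Perm.sign τ = Equiv.Perm.sign σ := Equiv.Perm.sign_permCongr _ _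
    rw [h1, α.map_perm, h2]
    change Equiv.Perm.sign σ • (f * _) = _
    rw [mul_smul_comm, smul_smul, Int.units_mul_self, one_smul]
  rw [Finset.sum_congr rfl fun σ _ => h' σ, Finset.sum_const, Finset.card_univ, Fintype.card_perm,
    Fintype.card_fin, ← Nat.cast_smul_eq_nsmul ℂ, smul_smul]
  have : (k.factorial : ℂ) ≠ 0 := by exact_mod_cast k.factorial_ne_zero
  simp [this]

/-- A permutation is determined by the image p of 0 and a permutation of the other points. The
chosen representative of p sends 0 to p and is increasing elsewhere, so that `Fin.succAbove` and the
sign (-1)^p appear by themselves. -/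
theorem sum_perm_fin_succ {M : Type*} [AddCommMonoid M] {n : ℕ}
    (F : Equiv.Perm (Fin (n + 1)) → M) :
    ∑ σ, F σ = ∑ p : Fin (n + 1), ∑ τ : Equiv.Perm (Fin n),
      F (p.cycleRange.symm * Equiv.Perm.decomposeFin.symm (0, τ)) := by
  rw [← Fintype.sum_prod_type' (f := fun (p : Fin (n + 1)) (τ : Equiv.Perm (Fin n)) =>
    F (p.cycleRange.symm * Equiv.Perm.decomposeFin.symm (0, τ)))]
  symm
  refine Fintype.sum_bijective _ ?_ _ _ fun x => rfl
  rw [Fintype.bijective_iff_injective_and_card]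
  constructor
  · rintro ⟨p, τ⟩ ⟨q, τ'⟩ h
    dsimp only at h
    have h0 := congrArg (fun σ : Equiv.Perm (Fin (n + 1)) => σ 0) h
    simp only [Equiv.Perm.mul_apply, Equiv.Perm.decomposeFin_symm_apply_zero,
      Fin.cycleRange_symm_zero] at h0
    subst h0
    have := Equiv.Perm.decomposeFin.symm.injective (mul_left_cancel h)
    simpa using this
  · simp [Fintype.card_perm, Nat.factorial_succ]

/-- Laplace expansion along the slot of the one-form: alternation of β absorbs the sign of the
residual permutation, leaving n! equal terms for every p. -/
theorem sum_sign_succ_expand {n : ℕ} (β : Form A n) (α : Form A 1) (Y : Fin (n + 1) → VF A) :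
    ∑ σ : Equiv.Perm (Fin (n + 1)), Equiv.Perm.sign σ •
      (β (fun i => Y (σ i.succ)) * contr (Y (σ 0)) α) =
    (n.factorial : ℂ) • ∑ p : Fin (n + 1),
      (-1 : A) ^ (p : ℕ) * (β (fun i => Y (p.succAbove i)) * contr (Y p) α) := by
  rw [sum_perm_fin_succ, Finset.smul_sum]
  refine Finset.sum_congr rfl fun p _ => ?_
  have h : ∀ τ : Equiv.Perm (Fin n),
      Equiv.Perm.sign (p.cycleRange.symm * Equiv.Perm.decomposeFin.symm (0, τ)) •
        (β (fun i => Y ((p.cycleRange.symm * Equiv.Perm.decomposeFin.symm (0, τ)) i.succ)) *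
          contr (Y ((p.cycleRange.symm * Equiv.Perm.decomposeFin.symm (0, τ)) 0)) α) =
      (-1 : A) ^ (p : ℕ) * (β (fun i => Y (p.succAbove i)) * contr (Y p) α) := by
    intro τ
    have h1 : (fun i : Fin n =>
        Y ((p.cycleRange.symm * Equiv.Perm.decomposeFin.symm (0, τ)) i.succ)) =
        (fun i => Y (p.succAbove i)) ∘ τ := by
      funext i
      simp [Equiv.Perm.mul_apply, Equiv.Perm.decomposeFin_symm_apply_succ]
    rw [h1, β.map_perm]
    simp only [Equiv.Perm.mul_apply, Equiv.Perm.decomposeFin_symm_apply_zero,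
      Fin.cycleRange_symm_zero, Equiv.Perm.sign_mul, Equiv.Perm.decomposeFin.symm_sign,
      Equiv.Perm.sign_symm, Fin.sign_cycleRange, if_true, one_mul]
    rw [smul_mul_assoc, smul_smul, mul_assoc, Int.units_mul_self, mul_one]
    simp [Units.smul_def]
  rw [Finset.sum_congr rfl fun τ _ => h τ, Finset.sum_const, Finset.card_univ, Fintype.card_perm,
    Fintype.card_fin, ← Nat.cast_smul_eq_nsmul ℂ]

/-- The expansion of the wedge product with a one-form on the right. -/
theorem wedge_one_right_apply {n : ℕ} (β : Form A n) (α : Form A 1) (Y : Fin (n + 1) → VF A) :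
    wedge β α Y = (-1 : A) ^ n * ∑ p : Fin (n + 1),
      (-1 : A) ^ (p : ℕ) * (β (fun i => Y (p.succAbove i)) * contr (Y p) α) := by
  have hn : (n.factorial : ℂ) ≠ 0 := by exact_mod_cast n.factorial_ne_zero
  -- The rotation moves the last slot, where the one-form sits, to the front; its sign is the
  -- prefactor (-1)^n.
  have h : ∀ σ : Equiv.Perm (Fin (n + 1)), Equiv.Perm.sign (σ * finRotate (n + 1)) •
      (β (fun i => Y ((σ * finRotate (n + 1)) (Fin.castAdd 1 i))) *
        α (fun j => Y ((σ * finRotate (n + 1)) (Fin.natAdd n j)))) =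
      (-1 : A) ^ n * (Equiv.Perm.sign σ •
        (β (fun i => Y (σ i.succ)) * contr (Y (σ 0)) α)) := by
    intro σ
    have h1 : ∀ i : Fin n, finRotate (n + 1) (Fin.castAdd 1 i) = i.succ := by
      intro i
      rw [finRotate_apply]
      exact Fin.coeSucc_eq_succ
    have h2 : ∀ j : Fin 1, finRotate (n + 1) (Fin.natAdd n j) = 0 := by
      intro j
      rw [show Fin.natAdd n j = Fin.last n by apply Fin.ext; simp]
      exact finRotate_last
    have h3 : (fun j : Fin 1 => Y (σ 0)) = ![Y (σ 0)] := by
      funext j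
      fin_cases j
      rfl
    simp only [Equiv.Perm.mul_apply, h1, h2, h3, Equiv.Perm.sign_mul, sign_finRotate]
    rw [mul_comm, mul_smul]
    simp [Units.smul_def, contr]
  rw [wedge_apply, ← Equiv.sum_comp (Equiv.mulRight (finRotate (n + 1)))]
  simp only [Equiv.coe_mulRight, h]
  rw [← Finset.mul_sum, sum_sign_succ_expand, mul_smul_comm, smul_smul]
  simp [hn]

/-- The expansion of the wedge product with a one-form on the left. -/
theorem wedge_one_left_apply {n : ℕ} (α : Form A 1) (β : Form A n) (Y : Fin (n + 1) → VF A) :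
    wedge α β (fun i => Y (Fin.cast (add_comm 1 n) i)) = ∑ p : Fin (n + 1),
      (-1 : A) ^ (p : ℕ) * (β (fun i => Y (p.succAbove i)) * contr (Y p) α) := by
  have hn : (n.factorial : ℂ) ≠ 0 := by exact_mod_cast n.factorial_ne_zero
  have h : ∀ σ : Equiv.Perm (Fin (n + 1)),
      Equiv.Perm.sign ((finCongr (add_comm n 1)).permCongr σ) •
      (α (fun i => Y (Fin.cast (add_comm 1 n)
          ((finCongr (add_comm n 1)).permCongr σ (Fin.castAdd n i)))) *
        β (fun j => Y (Fin.cast (add_comm 1 n)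
          ((finCongr (add_comm n 1)).permCongr σ (Fin.natAdd 1 j))))) =
      Equiv.Perm.sign σ • (β (fun i => Y (σ i.succ)) * contr (Y (σ 0)) α) := by
    intro σ
    have h1 : ∀ i : Fin 1, Fin.cast (add_comm 1 n)
        ((finCongr (add_comm n 1)).permCongr σ (Fin.castAdd n i)) = σ 0 := by
      intro i
      apply Fin.ext
      simp only [Equiv.permCongr_apply, finCongr_symm, finCongr_apply, Fin.val_cast]
      congr 2
      apply Fin.ext
      simp
    have h2 : ∀ j : Fin n, Fin.cast (add_comm 1 n)
        ((finCongr (add_comm n 1)).permCongr σ (Fin.natAdd 1 j)) = σ j.succ := by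
      intro j
      apply Fin.ext
      simp only [Equiv.permCongr_apply, finCongr_symm, finCongr_apply, Fin.val_cast]
      congr 2
      apply Fin.ext
      simp
    have h3 : (fun j : Fin 1 => Y (σ 0)) = ![Y (σ 0)] := by
      funext j
      fin_cases j
      rfl
    simp only [h1, h2, h3, Equiv.Perm.sign_permCongr]
    rw [mul_comm]
    rfl
  rw [wedge_apply, ← Equiv.sum_comp (finCongr (add_comm n 1)).permCongr]
  simp only [h]
  rw [sum_sign_succ_expand, smul_smul]
  simp [hn]

theorem update_vec_one {E : Type*} (Y Z : E) : Function.update ![Y] 0 Z = ![Z] := by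
  funext j
  fin_cases j
  rfl

theorem contr_add_left (Y Y' : VF A) (α : Form A 1) : contr (Y + Y') α = contr Y α + contr Y' α := by
  have := α.map_update_add ![Y] 0 Y Y'
  simp only [update_vec_one] at this
  exact this

theorem contr_smul_left (f : A) (Y : VF A) (α : Form A 1) : contr (f • Y) α = f * contr Y α := by
  have := α.map_update_smul ![Y] 0 f Y
  simp only [update_vec_one] at this
  exact this

theorem contr_dFn (Y : VF A) (f : A) : contr Y (dFn f) = Y f := rfl

theorem form_one_ext {α β : Form A 1} (h : ∀ Y, contr Y α = contr Y β) : α = β := by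
  ext Y
  have : Y = ![Y 0] := by
    funext j
    fin_cases j
    rfl
  rw [this]
  exact h (Y 0)

theorem contr_lieForm (X Y : VF A) (α : Form A 1) :
    X (contr Y α) = contr ⁅X, Y⁆ α + contr Y (lieForm X α) := by
  simp [contr, lieForm_apply, update_vec_one]

theorem lieForm_dFn (X : VF A) (f : A) : lieForm X (dFn f) = dFn (X f) := by
  refine form_one_ext fun Y => ?_
  have := contr_lieForm X Y (dFn f)
  simp only [contr_dFn, Derivation.commutator_apply] at this ⊢
  linear_combination -this

theorem dFn_mul (f g : A) : dFn (f * g) = g • dFn f + f • dFn g := by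
  refine form_one_ext fun Y => ?_
  change Y (f * g) = g * Y f + f * Y g
  rw [Derivation.leibniz, smul_eq_mul, smul_eq_mul]
  ring

theorem lieForm_zeroForm (X : VF A) (f : A) : lieForm X (zeroForm f) = zeroForm (X f) := by
  ext Y
  simp [lieForm_apply, zeroForm]

end FormCalculus

theorem sum_antidiagonal_antidiagonal_assoc {W : Type*} [AddCommMonoid W] (F : ℕ → ℕ → ℕ → W)
    (n : ℕ) :
    ∑ x ∈ antidiagonal n, ∑ y ∈ antidiagonal x.2, F x.1 y.1 y.2 =
      ∑ x ∈ antidiagonal n, ∑ y ∈ antidiagonal x.1, F y.1 y.2 x.2 := by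
  simp only [Finset.sum_sigma']
  refine Finset.sum_bij' (fun ⟨x, y⟩ _ => ⟨(x.1 + y.1, y.2), (x.1, y.1)⟩)
    (fun ⟨x, y⟩ _ => ⟨(y.1, y.2 + x.2), (y.2, x.2)⟩) ?_ ?_ ?_ ?_ ?_
  · rintro ⟨⟨a, b⟩, ⟨c, d⟩⟩ hx
    simp only [Finset.mem_sigma, Finset.HasAntidiagonal.mem_antidiagonal] at hx ⊢
    refine ⟨?_, trivial⟩
    omega
  · rintro ⟨⟨a, b⟩, ⟨c, d⟩⟩ hx
    simp only [Finset.mem_sigma, Finset.HasAntidiagonal.mem_antidiagonal] at hx ⊢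
    refine ⟨?_, trivial⟩
    omega
  · rintro ⟨⟨a, b⟩, ⟨c, d⟩⟩ hx
    simp only [Finset.mem_sigma, Finset.HasAntidiagonal.mem_antidiagonal] at hx
    obtain ⟨h1, h2⟩ := hx
    subst h2 h1
    simp
  · rintro ⟨⟨a, b⟩, ⟨c, d⟩⟩ hx
    simp only [Finset.mem_sigma, Finset.HasAntidiagonal.mem_antidiagonal] at hx
    obtain ⟨h1, h2⟩ := hx
    subst h2 h1
    simp
  · rintro ⟨⟨a, b⟩, ⟨c, d⟩⟩ hx
    rfl

/-! ### The ⋆-products of functions and forms, and their module identities -/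

section Star

variable {A : Type u} [CommRing A] [Algebra ℂ A] (T : Twist A)

theorem Twist.isAct_fn : T.IsAct (fun (X : VF A) (f : A) => X f) where
  add X f g := map_add X f g
  smul X c f := X.map_smul c f
  comm α β f := apply_apply_comm (T.commute α β) f

theorem Twist.isAct_vf : T.IsAct (fun (X : VF A) (Y : VF A) => ⁅X, Y⁆) where
  add X f g := lie_add X f g
  smul X c f := lie_smul c X f
  comm α β f := lie_lie_comm (T.commute α β) f

theorem Twist.isAct_form (k : ℕ) : T.IsAct (fun (X : VF A) (α : Form A k) => lieForm X α) where
  add X f g := lieForm_add X f g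
  smul X c f := lieForm_smul X c f
  comm α β f := lieForm_comm (T.commute α β) f

theorem Twist.isEquivariant_mul : T.IsEquivariant (fun X f => X f) (fun X f => X f)
    (fun X f => X f) (fun f g : A => f * g) where
  add_left _ _ _ := add_mul _ _ _
  add_right _ _ _ := mul_add _ _ _
  smul_left _ _ _ := smul_mul_assoc _ _ _
  smul_right _ _ _ := mul_smul_comm _ _ _
  leibniz α f g := by
    rw [Derivation.leibniz, smul_eq_mul, smul_eq_mul]
    ring

theorem Twist.isEquivariant_smul (k : ℕ) : T.IsEquivariant (fun X f => X f)
    (fun X α => lieForm X α) (fun X α => lieForm X α) (fun (f : A) (β : Form A k) => f • β) where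
  add_left _ _ _ := add_smul _ _ _
  add_right _ _ _ := smul_add _ _ _
  smul_left _ _ _ := form_smul_smul _ _ _
  smul_right _ _ _ := smul_comm _ _ _
  leibniz _ f β := lieForm_fun_smul _ f β

theorem Twist.isEquivariant_smul' (k : ℕ) : T.IsEquivariant (fun X α => lieForm X α)
    (fun X f => X f) (fun X α => lieForm X α) (fun (β : Form A k) (f : A) => f • β) where
  add_left _ _ _ := smul_add _ _ _
  add_right _ _ _ := add_smul _ _ _
  smul_left _ _ _ := smul_comm _ _ _
  smul_right _ _ _ := form_smul_smul _ _ _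
  leibniz α β f := by
    rw [lieForm_fun_smul, add_comm]

theorem Twist.isEquivariant_wedge (k l : ℕ) : T.IsEquivariant (fun X α => lieForm X α)
    (fun X α => lieForm X α) (fun X α => lieForm X α)
    (fun (α : Form A k) (β : Form A l) => wedge α β) where
  add_left := wedge_add_left
  add_right := wedge_add_right
  smul_left c α β := by
    rw [← form_smul_algebraMap, wedge_smul_left, form_smul_algebraMap]
  smul_right c α β := by
    rw [← form_smul_algebraMap, wedge_smul_right, form_smul_algebraMap]
  leibniz _ α β := lieForm_wedge _ α β

theorem Twist.isEquivariant_contr : T.IsEquivariant (fun X Y => ⁅X, Y⁆)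
    (fun X α => lieForm X α) (fun X f => X f) (fun (Y : VF A) (α : Form A 1) => contr Y α) where
  add_left := contr_add_left
  add_right _ _ _ := rfl
  smul_left c Y α := by
    rw [← algebraMap_smul A, contr_smul_left, Algebra.smul_def]
  smul_right _ _ _ := rfl
  leibniz _ Y α := contr_lieForm _ Y α

/-- The `⋆`-product `f ⋆ β` of a function and a form. -/
def Twist.starL {k : ℕ} (f : FS A) (β : FS (Form A k)) : FS (Form A k) :=
  T.deform (fun X f => X f) (fun X α => lieForm X α) (fun f β => f • β) f β

/-- The `⋆`-product `β ⋆ f` of a form and a function. -/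
def Twist.starR {k : ℕ} (β : FS (Form A k)) (f : FS A) : FS (Form A k) :=
  T.deform (fun X α => lieForm X α) (fun X f => X f) (fun β f => f • β) β f

/-- The wedge product `ϑ ∧ β = (-1)^n β ∧ ϑ` of a one-form and an `n`-form. -/
def oneWedge {n : ℕ} (ϑ : Form A 1) (β : Form A n) : Form A (n + 1) :=
  (-1 : ℂ) ^ n • wedge β ϑ

/-- The `⋆`-product of a one-form and an `n`-form. -/
def Twist.starOneWedge {n : ℕ} (ϑ : FS (Form A 1)) (β : FS (Form A n)) : FS (Form A (n + 1)) :=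
  T.deform (fun X α => lieForm X α) (fun X α => lieForm X α) oneWedge ϑ β

theorem Twist.isEquivariant_oneWedge (n : ℕ) : T.IsEquivariant (fun X α => lieForm X α)
    (fun X α => lieForm X α) (fun X α => lieForm X α)
    (fun (α : Form A 1) (β : Form A n) => oneWedge α β) where
  add_left α α' β := by simp only [oneWedge, wedge_add_right, smul_add]
  add_right α β β' := by simp only [oneWedge, wedge_add_left, smul_add]
  smul_left c α β := by
    rw [oneWedge, (T.isEquivariant_wedge n 1).smul_right, smul_comm, oneWedge]
  smul_right c α β := by
    rw [oneWedge, (T.isEquivariant_wedge n 1).smul_left, smul_comm, oneWedge]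
  leibniz _ α β := by
    rw [oneWedge, lieForm_smul, lieForm_wedge, smul_add]
    exact add_comm _ _

variable {T}

theorem Twist.starWedge_zeroForm_right {k : ℕ} (β : FS (Form A k)) (f : FS A) :
    T.starWedge β (fun n => zeroForm (f n)) = T.starR β f := by
  funext n
  symm
  exact Twist.map_deform (fun β f => f • β) wedge id zeroForm (LinearMap.id (R := ℂ))
    (fun _ _ => rfl) (fun _ _ => (lieForm_zeroForm _ _).symm)
    (fun p q => (wedge_zeroForm_right p q).symm) β f n

/-- Passing from functions to 0-forms commutes with Lie derivatives, hence with the twist. The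
comparison is on values because 0 + k is not k by definition. -/
theorem Twist.starWedge_zeroForm_left_apply {k : ℕ} (f : FS A) (β : FS (Form A k)) (n : ℕ)
    (Y : Fin (0 + k) → VF A) :
    T.starWedge (fun n => zeroForm (f n)) β n Y =
      T.starL f β n (fun i => Y (Fin.cast (zero_add k).symm i)) := by
  have h := Twist.map_deform (T := T) (actP' := fun X α => lieForm X α)
    (actQ' := fun X α => lieForm X α) (fun (f : A) (β : Form A k) => f • β)
    (fun (α : Form A 0) (β : Form A k) => wedge α β) zeroForm id
    ({ toFun := fun α => α.domDomCongr (finCongr (zero_add k).symm)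
       map_add' := fun _ _ => rfl
       map_smul' := fun _ _ => rfl } : Form A k →ₗ[ℂ] Form A (0 + k))
    (actP := fun X f => X f) (actQ := fun X α => lieForm X α)
    (fun _ _ => (lieForm_zeroForm _ _).symm) (fun _ _ => rfl)
    (fun p q => by
      ext Y
      exact (wedge_zeroForm_left p q Y).symm) f β n
  exact (congrArg (fun F : Form A (0 + k) => F Y) h).symm

theorem Twist.starL_sum_right {k : ℕ} {ι : Type*} (s : Finset ι) (f : FS A)
    (β : ι → FS (Form A k)) : T.starL f (∑ i ∈ s, β i) = ∑ i ∈ s, T.starL f (β i) :=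
  (T.isEquivariant_smul k).deform_sum_right T.isAct_fn (T.isAct_form k) (T.isAct_form k) _ _ _

theorem Twist.starR_add_left {k : ℕ} (β β' : FS (Form A k)) (f : FS A) :
    T.starR (β + β') f = T.starR β f + T.starR β' f :=
  (T.isEquivariant_smul' k).deform_add_left (T.isAct_form k) T.isAct_fn (T.isAct_form k) _ _ _

theorem Twist.starR_add_right {k : ℕ} (β : FS (Form A k)) (f f' : FS A) :
    T.starR β (f + f') = T.starR β f + T.starR β f' :=
  (T.isEquivariant_smul' k).deform_add_right (T.isAct_form k) T.isAct_fn (T.isAct_form k) _ _ _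

theorem Twist.starR_smul_left {k : ℕ} (c : ℂ) (β : FS (Form A k)) (f : FS A) :
    T.starR (c • β) f = c • T.starR β f :=
  (T.isEquivariant_smul' k).deform_smul_left (T.isAct_form k) T.isAct_fn (T.isAct_form k) _ _ _

theorem Twist.starR_sum_left {k : ℕ} {ι : Type*} (s : Finset ι) (β : ι → FS (Form A k))
    (f : FS A) : T.starR (∑ i ∈ s, β i) f = ∑ i ∈ s, T.starR (β i) f :=
  (T.isEquivariant_smul' k).deform_sum_left (T.isAct_form k) T.isAct_fn (T.isAct_form k) _ _ _

theorem Twist.starWedge_add_right {k l : ℕ} (α : FS (Form A k)) (β β' : FS (Form A l)) :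
    T.starWedge α (β + β') = T.starWedge α β + T.starWedge α β' :=
  (T.isEquivariant_wedge k l).deform_add_right (T.isAct_form k) (T.isAct_form l)
    (T.isAct_form (k + l)) _ _ _

theorem Twist.starWedge_sum_right {k l : ℕ} {ι : Type*} (s : Finset ι) (α : FS (Form A k))
    (β : ι → FS (Form A l)) : T.starWedge α (∑ i ∈ s, β i) = ∑ i ∈ s, T.starWedge α (β i) :=
  (T.isEquivariant_wedge k l).deform_sum_right (T.isAct_form k) (T.isAct_form l)
    (T.isAct_form (k + l)) _ _ _

theorem Twist.starWedge_sum_left {k l : ℕ} {ι : Type*} (s : Finset ι) (α : ι → FS (Form A k))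
    (β : FS (Form A l)) : T.starWedge (∑ i ∈ s, α i) β = ∑ i ∈ s, T.starWedge (α i) β :=
  (T.isEquivariant_wedge k l).deform_sum_left (T.isAct_form k) (T.isAct_form l)
    (T.isAct_form (k + l)) _ _ _

theorem Twist.starContr_sum_right {ι : Type*} (s : Finset ι) (Y : FS (VF A))
    (β : ι → FS (Form A 1)) : T.starContr Y (∑ i ∈ s, β i) = ∑ i ∈ s, T.starContr Y (β i) :=
  T.isEquivariant_contr.deform_sum_right T.isAct_vf (T.isAct_form 1) T.isAct_fn _ _ _

/-- This identity and the next four are undeformed associativity laws carried through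
`Twist.deform_assoc`. -/
theorem Twist.starL_starR {k : ℕ} (f : FS A) (β : FS (Form A k)) (g : FS A) :
    T.starR (T.starL f β) g = T.starL f (T.starR β g) :=
  Twist.deform_assoc T.isAct_fn (T.isAct_form k) T.isAct_fn (T.isAct_form k) (T.isAct_form k)
    (T.isAct_form k) (T.isEquivariant_smul k) (T.isEquivariant_smul' k) (T.isEquivariant_smul' k)
    (T.isEquivariant_smul k) (fun _ _ _ => smul_comm _ _ _) f β g

theorem Twist.starR_starR {k : ℕ} (β : FS (Form A k)) (f g : FS A) :
    T.starR (T.starR β f) g = T.starR β (T.starFn f g) :=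
  Twist.deform_assoc (T.isAct_form k) T.isAct_fn T.isAct_fn (T.isAct_form k) T.isAct_fn
    (T.isAct_form k) (T.isEquivariant_smul' k) (T.isEquivariant_smul' k) T.isEquivariant_mul
    (T.isEquivariant_smul' k) (fun β f g => by rw [smul_smul, mul_comm]) β f g

theorem Twist.starWedge_starR {k l : ℕ} (α : FS (Form A k)) (β : FS (Form A l)) (f : FS A) :
    T.starR (T.starWedge α β) f = T.starWedge α (T.starR β f) :=
  Twist.deform_assoc (T.isAct_form k) (T.isAct_form l) T.isAct_fn (T.isAct_form (k + l))
    (T.isAct_form l) (T.isAct_form (k + l)) (T.isEquivariant_wedge k l)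
    (T.isEquivariant_smul' (k + l)) (T.isEquivariant_smul' l) (T.isEquivariant_wedge k l)
    (fun α β f => (wedge_smul_right f α β).symm) α β f

theorem Twist.starL_starWedge {k l : ℕ} (f : FS A) (α : FS (Form A k)) (β : FS (Form A l)) :
    T.starWedge (T.starL f α) β = T.starL f (T.starWedge α β) :=
  Twist.deform_assoc T.isAct_fn (T.isAct_form k) (T.isAct_form l) (T.isAct_form k)
    (T.isAct_form (k + l)) (T.isAct_form (k + l)) (T.isEquivariant_smul k)
    (T.isEquivariant_wedge k l) (T.isEquivariant_wedge k l) (T.isEquivariant_smul (k + l))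
    (fun f α β => wedge_smul_left f α β) f α β

theorem Twist.starContr_starR (Y : FS (VF A)) (α : FS (Form A 1)) (f : FS A) :
    T.starContr Y (T.starR α f) = T.starFn (T.starContr Y α) f :=
  (Twist.deform_assoc T.isAct_vf (T.isAct_form 1) T.isAct_fn T.isAct_fn (T.isAct_form 1)
    T.isAct_fn T.isEquivariant_contr T.isEquivariant_mul (T.isEquivariant_smul' 1)
    T.isEquivariant_contr (fun Y α f => mul_comm (contr Y α) f) Y α f).symm

/-- The exterior derivative commutes with Lie derivatives, so it passes through the twist and the
ordinary Leibniz rule applies underneath. -/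
theorem Twist.dFn_starFn (f g : FS A) :
    (fun n => dFn (T.starFn f g n)) =
      T.starR (fun n => dFn (f n)) g + T.starL f (fun n => dFn (g n)) := by
  let d : A →ₗ[ℂ] Form A 1 :=
    { toFun := dFn
      map_add' := fun f g => form_one_ext fun Y => map_add Y f g
      map_smul' := fun c f => form_one_ext fun Y => Y.map_smul c f }
  have h1 : T.starR (fun n => dFn (f n)) g = T.deform (fun X f => X f) (fun X f => X f)
      (fun f g : A => g • dFn f) f g := by
    funext n
    symm
    exact Twist.map_deform (fun f g : A => g • dFn f) (fun β f => f • β) dFn id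
      (LinearMap.id (R := ℂ)) (fun _ _ => (lieForm_dFn _ _).symm) (fun _ _ => rfl)
      (fun _ _ => rfl) f g n
  have h2 : T.starL f (fun n => dFn (g n)) = T.deform (fun X f => X f) (fun X f => X f)
      (fun f g : A => f • dFn g) f g := by
    funext n
    symm
    exact Twist.map_deform (fun f g : A => f • dFn g) (fun f β => f • β) id dFn
      (LinearMap.id (R := ℂ)) (fun _ _ => rfl) (fun _ _ => (lieForm_dFn _ _).symm)
      (fun _ _ => rfl) f g n
  rw [h1, h2, ← Twist.deform_add_fun]
  funext n
  exact Twist.map_deform (fun f g : A => f * g) (fun f g : A => g • dFn f + f • dFn g) id id d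
    (fun _ _ => rfl) (fun _ _ => rfl) dFn_mul f g n

theorem Twist.deform_zero {P Q R : Type*} [AddCommGroup R] [Module ℂ R] {actP : VF A → P → P}
    {actQ : VF A → Q → Q} (B : P → Q → R) (p : FS P) (q : FS Q) :
    T.deform actP actQ B p q 0 = B (p 0) (q 0) := by
  simp [Twist.deform_apply, twistCoeff, Twist.term]

/-- The summation index b reaches n only for a = c = 0. Once that term is removed, only arguments of
order below n are left. -/
theorem deform_sub_congr_aux {R : Type*} [AddCommGroup R] (F F' : ℕ → ℕ → ℕ → R) (n : ℕ)
    (h : ∀ a b c, b < n → F a b c = F' a b c) :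
    (∑ x ∈ antidiagonal n, ∑ y ∈ antidiagonal x.2, F x.1 y.1 y.2) - F 0 n 0 =
      (∑ x ∈ antidiagonal n, ∑ y ∈ antidiagonal x.2, F' x.1 y.1 y.2) - F' 0 n 0 := by
  have key : ∀ G : ℕ → ℕ → ℕ → R,
      (∑ x ∈ antidiagonal n, ∑ y ∈ antidiagonal x.2, G x.1 y.1 y.2) - G 0 n 0 =
      ∑ x ∈ antidiagonal n, ∑ y ∈ antidiagonal x.2,
        if y.1 = n then 0 else G x.1 y.1 y.2 := by
    intro G
    rw [sub_eq_iff_eq_add]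
    have h2 : ∑ x ∈ antidiagonal n, ∑ y ∈ antidiagonal x.2,
        (if y.1 = n then G x.1 y.1 y.2 else 0) = G 0 n 0 := by
      rw [Finset.sum_eq_single (0, n), Finset.sum_eq_single (n, 0)]
      · simp
      · rintro ⟨b, c⟩ hb hne
        simp only [Finset.HasAntidiagonal.mem_antidiagonal] at hb
        rw [if_neg]
        rintro rfl
        apply hne
        ext <;> simp at hb ⊢
        omega
      · simp
      · rintro ⟨a, s⟩ ha hne
        refine Finset.sum_eq_zero ?_
        rintro ⟨b, c⟩ hb
        simp only [Finset.HasAntidiagonal.mem_antidiagonal] at hb ha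
        rw [if_neg]
        rintro rfl
        apply hne
        ext <;> simp <;> omega
      · simp
    rw [← h2, ← Finset.sum_add_distrib]
    refine Finset.sum_congr rfl fun x _ => ?_
    rw [← Finset.sum_add_distrib]
    refine Finset.sum_congr rfl fun y _ => ?_
    split_ifs <;> simp
  rw [key, key]
  refine Finset.sum_congr rfl fun x hx => Finset.sum_congr rfl fun y hy => ?_
  simp only [Finset.HasAntidiagonal.mem_antidiagonal] at hx hy
  split_ifs with hn
  · rfl
  · exact h _ _ _ (by omega)

/-- Triangularity in λ: the order-n coefficient sees the order-n part of the first argument only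
through the undeformed operation with q 0. This feeds `surjective_of_triangular`. -/
theorem Twist.deform_sub_congr_left {P Q R : Type*} [AddCommGroup R] [Module ℂ R]
    {actP : VF A → P → P} {actQ : VF A → Q → Q} (B : P → Q → R) (p p' : FS P) (q : FS Q) (n : ℕ)
    (h : ∀ m < n, p m = p' m) :
    T.deform actP actQ B p q n - B (p n) (q 0) =
      T.deform actP actQ B p' q n - B (p' n) (q 0) := by
  have := deform_sub_congr_aux
    (fun a b c => twistCoeff a • T.term actP actQ B a (p b) (q c))
    (fun a b c => twistCoeff a • T.term actP actQ B a (p' b) (q c)) n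
    (fun a b c hb => by rw [h b hb])
  simpa [twistCoeff, Twist.term, Twist.deform_apply] using this

theorem Twist.deform_sub_congr_right {P Q R : Type*} [AddCommGroup R] [Module ℂ R]
    {actP : VF A → P → P} {actQ : VF A → Q → Q} (B : P → Q → R) (p : FS P) (q q' : FS Q) (n : ℕ)
    (h : ∀ m < n, q m = q' m) :
    T.deform actP actQ B p q n - B (p 0) (q n) =
      T.deform actP actQ B p q' n - B (p 0) (q' n) := by
  have hs : ∀ q : FS Q, T.deform actP actQ B p q n =
      ∑ x ∈ antidiagonal n, ∑ y ∈ antidiagonal x.2,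
        twistCoeff x.1 • T.term actP actQ B x.1 (p y.2) (q y.1) := by
    intro q
    rw [Twist.deform_apply]
    refine Finset.sum_congr rfl fun x _ => ?_
    exact (Finset.Nat.sum_antidiagonal_swap (f := fun y =>
      twistCoeff x.1 • T.term actP actQ B x.1 (p y.2) (q y.1)))
  have := deform_sub_congr_aux
    (fun a b c => twistCoeff a • T.term actP actQ B a (p c) (q b))
    (fun a b c => twistCoeff a • T.term actP actQ B a (p c) (q' b)) n
    (fun a b c hb => by rw [h b hb])
  rw [hs, hs]
  simpa [twistCoeff, Twist.term] using this

/-- Order by order solution of triangular systems. -/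
theorem surjective_of_triangular {P R : Type*} [AddCommGroup R] (Φ : (ℕ → P) → ℕ → R) (L : P → R)
    (hL : Function.Surjective L)
    (hΦ : ∀ p p' n, (∀ m < n, p m = p' m) → Φ p n - L (p n) = Φ p' n - L (p' n)) :
    Function.Surjective Φ := by
  intro r
  obtain ⟨p₀, -⟩ := hL 0
  -- A partial solution of length n, continued by the arbitrary value p₀. The triangularity
  -- hypothesis makes the continuation irrelevant for the equation at order n.
  let ext : (n : ℕ) → ((m : ℕ) → m < n → P) → ℕ → P :=
    fun n q m => if h : m < n then q m h else p₀
  let p : ℕ → P := fun n => Nat.strongRec (motive := fun _ => P)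
    (fun n q => Function.surjInv hL (r n - (Φ (ext n q) n - L (ext n q n)))) n
  have hp : ∀ n, L (p n) = r n - (Φ (ext n fun m _ => p m) n - L (ext n (fun m _ => p m) n)) := by
    intro n
    have h1 : p n = Function.surjInv hL (r n - (Φ (ext n fun m _ => p m) n -
        L (ext n (fun m _ => p m) n))) := by
      simp only [p]
      rw [Nat.strongRec_eq]
    rw [h1]
    exact Function.surjInv_eq hL _
  refine ⟨p, funext fun n => ?_⟩
  have h := hΦ p (ext n fun m _ => p m) n fun m hm => by simp [ext, hm]
  have := hp n
  rw [← h, eq_sub_iff_add_eq] at this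
  rw [← this]
  abel

end Star

/-! ### Graded cyclicity of an invariant integral -/

section Integral

variable {A : Type u} [CommRing A] [Algebra ℂ A]

/-- The forms whose values lie in the ideal `K`. -/
def formsIn (K : Ideal A) (k : ℕ) : Submodule ℂ (Form A k) where
  carrier := {α | ∀ Y, α Y ∈ K}
  add_mem' h h' Y := K.add_mem (h Y) (h' Y)
  zero_mem' _ := K.zero_mem
  smul_mem' c α h Y := by
    rw [← form_smul_algebraMap]
    exact K.mul_mem_left _ (h Y)

theorem smul_mem_formsIn {K : Ideal A} {k : ℕ} {f : A} (hf : f ∈ K) (α : Form A k) :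
    f • α ∈ formsIn K k := fun Y => K.mul_mem_right (α Y) hf

theorem fun_smul_mem_formsIn {K : Ideal A} {k : ℕ} (f : A) {α : Form A k} (h : α ∈ formsIn K k) :
    f • α ∈ formsIn K k := fun Y => K.mul_mem_left f (h Y)

theorem wedge_mem_formsIn {K : Ideal A} {k l : ℕ} {α : Form A k} (h : α ∈ formsIn K k)
    (β : Form A l) : wedge α β ∈ formsIn K (k + l) := by
  intro Y
  rw [wedge_apply, ← algebraMap_smul A]
  refine K.mul_mem_left _ (K.sum_mem fun σ _ => ?_)
  rw [Units.smul_def]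
  exact zsmul_mem (K.mul_mem_right _ (h _)) _

theorem lieForm_mem_formsIn {K : Ideal A} {X : VF A} (hX : ∀ f ∈ K, X f ∈ K) {k : ℕ}
    {α : Form A k} (h : α ∈ formsIn K k) : lieForm X α ∈ formsIn K k := fun _ =>
  K.sub_mem (hX _ (h _)) (K.sum_mem fun _ _ => h _)

/-- The properties of integration of compactly supported top-degree forms which are used to
analyse the operator: linearity, invariance under the vector fields of the twist and
nondegeneracy. The ideal `K` is that of compactly supported functions. -/
structure Twist.IsIntegral (T : Twist A) (K : Ideal A) {D : ℕ} (I : Form A D → ℂ) : Prop where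
  mem : ∀ α f, f ∈ K → T.X α f ∈ K
  add : ∀ α β, α ∈ formsIn K D → β ∈ formsIn K D → I (α + β) = I α + I β
  smul : ∀ (c : ℂ) α, α ∈ formsIn K D → I (c • α) = c * I α
  lie : ∀ γ α, α ∈ formsIn K D → I (lieForm (T.X γ) α) = 0
  nondegenerate : ∀ α, (∀ f ∈ K, I (f • α) = 0) → α = 0

variable {T : Twist A} {K : Ideal A} {D : ℕ} {I : Form A D → ℂ} (hI : T.IsIntegral K I)
include hI

theorem Twist.IsIntegral.sum {ι : Type*} (s : Finset ι) (f : ι → Form A D)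
    (h : ∀ i ∈ s, f i ∈ formsIn K D) : I (∑ i ∈ s, f i) = ∑ i ∈ s, I (f i) := by
  classical
  induction s using Finset.induction_on with
  | empty =>
    have := hI.smul 0 0 (formsIn K D).zero_mem
    simpa using this
  | insert i s hi ih =>
    rw [Finset.sum_insert hi, Finset.sum_insert hi, hI.add _ _ (h i (by simp))
      ((formsIn K D).sum_mem fun j hj => h j (by simp [hj])), ih fun j hj => h j (by simp [hj])]

section Cyclic

variable {P Q : Type*} [AddCommGroup P] [Module ℂ P] [AddCommGroup Q] [Module ℂ Q]
  {actP : VF A → P → P} {actQ : VF A → Q → Q} {B : P → Q → Form A D}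
  (C : P → Q → Prop)

/-- The predicate C says which argument carries the compact support, for instance f ∈ K in f • β. It
has to be stable under the vector fields of the twist, so that all terms remain integrable. -/
theorem Twist.IsIntegral.term_mem (hB : ∀ p q, C p q → B p q ∈ formsIn K D)
    (hl : ∀ α p q, C p q → C (actP (T.X α) p) q) (hr : ∀ α p q, C p q → C p (actQ (T.X α) q))
    (n : ℕ) {p : P} {q : Q} (h : C p q) : T.term actP actQ B n p q ∈ formsIn K D := by
  induction n generalizing p q with
  | zero => exact hB p q h
  | succ n ih =>
    refine Submodule.sum_mem _ fun α _ => Submodule.sum_mem _ fun β _ =>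
      Submodule.smul_mem _ _ (ih ?_)
    exact hl _ _ _ (hr _ _ _ h)

/-- Integration by parts moves X_α from p to q with a minus sign. What remains contracts the
antisymmetric Θ^{αβ} with the symmetric X_α X_β acting on q. -/
theorem Twist.IsIntegral.term_succ (hP : T.IsAct actP) (hQ : T.IsAct actQ)
    (hE : T.IsEquivariant actP actQ (fun X α => lieForm X α) B)
    (hB : ∀ p q, C p q → B p q ∈ formsIn K D)
    (hl : ∀ α p q, C p q → C (actP (T.X α) p) q) (hr : ∀ α p q, C p q → C p (actQ (T.X α) q))
    (n : ℕ) {p : P} {q : Q} (h : C p q) : I (T.term actP actQ B (n + 1) p q) = 0 := by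
  have hmem : ∀ {p q}, C p q → T.term actP actQ B n p q ∈ formsIn K D := fun h =>
    hI.term_mem C hB hl hr n h
  have hflip : ∀ α β, I (T.term actP actQ B n (actP (T.X α) p) (actQ (T.X β) q)) =
      -I (T.term actP actQ B n p (actQ (T.X α) (actQ (T.X β) q))) := by
    intro α β
    have h1 := hI.lie α _ (hmem (hr β _ _ h))
    have h2 := (hE.term hP hQ (T.isAct_form D) n).leibniz α p (actQ (T.X β) q)
    rw [h2, hI.add _ _ (hmem (hl _ _ _ (hr _ _ _ h)))
      (hmem (hr _ _ _ (hr _ _ _ h)))] at h1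
    exact eq_neg_of_add_eq_zero_left h1
  have hexp : I (T.term actP actQ B (n + 1) p q) = ∑ α, ∑ β, (T.Θ α β : ℂ) *
      -I (T.term actP actQ B n p (actQ (T.X α) (actQ (T.X β) q))) := by
    have hm : ∀ α β, T.term actP actQ B n (actP (T.X α) p) (actQ (T.X β) q) ∈ formsIn K D :=
      fun α β => hmem (hl _ _ _ (hr _ _ _ h))
    simp only [Twist.term]
    rw [hI.sum _ _ fun α _ => Submodule.sum_mem _ fun β _ => Submodule.smul_mem _ _ (hm α β)]
    refine Finset.sum_congr rfl fun α _ => ?_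
    rw [hI.sum _ _ fun β _ => Submodule.smul_mem _ _ (hm α β)]
    refine Finset.sum_congr rfl fun β _ => ?_
    rw [hI.smul _ _ (hm α β), hflip]
  have hΘ : ∀ α β, T.Θ β α = -T.Θ α β := fun α β => congrFun (congrFun T.antisymm α) β
  -- Interchanging the names of α and β changes the sign of Θ and nothing else, so the integral
  -- equals its own negative.
  have hneg : I (T.term actP actQ B (n + 1) p q) = -I (T.term actP actQ B (n + 1) p q) := by
    conv_lhs => rw [hexp, Finset.sum_comm]
    rw [hexp, ← Finset.sum_neg_distrib]
    refine Finset.sum_congr rfl fun α _ => ?_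
    rw [← Finset.sum_neg_distrib]
    refine Finset.sum_congr rfl fun β _ => ?_
    rw [hΘ, hQ.comm]
    push_cast
    ring
  exact self_eq_neg.mp hneg

/-- The integral of a deformed product is that of the undeformed product. -/
theorem Twist.IsIntegral.deform (hP : T.IsAct actP) (hQ : T.IsAct actQ)
    (hE : T.IsEquivariant actP actQ (fun X α => lieForm X α) B)
    (hB : ∀ p q, C p q → B p q ∈ formsIn K D)
    (hl : ∀ α p q, C p q → C (actP (T.X α) p) q) (hr : ∀ α p q, C p q → C p (actQ (T.X α) q))
    (p : FS P) (q : FS Q) (h : ∀ a b, C (p a) (q b)) (n : ℕ) :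
    I (T.deform actP actQ B p q n) = ∑ x ∈ antidiagonal n, I (B (p x.1) (q x.2)) := by
  have hm : ∀ a i j, T.term actP actQ B a (p i) (q j) ∈ formsIn K D := fun a i j =>
    hI.term_mem C hB hl hr a (h i j)
  rw [Twist.deform_apply, hI.sum _ _ fun x _ => Submodule.sum_mem _ fun y _ =>
    Submodule.smul_mem _ _ (hm _ _ _), Finset.sum_eq_single (0, n)]
  · rw [hI.sum _ _ fun y _ => Submodule.smul_mem _ _ (hm _ _ _)]
    simp [twistCoeff, Twist.term]
  · rintro ⟨a, s⟩ ha hne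
    rw [hI.sum _ _ fun y _ => Submodule.smul_mem _ _ (hm _ _ _)]
    refine Finset.sum_eq_zero fun y _ => ?_
    obtain ⟨a, rfl⟩ : ∃ b, a = b + 1 := by
      refine Nat.exists_eq_succ_of_ne_zero ?_
      rintro rfl
      simp only [Finset.HasAntidiagonal.mem_antidiagonal, zero_add] at ha
      exact hne (by rw [ha])
    rw [hI.smul _ _ (hm _ _ _), hI.term_succ C hP hQ hE hB hl hr a (h _ _), mul_zero]
  · simp

theorem Twist.IsIntegral.deform_mem (hB : ∀ p q, C p q → B p q ∈ formsIn K D)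
    (hl : ∀ α p q, C p q → C (actP (T.X α) p) q) (hr : ∀ α p q, C p q → C p (actQ (T.X α) q))
    (p : FS P) (q : FS Q) (h : ∀ a b, C (p a) (q b)) (n : ℕ) :
    T.deform actP actQ B p q n ∈ formsIn K D :=
  Submodule.sum_mem _ fun _ _ => Submodule.sum_mem _ fun _ _ => Submodule.smul_mem _ _
    (hI.term_mem C hB hl hr _ (h _ _))

end Cyclic

theorem Twist.IsIntegral.starL_mem {k : ℕ} {f : FS A} (hf : ∀ m, f m ∈ K) (β : FS (Form A k))
    (m : ℕ) : T.starL f β m ∈ formsIn K k := by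
  have hm : ∀ n (f : A) (β : Form A k), f ∈ K →
      T.term (fun X f => X f) (fun X α => lieForm X α) (fun f β => f • β) n f β ∈ formsIn K k := by
    intro n
    induction n with
    | zero => exact fun f β h => smul_mem_formsIn h β
    | succ n ih =>
      exact fun f β h => Submodule.sum_mem _ fun α _ => Submodule.sum_mem _ fun β _ =>
        Submodule.smul_mem _ _ (ih _ _ (hI.mem _ _ h))
  exact Submodule.sum_mem _ fun _ _ => Submodule.sum_mem _ fun _ _ => Submodule.smul_mem _ _
    (hm _ _ _ (hf _))

theorem Twist.IsIntegral.starL_eq {f : FS A} (hf : ∀ m, f m ∈ K) (β : FS (Form A D)) (m : ℕ) :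
    I (T.starL f β m) = ∑ x ∈ antidiagonal m, I (f x.1 • β x.2) :=
  hI.deform (fun f _ => f ∈ K) T.isAct_fn (T.isAct_form D) (T.isEquivariant_smul D)
    (fun _ q h => smul_mem_formsIn h q) (fun _ _ _ h => hI.mem _ _ h) (fun _ _ _ h => h) f β
    (fun a _ => hf a) m

/-- Both integrals reduce to the same undeformed one. The support condition here is on the form,
since f is arbitrary. -/
theorem Twist.IsIntegral.starL_starL_comm (f : FS A) {β : FS (Form A D)}
    (hβ : ∀ m, β m ∈ formsIn K D) (m : ℕ) : I (T.starL f β m) = I (T.starR β f m) := by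
  have h1 : I (T.starL f β m) = ∑ x ∈ antidiagonal m, I (f x.1 • β x.2) :=
    hI.deform (fun _ β => β ∈ formsIn K D) T.isAct_fn (T.isAct_form D) (T.isEquivariant_smul D)
      (fun f _ h => fun_smul_mem_formsIn f h) (fun _ _ _ h => h)
      (fun _ _ _ h => lieForm_mem_formsIn (hI.mem _) h) f β (fun _ b => hβ b) m
  have h2 : I (T.starR β f m) = ∑ x ∈ antidiagonal m, I (f x.2 • β x.1) :=
    hI.deform (fun β _ => β ∈ formsIn K D) (T.isAct_form D) T.isAct_fn (T.isEquivariant_smul' D)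
      (fun _ f h => fun_smul_mem_formsIn f h)
      (fun _ _ _ h => lieForm_mem_formsIn (hI.mem _) h) (fun _ _ _ h => h) β f (fun b _ => hβ b) m
  rw [h1, h2]
  exact Finset.Nat.sum_antidiagonal_swap (f := fun x => I (f x.2 • β x.1))

-- The same argument for two forms: under the integral only the undeformed graded commutativity,
-- with its sign (-1)^n, is left.
omit hI in
theorem Twist.IsIntegral.starOneWedge_comm {n : ℕ} {I : Form A (n + 1) → ℂ}
    (hI : T.IsIntegral K I) (ϑ : FS (Form A 1)) {β : FS (Form A n)}
    (hβ : ∀ m, β m ∈ formsIn K n) (m : ℕ) :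
    I (T.starOneWedge ϑ β m) = (-1) ^ n * I (T.starWedge β ϑ m) := by
  have h1 : I (T.starOneWedge ϑ β m) = ∑ x ∈ antidiagonal m, I (oneWedge (ϑ x.1) (β x.2)) :=
    hI.deform (fun _ β => β ∈ formsIn K n) (T.isAct_form 1) (T.isAct_form n)
      (T.isEquivariant_oneWedge n)
      (fun f _ h => Submodule.smul_mem _ _ (wedge_mem_formsIn h _)) (fun _ _ _ h => h)
      (fun _ _ _ h => lieForm_mem_formsIn (hI.mem _) h) ϑ β (fun _ b => hβ b) m
  have h2 : I (T.starWedge β ϑ m) = ∑ x ∈ antidiagonal m, I (wedge (β x.1) (ϑ x.2)) :=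
    hI.deform (fun β _ => β ∈ formsIn K n) (T.isAct_form n) (T.isAct_form 1)
      (T.isEquivariant_wedge n 1)
      (fun _ f h => wedge_mem_formsIn h _)
      (fun _ _ _ h => lieForm_mem_formsIn (hI.mem _) h) (fun _ _ _ h => h) β ϑ (fun b _ => hβ b) m
  rw [h1, h2, Finset.mul_sum,
    ← Finset.Nat.sum_antidiagonal_swap (f := fun x => (-1) ^ n * I (wedge (β x.1) (ϑ x.2)))]
  refine Finset.sum_congr rfl fun x _ => ?_
  exact hI.smul _ _ (wedge_mem_formsIn (hβ _) _)

theorem Twist.IsIntegral.starOneWedge_mem {n : ℕ} (ϑ : FS (Form A 1)) {β : FS (Form A n)}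
    (hβ : ∀ m, β m ∈ formsIn K n) (m : ℕ) : T.starOneWedge ϑ β m ∈ formsIn K (n + 1) := by
  have hm : ∀ a (ϑ : Form A 1) (β : Form A n), β ∈ formsIn K n →
      T.term (fun X α => lieForm X α) (fun X α => lieForm X α) oneWedge a ϑ β ∈
        formsIn K (n + 1) := by
    intro a
    induction a with
    | zero => exact fun ϑ β h => Submodule.smul_mem _ _ (wedge_mem_formsIn h ϑ)
    | succ n ih =>
      exact fun f β h => Submodule.sum_mem _ fun α _ => Submodule.sum_mem _ fun β _ =>
        Submodule.smul_mem _ _ (ih _ _ (lieForm_mem_formsIn (hI.mem _) h))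
  exact Submodule.sum_mem _ fun _ _ => Submodule.sum_mem _ fun _ _ => Submodule.smul_mem _ _
    (hm _ _ _ (hβ _))

end Integral

/-! ### From the weak to the strong equation -/

section KeyEquation

variable {A : Type u} [CommRing A] [Algebra ℂ A] (T : Twist A) {n N : ℕ}

/-- The covariant differential of a Dirac field. -/
def Twist.covD (Om : Matrix (Fin N) (Fin N) (FS (Form A 1))) (ψ : Spinor A N) :
    Fin N → FS (Form A 1) :=
  fun i => (fun m => dFn (ψ i m)) - ∑ j, T.starR (Om i j) (ψ j)

/-- The matrix-vector `⋆`-product of a matrix-valued form with a Dirac field. -/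
def Twist.matMul {k : ℕ} (W : Matrix (Fin N) (Fin N) (FS (Form A k))) (χ : Spinor A N) :
    Fin N → FS (Form A k) :=
  fun i => ∑ j, T.starR (W i j) (χ j)

/-- The matrix-vector `∧_⋆`-product of a matrix-valued form with a column of one-forms. -/
def Twist.matWedge (U : Matrix (Fin N) (Fin N) (FS (Form A n))) (ϑ : Fin N → FS (Form A 1)) :
    Fin N → FS (Form A (n + 1)) :=
  fun i => ∑ j, T.starWedge (U i j) (ϑ j)

variable {T}

/-- Cyclicity moves χ to the far right and associativity collects W ⋆ χ. The remaining ⋆-product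
with the compactly supported φ may be replaced by the ordinary one under the integral. -/
theorem Twist.IsIntegral.trace_left {K : Ideal A} {D : ℕ} {I : Form A D → ℂ}
    (hI : T.IsIntegral K I) (W : Matrix (Fin N) (Fin N) (FS (Form A D))) (χ φ : Spinor A N)
    (hφ : ∀ j m, φ j m ∈ K) (m : ℕ) :
    I ((∑ i, T.starL (χ i) (∑ j, T.starL (φ j) (W j i))) m) =
      ∑ j, ∑ x ∈ antidiagonal m, I (φ j x.1 • T.matMul W χ j x.2) := by
  have hsum : ∀ i m, (∑ j, T.starL (φ j) (W j i)) m ∈ formsIn K D := fun i m => by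
    rw [Finset.sum_apply]
    exact Submodule.sum_mem _ fun j _ => hI.starL_mem (hφ j) _ m
  have hmem : ∀ i m, T.starL (χ i) (∑ j, T.starL (φ j) (W j i)) m ∈ formsIn K D := fun i m =>
    hI.deform_mem (fun _ β => β ∈ formsIn K D) (fun f _ h => fun_smul_mem_formsIn f h)
      (fun _ _ _ h => h) (fun _ _ _ h => lieForm_mem_formsIn (hI.mem _) h) _ _ (fun _ b => hsum i b) m
  rw [Finset.sum_apply, hI.sum _ _ fun i _ => hmem i m]
  have h1 : ∀ i, I (T.starL (χ i) (∑ j, T.starL (φ j) (W j i)) m) =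
      ∑ j, I (T.starL (φ j) (T.starR (W j i) (χ i)) m) := by
    intro i
    rw [hI.starL_starL_comm _ (hsum i), Twist.starR_sum_left, Finset.sum_apply,
      hI.sum _ _ fun j _ => by
        rw [Twist.starL_starR]
        exact hI.starL_mem (hφ j) _ m]
    simp only [Twist.starL_starR]
  simp only [h1]
  rw [Finset.sum_comm]
  refine Finset.sum_congr rfl fun j _ => ?_
  rw [← hI.starL_eq (hφ j), Twist.matMul, Twist.starL_sum_right, Finset.sum_apply,
    hI.sum _ _ fun i _ => hI.starL_mem (hφ j) _ m]

/-- As in `trace_left`; carrying the one-form ϑ past an n-form produces the sign. -/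
theorem Twist.IsIntegral.trace_right {K : Ideal A} {I : Form A (n + 1) → ℂ}
    (hI : T.IsIntegral K I) (U : Matrix (Fin N) (Fin N) (FS (Form A n))) (ϑ : Fin N → FS (Form A 1))
    (φ : Spinor A N) (hφ : ∀ j m, φ j m ∈ K) (m : ℕ) :
    I ((∑ i, T.starOneWedge (ϑ i) (∑ j, T.starL (φ j) (U j i))) m) =
      (-1) ^ n * ∑ j, ∑ x ∈ antidiagonal m, I (φ j x.1 • T.matWedge U ϑ j x.2) := by
  have hsum : ∀ i m, (∑ j, T.starL (φ j) (U j i)) m ∈ formsIn K n := fun i m => by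
    rw [Finset.sum_apply]
    exact Submodule.sum_mem _ fun j _ => hI.starL_mem (hφ j) _ m
  rw [Finset.sum_apply, hI.sum _ _ fun i _ => hI.starOneWedge_mem _ (hsum i) m]
  have h1 : ∀ i, I (T.starOneWedge (ϑ i) (∑ j, T.starL (φ j) (U j i)) m) =
      (-1) ^ n * ∑ j, I (T.starL (φ j) (T.starWedge (U j i) (ϑ i)) m) := by
    intro i
    rw [hI.starOneWedge_comm _ (hsum i), Twist.starWedge_sum_left, Finset.sum_apply,
      hI.sum _ _ fun j _ => by
        rw [Twist.starL_starWedge]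
        exact hI.starL_mem (hφ j) _ m]
    simp only [Twist.starL_starWedge]
  simp only [h1]
  rw [← Finset.mul_sum, Finset.sum_comm]
  congr 1
  refine Finset.sum_congr rfl fun j _ => ?_
  rw [← hI.starL_eq (hφ j), Twist.matWedge, Twist.starL_sum_right, Finset.sum_apply,
    hI.sum _ _ fun i _ => hI.starL_mem (hφ j) _ m]

/-- The weak equation tested against all elements of `K` is equivalent to the strong equation. -/
theorem Twist.IsIntegral.weak_iff_strong {K : Ideal A} {I : Form A (n + 1) → ℂ}
    (hI : T.IsIntegral K I) (W : Matrix (Fin N) (Fin N) (FS (Form A (n + 1))))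
    (U : Matrix (Fin N) (Fin N) (FS (Form A n))) (ϑ : Fin N → FS (Form A 1)) (χ : Spinor A N)
    (c c' : ℂ) :
    (∀ φ : Spinor A N, (∀ j m, φ j m ∈ K) → ∀ m,
      c * I ((∑ i, T.starL (χ i) (∑ j, T.starL (φ j) (W j i))) m) =
      c' * I ((∑ i, T.starOneWedge (ϑ i) (∑ j, T.starL (φ j) (U j i))) m)) ↔
    ∀ j, c • T.matMul W χ j = (c' * (-1) ^ n) • T.matWedge U ϑ j := by
  have key : ∀ φ : Spinor A N, (∀ j m, φ j m ∈ K) → ∀ m,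
      c * I ((∑ i, T.starL (χ i) (∑ j, T.starL (φ j) (W j i))) m) -
      c' * I ((∑ i, T.starOneWedge (ϑ i) (∑ j, T.starL (φ j) (U j i))) m) =
      ∑ j, ∑ x ∈ antidiagonal m, I (φ j x.1 • (c • T.matMul W χ j -
        (c' * (-1) ^ n) • T.matWedge U ϑ j) x.2) := by
    intro φ hφ m
    rw [hI.trace_left W χ φ hφ m, hI.trace_right U ϑ φ hφ m, ← mul_assoc, Finset.mul_sum,
      Finset.mul_sum, ← Finset.sum_sub_distrib]
    refine Finset.sum_congr rfl fun j _ => ?_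
    rw [Finset.mul_sum, Finset.mul_sum, ← Finset.sum_sub_distrib]
    refine Finset.sum_congr rfl fun x _ => ?_
    have hm : ∀ α : Form A (n + 1), φ j x.1 • α ∈ formsIn K (n + 1) := fun α =>
      smul_mem_formsIn (hφ j x.1) α
    simp only [Pi.sub_apply, Pi.smul_apply, sub_eq_add_neg, smul_add]
    rw [← neg_smul (c' * (-1) ^ n) (T.matWedge U ϑ j x.2), hI.add _ _ (hm _) (hm _), smul_comm (φ j x.1) c, smul_comm (φ j x.1) (-(c' * (-1) ^ n)),
      hI.smul _ _ (hm _), hI.smul _ _ (hm _)]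
    ring
  constructor
  · intro h j
    rw [← sub_eq_zero]
    funext m
    refine hI.nondegenerate _ fun f hf => ?_
    -- A test field with the single entry f at order λ⁰ in component j isolates the order-m
    -- coefficient of the j-th equation.
    let φ : Spinor A N := fun i => if i = j then Pi.single 0 f else 0
    have hφ : ∀ i m, φ i m ∈ K := by
      intro i m
      by_cases hi : i = j
      · rcases eq_or_ne m 0 with rfl | hm
        · simpa [φ, hi] using hf
        · simp [φ, hi, hm]
      · simp [φ, hi]
    have h0 : I 0 = 0 := by simpa using hI.smul 0 0 (formsIn K (n + 1)).zero_mem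
    have h1 := key φ hφ m
    rw [sub_eq_zero.mpr (h φ hφ m), Finset.sum_eq_single j, Finset.sum_eq_single (0, m)] at h1
    · simpa [φ] using h1.symm
    · rintro ⟨a, b⟩ hab hne
      have ha : a ≠ 0 := by
        rintro rfl
        simp only [Finset.HasAntidiagonal.mem_antidiagonal, zero_add] at hab
        exact hne (by rw [hab])
      simp [φ, ha, h0]
    · simp
    · intro i _ hi
      simp [φ, hi, h0]
    · simp
  · intro h φ hφ m
    have h0 : I 0 = 0 := by simpa using hI.smul 0 0 (formsIn K (n + 1)).zero_mem
    have h1 := key φ hφ m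
    simp only [h, sub_self, Pi.zero_apply, smul_zero, h0, Finset.sum_const_zero] at h1
    exact sub_eq_zero.mp h1

end KeyEquation

/-! ### Power series over the algebra of finite-order differential operators -/

section DiffOps

variable {A : Type u} [CommRing A] [Algebra ℂ A] {N : ℕ}

theorem HasOrderLE.zero (k : ℕ) : HasOrderLE k (0 : Module.End ℂ (Fin N → A)) := by
  induction k with
  | zero => intro f ψ; simp
  | succ k ih => intro f; simpa using ih

theorem HasOrderLE.add {k : ℕ} {P Q : Module.End ℂ (Fin N → A)} (hP : HasOrderLE k P)
    (hQ : HasOrderLE k Q) : HasOrderLE k (P + Q) := by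
  induction k generalizing P Q with
  | zero =>
    intro f ψ
    rw [LinearMap.add_apply, LinearMap.add_apply, hP f ψ, hQ f ψ, smul_add]
  | succ k ih =>
    intro f
    have := ih (hP f) (hQ f)
    rwa [show P * Algebra.lsmul ℂ ℂ (Fin N → A) f - Algebra.lsmul ℂ ℂ (Fin N → A) f * P +
      (Q * Algebra.lsmul ℂ ℂ (Fin N → A) f - Algebra.lsmul ℂ ℂ (Fin N → A) f * Q) =
      (P + Q) * Algebra.lsmul ℂ ℂ (Fin N → A) f - Algebra.lsmul ℂ ℂ (Fin N → A) f * (P + Q) by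
        noncomm_ring] at this

theorem HasOrderLE.commutator_eq_zero {P : Module.End ℂ (Fin N → A)} (hP : HasOrderLE 0 P)
    (f : A) : P * Algebra.lsmul ℂ ℂ (Fin N → A) f - Algebra.lsmul ℂ ℂ (Fin N → A) f * P = 0 := by
  refine LinearMap.ext fun ψ => ?_
  exact sub_eq_zero.mpr (hP f ψ)

theorem HasOrderLE.succ {k : ℕ} {P : Module.End ℂ (Fin N → A)} (hP : HasOrderLE k P) :
    HasOrderLE (k + 1) P := by
  induction k generalizing P with
  | zero =>
    intro f
    rw [hP.commutator_eq_zero]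
    exact HasOrderLE.zero 0
  | succ k ih => exact fun f => ih (hP f)

theorem HasOrderLE.mono {k l : ℕ} (h : k ≤ l) {P : Module.End ℂ (Fin N → A)}
    (hP : HasOrderLE k P) : HasOrderLE l P := by
  induction h with
  | refl => exact hP
  | step _ ih => exact ih.succ

/-- The commutator with f is a derivation, [PQ, f] = P [Q, f] + [P, f] Q, and lowers the order of
one factor; hence induction on the total order s. -/
theorem HasOrderLE.mul {s k l : ℕ} (hs : k + l = s) {P Q : Module.End ℂ (Fin N → A)}
    (hP : HasOrderLE k P) (hQ : HasOrderLE l Q) : HasOrderLE s (P * Q) := by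
  induction s generalizing k l P Q with
  | zero =>
    obtain ⟨rfl, rfl⟩ : k = 0 ∧ l = 0 := by omega
    intro f ψ
    rw [Module.End.mul_apply, hQ f ψ, hP f (Q ψ), Module.End.mul_apply]
  | succ s ih =>
    intro f
    have e : P * Q * Algebra.lsmul ℂ ℂ (Fin N → A) f - Algebra.lsmul ℂ ℂ (Fin N → A) f * (P * Q) =
        P * (Q * Algebra.lsmul ℂ ℂ (Fin N → A) f - Algebra.lsmul ℂ ℂ (Fin N → A) f * Q) +
        (P * Algebra.lsmul ℂ ℂ (Fin N → A) f - Algebra.lsmul ℂ ℂ (Fin N → A) f * P) * Q := by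
      simp only [mul_sub, sub_mul, mul_assoc]
      abel
    rw [e]
    refine HasOrderLE.add ?_ ?_
    · cases l with
      | zero =>
        rw [hQ.commutator_eq_zero, mul_zero]
        exact HasOrderLE.zero s
      | succ l => exact ih (by omega) hP (hQ f)
    · cases k with
      | zero =>
        rw [hP.commutator_eq_zero, zero_mul]
        exact HasOrderLE.zero s
      | succ k => exact ih (by omega) (hP f) hQ

theorem HasOrderLE.algebraMap (c : ℂ) :
    HasOrderLE 0 (algebraMap ℂ (Module.End ℂ (Fin N → A)) c) := by
  intro f ψ
  simp only [Module.algebraMap_end_apply]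
  exact smul_comm c f ψ

variable (A N) in
/-- The algebra of differential operators of finite order. -/
def diffOps : Subalgebra ℂ (Module.End ℂ (Fin N → A)) where
  carrier := {P | ∃ k, HasOrderLE k P}
  mul_mem' := fun ⟨_, hk⟩ ⟨_, hl⟩ => ⟨_, hk.mul rfl hl⟩
  add_mem' := fun ⟨_, hk⟩ ⟨_, hl⟩ =>
    ⟨_, (hk.mono (le_max_left _ _)).add (hl.mono (le_max_right _ _))⟩
  algebraMap_mem' c := ⟨0, HasOrderLE.algebraMap c⟩

/-- The action of a matrix of operators. -/
def matOp (F : Fin N → Fin N → A →ₗ[ℂ] A) : Module.End ℂ (Fin N → A) where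
  toFun ψ i := ∑ j, F i j (ψ j)
  map_add' ψ ψ' := by
    funext i
    simp [Finset.sum_add_distrib]
  map_smul' c ψ := by
    funext i
    simp [Finset.smul_sum]

/-- A vector field, acting on the components of a Dirac field. -/
def vfOp (X : VF A) : Module.End ℂ (Fin N → A) where
  toFun ψ i := X (ψ i)
  map_add' ψ ψ' := by
    funext i
    simp
  map_smul' c ψ := by
    funext i
    exact X.map_smul c (ψ i)

theorem vfOp_mem (X : VF A) : vfOp X ∈ diffOps A N := by
  refine ⟨1, fun f g ψ => ?_⟩
  funext i
  simp only [LinearMap.sub_apply, Module.End.mul_apply, Algebra.lsmul_coe, vfOp,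
    LinearMap.coe_mk, AddHom.coe_mk, Pi.sub_apply, Pi.smul_apply, smul_eq_mul, Derivation.leibniz]
  ring

/-- The power series of operators acting on Dirac fields. -/
def serOp (H : PowerSeries (diffOps A N)) (ψ : Spinor A N) : Spinor A N :=
  fun i m => ∑ x ∈ antidiagonal m,
    (PowerSeries.coeff x.1 H).1 (fun j => ψ j x.2) i

theorem serOp_apply (H : PowerSeries (diffOps A N)) (ψ : Spinor A N) (m : ℕ) :
    (fun i => serOp H ψ i m) = ∑ x ∈ antidiagonal m,
      (PowerSeries.coeff x.1 H).1 (fun j => ψ j x.2) := by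
  funext i
  simp [serOp, Finset.sum_apply]

theorem serOp_isDiffOp (H : PowerSeries (diffOps A N)) : IsDiffOp (serOp H) :=
  ⟨fun n => (PowerSeries.coeff n H).1,
    fun n => (PowerSeries.coeff n H).2, fun ψ m => serOp_apply H ψ m⟩

theorem serOp_mul (H H' : PowerSeries (diffOps A N)) (ψ : Spinor A N) :
    serOp (H * H') ψ = serOp H (serOp H' ψ) := by
  have h : ∀ m, (fun i => serOp (H * H') ψ i m) = fun i => serOp H (serOp H' ψ) i m := by
    intro m
    rw [serOp_apply, serOp_apply]
    simp only [serOp_apply, map_sum, PowerSeries.coeff_mul]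
    rw [sum_antidiagonal_antidiagonal_assoc (fun a b c =>
      (PowerSeries.coeff a H).1
        ((PowerSeries.coeff b H').1 fun j => ψ j c))]
    refine Finset.sum_congr rfl fun x _ => ?_
    simp [LinearMap.sum_apply]
  funext i m
  exact congrFun (h m) i

theorem serOp_one (ψ : Spinor A N) : serOp (1 : PowerSeries (diffOps A N)) ψ = ψ := by
  have h : ∀ m, (fun i => serOp (1 : PowerSeries (diffOps A N)) ψ i m) = fun i => ψ i m := by
    intro m
    rw [serOp_apply, Finset.sum_eq_single (0, m)]
    · simp
    · rintro ⟨a, b⟩ hab hne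
      have ha : a ≠ 0 := by
        rintro rfl
        simp only [Finset.HasAntidiagonal.mem_antidiagonal, zero_add] at hab
        exact hne (by rw [hab])
      simp [PowerSeries.coeff_one, ha]
    · simp
  funext i m
  exact congrFun (h m) i

theorem serOp_sub (H H' : PowerSeries (diffOps A N)) (ψ : Spinor A N) :
    serOp (H - H') ψ = serOp H ψ - serOp H' ψ := by
  funext i m
  simp [serOp, Finset.sum_sub_distrib]

theorem serOp_smul (c : ℂ) (H : PowerSeries (diffOps A N)) (ψ : Spinor A N) :
    serOp (c • H) ψ = c • serOp H ψ := by
  funext i m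
  simp [serOp, Finset.smul_sum]

section Series

variable (T : Twist A) {k : ℕ} (B : Form A k →+ (A →ₗ[ℂ] A))

/-- The terms of the deformation of `B`, as operators in the second argument. -/
def Twist.termOp : ℕ → Form A k → A →ₗ[ℂ] A
  | 0, β => B β
  | n + 1, β => ∑ α, ∑ α', (T.Θ α α' : ℂ) •
      (Twist.termOp n (lieForm (T.X α) β) ∘ₗ (T.X α' : A →ₗ[ℂ] A))

theorem Twist.termOp_apply (n : ℕ) (β : Form A k) (f : A) :
    T.termOp B n β f =
      T.term (fun X α => lieForm X α) (fun X f => X f) (fun β f => B β f) n β f := by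
  induction n generalizing β f with
  | zero => rfl
  | succ n ih => simp [Twist.termOp, Twist.term, LinearMap.sum_apply, ih]

/-- Each further power of the twist only composes with one more vector field, itself of order one.
-/
theorem Twist.matOp_termOp_mem
    (hB : ∀ W : Fin N → Fin N → Form A k, matOp (fun i j => B (W i j)) ∈ diffOps A N) (n : ℕ)
    (W : Fin N → Fin N → Form A k) : matOp (fun i j => T.termOp B n (W i j)) ∈ diffOps A N := by
  induction n generalizing W with
  | zero => exact hB W
  | succ n ih =>
    have : matOp (fun i j => T.termOp B (n + 1) (W i j)) = ∑ α, ∑ α', (T.Θ α α' : ℂ) •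
        (matOp (fun i j => T.termOp B n (lieForm (T.X α) (W i j))) * vfOp (T.X α')) := by
      refine LinearMap.ext fun ψ => ?_
      funext i
      simp only [LinearMap.sum_apply, Finset.sum_apply, LinearMap.smul_apply, Pi.smul_apply,
        Module.End.mul_apply, matOp, vfOp, LinearMap.coe_mk, AddHom.coe_mk, Twist.termOp,
        LinearMap.comp_apply, Finset.smul_sum]
      rw [Finset.sum_comm]
      refine Finset.sum_congr rfl fun α _ => ?_
      rw [Finset.sum_comm]
      rfl
    rw [this]
    exact Subalgebra.sum_mem _ fun α _ => Subalgebra.sum_mem _ fun α' _ =>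
      Subalgebra.smul_mem _ (Subalgebra.mul_mem _ (ih _) (vfOp_mem _)) _

theorem Twist.coeff_mem
    (hB : ∀ W : Fin N → Fin N → Form A k, matOp (fun i j => B (W i j)) ∈ diffOps A N)
    (W : Matrix (Fin N) (Fin N) (FS (Form A k))) (m : ℕ) :
    ∑ x ∈ antidiagonal m, twistCoeff x.1 • matOp (fun i j => T.termOp B x.1 (W i j x.2)) ∈
      diffOps A N :=
  Subalgebra.sum_mem _ fun _ _ => Subalgebra.smul_mem _ (T.matOp_termOp_mem B hB _ _) _

/-- The power series of differential operators `ψ ↦ W ⋆_B ψ`. -/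
def Twist.series
    (hB : ∀ W : Fin N → Fin N → Form A k, matOp (fun i j => B (W i j)) ∈ diffOps A N)
    (W : Matrix (Fin N) (Fin N) (FS (Form A k))) : PowerSeries (diffOps A N) :=
  PowerSeries.mk fun m => ⟨_, T.coeff_mem B hB W m⟩

/-- The twist order and the order of W are merged into one power of λ, which exhibits left
multiplication by W as a power series of operators acting on ψ. -/
theorem Twist.serOp_series
    (hB : ∀ W : Fin N → Fin N → Form A k, matOp (fun i j => B (W i j)) ∈ diffOps A N)
    (W : Matrix (Fin N) (Fin N) (FS (Form A k))) (ψ : Spinor A N) (i : Fin N) :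
    serOp (T.series B hB W) ψ i = ∑ j, T.deform (fun X α => lieForm X α) (fun X f => X f)
      (fun β f => B β f) (W i j) (ψ j) := by
  funext m
  simp only [serOp, Twist.series, PowerSeries.coeff_mk, Finset.sum_apply, Twist.deform_apply]
  have h : ∀ j, ∑ x ∈ antidiagonal m, ∑ y ∈ antidiagonal x.2, twistCoeff x.1 •
      T.term (fun X α => lieForm X α) (fun X f => X f) (fun β f => B β f) x.1 (W i j y.1)
        (ψ j y.2) = ∑ x ∈ antidiagonal m, ∑ y ∈ antidiagonal x.1, twistCoeff y.1 •
      T.term (fun X α => lieForm X α) (fun X f => X f) (fun β f => B β f) y.1 (W i j y.2)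
        (ψ j x.2) := fun j =>
    sum_antidiagonal_antidiagonal_assoc (fun a b c => twistCoeff a •
      T.term (fun X α => lieForm X α) (fun X f => X f) (fun β f => B β f) a (W i j b) (ψ j c)) m
  simp only [h]
  rw [Finset.sum_comm]
  refine Finset.sum_congr rfl fun x _ => ?_
  rw [Finset.sum_comm]
  simp only [LinearMap.sum_apply, Finset.sum_apply, LinearMap.smul_apply, Pi.smul_apply, matOp,
    LinearMap.coe_mk, AddHom.coe_mk, Twist.termOp_apply, Finset.smul_sum]

end Series

end DiffOps

/-! ### Solving the strong equation by inverting a power series -/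

section Operator

variable {A : Type u} [CommRing A] [Algebra ℂ A] {N n : ℕ} (T : Twist A)
  (E : Fin (n + 1) → VF A)

theorem form_sum_apply {k : ℕ} {ι : Type*} (s : Finset ι) (α : ι → Form A k) (Y : Fin k → VF A) :
    (∑ i ∈ s, α i) Y = ∑ i ∈ s, α i Y :=
  map_sum (AddMonoidHom.mk' (fun α : Form A k => α Y) fun _ _ => rfl) α s

/-- The evaluation of a top-degree form on a frame. -/
def evalFrame : Form A (n + 1) →ₗ[ℂ] A where
  toFun α := α E
  map_add' _ _ := rfl
  map_smul' _ _ := rfl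

/-- The operator `f ↦ (f β)(E)`. -/
def smulOp : Form A (n + 1) →+ (A →ₗ[ℂ] A) where
  toFun β :=
    { toFun := fun f => f * β E
      map_add' := fun _ _ => add_mul _ _ _
      map_smul' := fun _ _ => smul_mul_assoc _ _ _ }
  map_zero' := LinearMap.ext fun _ => mul_zero _
  map_add' _ _ := LinearMap.ext fun _ => mul_add _ _ _

theorem dFn_add (f g : A) : dFn (f + g) = dFn f + dFn g := form_one_ext fun Y => map_add Y f g

theorem dFn_smul (c : ℂ) (f : A) : dFn (c • f) = c • dFn f :=
  form_one_ext fun Y => Y.map_smul c f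

/-- The operator `f ↦ (β ∧ df)(E)`. -/
def wedgeOp : Form A n →+ (A →ₗ[ℂ] A) where
  toFun β :=
    { toFun := fun f => wedge β (dFn f) E
      map_add' := fun f g => by rw [dFn_add, wedge_add_right]; rfl
      map_smul' := fun c f => by
        rw [dFn_smul, ← form_smul_algebraMap, wedge_smul_right, form_smul_algebraMap]; rfl }
  map_zero' := LinearMap.ext fun f => by
    have : wedge (0 : Form A n) (dFn f) = 0 := by
      have := wedge_smul_left (0 : A) (0 : Form A n) (dFn f)
      simpa using this
    simp [this]
  map_add' β β' := LinearMap.ext fun f => by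
    simp only [LinearMap.coe_mk, AddHom.coe_mk, LinearMap.add_apply, wedge_add_left]
    rfl

theorem smulOp_mem (W : Fin N → Fin N → Form A (n + 1)) :
    matOp (fun i j => smulOp E (W i j)) ∈ diffOps A N := by
  refine ⟨0, fun f ψ => ?_⟩
  funext i
  simp only [matOp, smulOp, LinearMap.coe_mk, AddHom.coe_mk, AddMonoidHom.coe_mk, ZeroHom.coe_mk,
    Pi.smul_apply, smul_eq_mul, Finset.mul_sum, mul_assoc]

theorem wedgeOp_mem (U : Fin N → Fin N → Form A n) :
    matOp (fun i j => wedgeOp E (U i j)) ∈ diffOps A N := by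
  refine ⟨1, fun f g ψ => ?_⟩
  have h : ∀ (β : Form A n) (f g : A), wedge β (dFn (f * g)) E =
      g * wedge β (dFn f) E + f * wedge β (dFn g) E := by
    intro β f g
    rw [dFn_mul, wedge_add_right, wedge_smul_right, wedge_smul_right]
    rfl
  funext i
  simp only [LinearMap.sub_apply, Module.End.mul_apply, Algebra.lsmul_coe, matOp, wedgeOp,
    LinearMap.coe_mk, AddHom.coe_mk, AddMonoidHom.coe_mk, ZeroHom.coe_mk, Pi.sub_apply,
    Pi.smul_apply, smul_eq_mul, Finset.mul_sum, ← Finset.sum_sub_distrib]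
  refine Finset.sum_congr rfl fun j _ => ?_
  simp only [h]
  ring

variable {T}

/-- Evaluation on E does not commute with Lie derivatives, but it need not: it is a linear map
applied after the twist has acted on both factors, so the factors keep their own actions. -/
theorem evalFrame_matMul (W : Matrix (Fin N) (Fin N) (FS (Form A (n + 1)))) (χ : Spinor A N) :
    (fun i m => T.matMul W χ i m E) = serOp (T.series (smulOp E) (smulOp_mem E) W) χ := by
  funext i m
  rw [Twist.serOp_series, Twist.matMul]
  simp only [Finset.sum_apply, form_sum_apply]
  refine Finset.sum_congr rfl fun j _ => ?_
  exact Twist.map_deform (fun (β : Form A (n + 1)) (f : A) => f • β) (fun β f => smulOp E β f)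
    id id (evalFrame E) (fun _ _ => rfl) (fun _ _ => rfl) (fun _ _ => rfl) (W i j) (χ j) m

/-- As d commutes with Lie derivatives, β ∧_⋆ dψ is the deformation of the bilinear map (β, f) ↦ β ∧
df. It can then be read as a series of operators in ψ. -/
theorem evalFrame_matWedge_dFn (U : Matrix (Fin N) (Fin N) (FS (Form A n))) (ψ : Spinor A N) :
    (fun i m => T.matWedge U (fun j m => dFn (ψ j m)) i m E) =
      serOp (T.series (wedgeOp E) (wedgeOp_mem E) U) ψ := by
  funext i m
  rw [Twist.serOp_series, Twist.matWedge]
  simp only [Finset.sum_apply, form_sum_apply]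
  refine Finset.sum_congr rfl fun j _ => ?_
  symm
  have h : T.starWedge (U i j) (fun m => dFn (ψ j m)) = T.deform (fun X α => lieForm X α)
      (fun X f => X f) (fun (β : Form A n) (f : A) => wedge β (dFn f)) (U i j) (ψ j) := by
    funext m
    symm
    exact Twist.map_deform (fun (β : Form A n) (f : A) => wedge β (dFn f)) wedge id dFn
      (LinearMap.id (R := ℂ)) (fun _ _ => rfl) (fun _ _ => (lieForm_dFn _ _).symm)
      (fun _ _ => rfl) (U i j) (ψ j) m
  rw [h]
  symm
  exact Twist.map_deform (fun (β : Form A n) (f : A) => wedge β (dFn f))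
    (fun β f => wedgeOp E β f) id id (evalFrame E) (fun _ _ => rfl) (fun _ _ => rfl)
    (fun _ _ => rfl) (U i j) (ψ j) m

/-- The product of matrix-valued forms. -/
def Twist.matMatWedge (T : Twist A) (U : Matrix (Fin N) (Fin N) (FS (Form A n)))
    (Om : Matrix (Fin N) (Fin N) (FS (Form A 1))) : Matrix (Fin N) (Fin N) (FS (Form A (n + 1))) :=
  fun i l => ∑ j, T.starWedge (U i j) (Om j l)

theorem Twist.starWedge_sub_right {k l : ℕ} (α : FS (Form A k)) (β β' : FS (Form A l)) :
    T.starWedge α (β - β') = T.starWedge α β - T.starWedge α β' := by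
  rw [eq_sub_iff_add_eq, ← Twist.starWedge_add_right, sub_add_cancel]

theorem Twist.matWedge_covD (U : Matrix (Fin N) (Fin N) (FS (Form A n)))
    (Om : Matrix (Fin N) (Fin N) (FS (Form A 1))) (ψ : Spinor A N) (i : Fin N) :
    T.matWedge U (T.covD Om ψ) i =
      T.matWedge U (fun j m => dFn (ψ j m)) i - T.matMul (T.matMatWedge U Om) ψ i := by
  simp only [Twist.matWedge, Twist.covD, Twist.matMul, Twist.matMatWedge,
    Twist.starWedge_sub_right, Finset.sum_sub_distrib, Twist.starWedge_sum_right,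
    Twist.starR_sum_left, Twist.starWedge_starR]
  rw [Finset.sum_comm (f := fun x i_1 => T.starWedge (U i x) (T.starR (Om x i_1) (ψ i_1)))]

theorem evalFrame_matWedge_covD (U : Matrix (Fin N) (Fin N) (FS (Form A n)))
    (Om : Matrix (Fin N) (Fin N) (FS (Form A 1))) (ψ : Spinor A N) :
    (fun i m => T.matWedge U (T.covD Om ψ) i m E) =
      serOp (T.series (wedgeOp E) (wedgeOp_mem E) U -
        T.series (smulOp E) (smulOp_mem E) (T.matMatWedge U Om)) ψ := by
  rw [serOp_sub, ← evalFrame_matMul, ← evalFrame_matWedge_dFn]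
  funext i m
  rw [Twist.matWedge_covD]
  rfl

/-- A power series over a noncommutative ring is invertible on both sides as soon as its constant
coefficient is a unit, here a nonzero scalar; no inverse of a genuine differential operator is
needed. -/
theorem exists_inverse_series {R : Type*} [Ring R] [Algebra ℂ R] {S : Subalgebra ℂ R}
    {G : PowerSeries S} {w : ℂ} (hw : w ≠ 0) (hG : PowerSeries.coeff 0 G = algebraMap ℂ S w) :
    ∃ H : PowerSeries S, H * G = 1 ∧ G * H = 1 := by
  let v : Sˣ := Units.map (algebraMap ℂ S).toMonoidHom (Units.mk0 w hw)
  have h : PowerSeries.constantCoeff G = v := by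
    rw [← PowerSeries.coeff_zero_eq_constantCoeff_apply, hG]
    rfl
  exact ⟨G.invOfUnit v, PowerSeries.invOfUnit_mul G v h, PowerSeries.mul_invOfUnit G v h⟩

section Solve

variable {E} (hE : ∀ α β : Form A (n + 1), α E = β E → α = β)
  {W : Matrix (Fin N) (Fin N) (FS (Form A (n + 1)))} {w : ℂ} (hw : w ≠ 0)
  (hW : ∀ i j, W i j 0 E = algebraMap ℂ A (if i = j then w else 0))
include hE hw hW

-- At order λ⁰ only the undeformed product with W at λ = 0 is left, and on E the latter is w times
-- the identity matrix.
omit hE hw in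
theorem coeff_zero_series_smulOp :
    PowerSeries.coeff 0 (T.series (smulOp E) (smulOp_mem E) W) = algebraMap ℂ (diffOps A N) w := by
  apply Subtype.ext
  refine LinearMap.ext fun ψ => ?_
  funext i
  simp [Twist.series, twistCoeff, matOp, Twist.termOp, smulOp, hW, apply_ite, Algebra.smul_def,
    mul_comm]

/-- The left inverse gives uniqueness of χ, the right inverse gives existence. -/
theorem exists_series_inverse : ∃ H : PowerSeries (diffOps A N), ∀ χ ψ : Spinor A N,
    (∀ i m, T.matMul W χ i m E = ψ i m) ↔ χ = serOp H ψ := by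
  obtain ⟨H, h1, h2⟩ := exists_inverse_series hw
    (coeff_zero_series_smulOp (T := T) hW)
  refine ⟨H, fun χ ψ => ?_⟩
  have h3 : (∀ i m, T.matMul W χ i m E = ψ i m) ↔
      serOp (T.series (smulOp E) (smulOp_mem E) W) χ = ψ := by
    rw [← evalFrame_matMul]
    exact ⟨fun h => funext fun i => funext fun m => h i m, fun h i m => congrFun (congrFun h i) m⟩
  rw [h3]
  constructor
  · rintro rfl
    rw [← serOp_mul, h1, serOp_one]
  · rintro rfl
    rw [← serOp_mul, h2, serOp_one]

theorem existsUnique_matMul_eq (r : Fin N → FS (Form A (n + 1))) :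
    ∃! χ : Spinor A N, T.matMul W χ = r := by
  obtain ⟨H, hH⟩ := exists_series_inverse (T := T) hE hw hW
  have h : ∀ χ, T.matMul W χ = r ↔ χ = serOp H fun i m => r i m E := by
    intro χ
    rw [← hH]
    exact ⟨fun h i m => by rw [h], fun h => funext fun i => funext fun m => hE _ _ (h i m)⟩
  exact ⟨_, (h _).mpr rfl, fun χ hχ => (h χ).mp hχ⟩

/-- The equation `c W ⋆ χ = c' U ∧_⋆ d_Ω ψ` is solved by a formal differential operator. -/
theorem exists_series_solution (U : Matrix (Fin N) (Fin N) (FS (Form A n)))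
    (Om : Matrix (Fin N) (Fin N) (FS (Form A 1))) {c : ℂ} (hc : c ≠ 0) (c' : ℂ) :
    ∃ H : PowerSeries (diffOps A N), ∀ χ ψ : Spinor A N,
      (∀ j, c • T.matMul W χ j = c' • T.matWedge U (T.covD Om ψ) j) ↔ χ = serOp H ψ := by
  obtain ⟨H, hH⟩ := exists_series_inverse (T := T) hE hw hW
  refine ⟨H * ((c⁻¹ * c') • (T.series (wedgeOp E) (wedgeOp_mem E) U -
        T.series (smulOp E) (smulOp_mem E) (T.matMatWedge U Om))), fun χ ψ => ?_⟩
  rw [serOp_mul, serOp_smul, ← evalFrame_matWedge_covD, ← hH]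
  constructor
  · intro h i m
    have := congrArg (fun F : FS (Form A (n + 1)) => c⁻¹ • F m E) (h i)
    simp only [Pi.smul_apply, AlternatingMap.smul_apply, smul_smul, inv_mul_cancel₀ hc,
      one_smul] at this
    exact this
  · intro h j
    funext m
    refine hE _ _ ?_
    simp only [Pi.smul_apply, AlternatingMap.smul_apply, h j m, smul_smul]
    rw [← mul_assoc, mul_inv_cancel₀ hc, one_mul]

end Solve

end Operator

/-! ### The symbol of the operator -/

section FirstOrder

variable {A : Type u} [CommRing A] [Algebra ℂ A] {N n d : ℕ} {T : Twist A}

/-- Solved order by order in λ: the diagonal part Y ↦ (θ^b(Y))_b is onto, a preimage of f being ∑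
f_a E_a. `Pi.single 0 (θ b)` is θ^b without λ-corrections. -/
theorem exists_starContr_eq {θ : Fin d → Form A 1} {E : Fin d → VF A}
    (hdual : ∀ a b, contr (E a) (θ b) = if a = b then 1 else 0) (k : Fin d → FS A) :
    ∃ Q : FS (VF A), ∀ b, T.starContr Q (Pi.single 0 (θ b)) = k b := by
  have hs : Function.Surjective fun (Y : VF A) (b : Fin d) => contr Y (θ b) := by
    intro f
    refine ⟨∑ a, f a • E a, funext fun b => ?_⟩
    change contr (∑ a, f a • E a) (θ b) = f b
    rw [T.isEquivariant_contr.sum_left]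
    simp [contr_smul_left, hdual]
  obtain ⟨Q, hQ⟩ := surjective_of_triangular
    (fun (Q : ℕ → VF A) (m : ℕ) (b : Fin d) => T.starContr Q (Pi.single 0 (θ b)) m) _ hs
    (fun Q Q' m h => funext fun b => by
      have := Twist.deform_sub_congr_left (T := T) (actP := fun X Y => ⁅X, Y⁆)
        (actQ := fun X α => lieForm X α) contr Q Q' (Pi.single 0 (θ b)) m h
      simpa [Twist.starContr] using this) (fun m b => k b m)
  exact ⟨Q, fun b => funext fun m => congrFun (congrFun hQ m) b⟩

/-- The undeformed coframe still spans the one-forms as a right ⋆-module: the λ⁰ equation is α = ∑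
α(E_b) θ^b, and higher orders follow by triangularity. -/
theorem exists_eq_sum_starR {θ : Fin d → Form A 1} {E : Fin d → VF A}
    (hspan : ∀ Y : VF A, Y = ∑ a, contr Y (θ a) • E a) (α : FS (Form A 1)) :
    ∃ f : Fin d → FS A, α = ∑ b, T.starR (Pi.single 0 (θ b)) (f b) := by
  have hs : Function.Surjective fun (f : Fin d → A) => ∑ b, f b • θ b := by
    intro α
    refine ⟨fun b => contr (E b) α, form_one_ext fun Y => ?_⟩
    conv_rhs => rw [hspan Y, T.isEquivariant_contr.sum_left]
    simp only [contr_smul_left]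
    change (∑ b, contr (E b) α • θ b) ![Y] = _
    rw [form_sum_apply]
    exact Finset.sum_congr rfl fun b _ => mul_comm _ _
  obtain ⟨f, hf⟩ := surjective_of_triangular
    (fun (f : ℕ → Fin d → A) (m : ℕ) =>
      ∑ b, T.starR (Pi.single 0 (θ b)) (fun m => f m b) m) _ hs
    (fun f f' m h => by
      simp only [← Finset.sum_sub_distrib]
      refine Finset.sum_congr rfl fun b _ => ?_
      have := Twist.deform_sub_congr_right (T := T) (actP := fun X α => lieForm X α)
        (actQ := fun X f => X f) (fun (β : Form A 1) (f : A) => f • β) (Pi.single 0 (θ b))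
        (fun m => f m b) (fun m => f' m b) m (fun j hj => by rw [h j hj])
      simpa [Twist.starR] using this) α
  refine ⟨fun b m => f m b, funext fun m => ?_⟩
  rw [Finset.sum_apply]
  exact (congrFun hf m).symm

/-- The symbol `Q_ψ` is unique. -/
theorem starContr_dFn_injective {Q Q' : FS (VF A)}
    (h : ∀ a : FS A, T.starContr Q (fun n => dFn (a n)) = T.starContr Q' (fun n => dFn (a n))) :
    Q = Q' := by
  funext m
  induction m using Nat.strong_induction_on with
  | _ m ih =>
    -- Lower orders agree by induction; testing with f at order λ⁰ leaves only the leading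
    -- contraction, which is the value of the m-th coefficient on f.
    ext f
    have h1 := Twist.deform_sub_congr_left (T := T) (actP := fun X Y => ⁅X, Y⁆)
        (actQ := fun X α => lieForm X α) contr Q Q' (fun n => dFn ((Pi.single 0 f : FS A) n)) m ih
    have h2 := congrFun (h (Pi.single 0 f)) m
    rw [Twist.starContr, Twist.starContr] at h2
    rw [h2] at h1
    have h3 := sub_right_injective h1
    simpa [contr_dFn] using h3

variable {E : Fin (n + 1) → VF A} (hE : ∀ α β : Form A (n + 1), α E = β E → α = β)
  {W : Matrix (Fin N) (Fin N) (FS (Form A (n + 1)))} {w : ℂ} (hw : w ≠ 0)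
  (hW : ∀ i j, W i j 0 E = algebraMap ℂ A (if i = j then w else 0))
  {θ : Fin d → Form A 1} {F : Fin d → VF A}
  (hdual : ∀ a b, contr (F a) (θ b) = if a = b then 1 else 0)
  (hspan : ∀ Y : VF A, Y = ∑ a, contr Y (θ a) • F a)

theorem Twist.matMul_spinorMul (W : Matrix (Fin N) (Fin N) (FS (Form A n))) (χ : Spinor A N)
    (a : FS A) (i : Fin N) :
    T.matMul W (T.spinorMul χ a) i = T.starR (T.matMul W χ i) a := by
  simp only [Twist.matMul, Twist.spinorMul, Twist.starR_sum_left, Twist.starR_starR]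

theorem Twist.matMul_add (W : Matrix (Fin N) (Fin N) (FS (Form A n))) (χ χ' : Spinor A N) :
    T.matMul W (χ + χ') = T.matMul W χ + T.matMul W χ' := by
  funext i
  simp only [Twist.matMul, Pi.add_apply, Twist.starR_add_right, Finset.sum_add_distrib]

theorem Twist.covD_spinorMul (Om : Matrix (Fin N) (Fin N) (FS (Form A 1))) (ψ : Spinor A N)
    (a : FS A) (i : Fin N) :
    T.covD Om (T.spinorMul ψ a) i =
      T.starR (T.covD Om ψ i) a + T.starL (ψ i) (fun m => dFn (a m)) := by
  have hsub : ∀ β β' : FS (Form A 1), T.starR (β - β') a = T.starR β a - T.starR β' a := by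
    intro β β'
    rw [eq_sub_iff_add_eq, ← Twist.starR_add_left, sub_add_cancel]
  simp only [Twist.covD, Twist.spinorMul, Twist.dFn_starFn, hsub, Twist.starR_sum_left,
    Twist.starR_starR]
  abel

theorem Twist.starL_sum_right_form (ψ : Spinor A N) (U : Matrix (Fin N) (Fin N) (FS (Form A n)))
    (s : Fin d → FS (Form A 1)) (i : Fin N) :
    T.matWedge U (fun k => T.starL (ψ k) (∑ b, s b)) i =
      ∑ b, T.matWedge U (fun k => T.starL (ψ k) (s b)) i := by
  simp only [Twist.matWedge, Twist.starL_sum_right, Twist.starWedge_sum_right]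
  rw [Finset.sum_comm]

include hE hw hW hdual hspan in
/-- A solution operator of `c W ⋆ χ = c' U ∧_⋆ d_Ω ψ` is a first-order operator. -/
theorem exists_symbol (U : Matrix (Fin N) (Fin N) (FS (Form A n)))
    (Om : Matrix (Fin N) (Fin N) (FS (Form A 1))) {c : ℂ} (hc : c ≠ 0) (c' : ℂ)
    {Dop : Spinor A N → Spinor A N}
    (hD : ∀ ψ j, c • T.matMul W (Dop ψ) j = c' • T.matWedge U (T.covD Om ψ) j) (ψ : Spinor A N) :
    ∃ Q : Fin N → FS (VF A), ∀ a : FS A,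
      Dop (T.spinorMul ψ a) = T.spinorMul (Dop ψ) a + T.spinorContr Q (fun n => dFn (a n)) := by
  have hsolve := fun r => existsUnique_matMul_eq (T := T) hE hw hW r
  have hinj : ∀ χ χ', T.matMul W χ = T.matMul W χ' → χ = χ' := fun χ χ' h =>
    (hsolve (T.matMul W χ')).unique h rfl
  -- By the Leibniz rule for d_Ω, the failure of Dop to be right ⋆-linear is κ(da). Uniqueness of
  -- solutions makes κ additive and right ⋆-linear.
  choose κ hκ _ using fun α : FS (Form A 1) =>
    hsolve ((c⁻¹ * c') • T.matWedge U fun k => T.starL (ψ k) α)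
  have hκR : ∀ α f, κ (T.starR α f) = T.spinorMul (κ α) f := by
    intro α f
    refine hinj _ _ (funext fun i => ?_)
    rw [Twist.matMul_spinorMul, hκ, hκ, Pi.smul_apply, Pi.smul_apply, Twist.starR_smul_left]
    congr 1
    simp only [Twist.matWedge, Twist.starR_sum_left, Twist.starWedge_starR, Twist.starL_starR]
  have hκsum : ∀ s : Fin d → FS (Form A 1), κ (∑ b, s b) = ∑ b, κ (s b) := by
    intro s
    refine hinj _ _ ?_
    have : T.matMul W (∑ b, κ (s b)) = ∑ b, T.matMul W (κ (s b)) :=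
      map_sum (AddMonoidHom.mk' (T.matMul W) (Twist.matMul_add W)) _ _
    rw [this, hκ]
    simp only [hκ, ← Finset.smul_sum]
    congr 1
    funext i
    rw [Twist.starL_sum_right_form, Finset.sum_apply]
  -- Q is prescribed on the coframe. Contraction with Q and κ are both right ⋆-linear, so they agree
  -- on all one-forms.
  choose Q hQ using fun i : Fin N =>
    exists_starContr_eq (T := T) hdual fun b => κ (Pi.single 0 (θ b)) i
  have hκQ : ∀ α, κ α = T.spinorContr Q α := by
    intro α
    obtain ⟨f, rfl⟩ := exists_eq_sum_starR (T := T) hspan α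
    rw [hκsum]
    funext i
    simp only [Finset.sum_apply, hκR, Twist.spinorContr, Twist.spinorMul,
      Twist.starContr_sum_right, Twist.starContr_starR, hQ]
  refine ⟨Q, fun a => ?_⟩
  rw [← hκQ]
  have hD' : ∀ ψ i, T.matMul W (Dop ψ) i = (c⁻¹ * c') • T.matWedge U (T.covD Om ψ) i := by
    intro ψ i
    rw [mul_smul, ← hD, smul_smul, inv_mul_cancel₀ hc, one_smul]
  refine hinj _ _ (funext fun i => ?_)
  rw [Twist.matMul_add, Pi.add_apply, Twist.matMul_spinorMul, hκ, hD', hD', Pi.smul_apply,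
    Twist.starR_smul_left, ← smul_add]
  congr 1
  simp only [Twist.matWedge, Twist.covD_spinorMul, Twist.starWedge_add_right,
    Finset.sum_add_distrib, Twist.starR_sum_left, Twist.starWedge_starR]

end FirstOrder

/-! ### Derivations and top forms in charts -/

section SmoothFunctions

variable {D : ℕ} {M : Type u} [TopologicalSpace M] [ChartedSpace (EuclideanSpace ℝ (Fin D)) M]

theorem Fn.ext {f g : Fn D M} (h : ∀ x, f x = g x) : f = g := Subtype.ext (funext h)

/-- The evaluation of functions at a point. -/
def evalHom (p : M) : Fn D M →+* ℂ where
  toFun f := f p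
  map_one' := rfl
  map_mul' _ _ := rfl
  map_zero' := rfl
  map_add' _ _ := rfl

theorem evalHom_apply (p : M) (f : Fn D M) : evalHom p f = f p := rfl

theorem Fn.sum_apply {ι : Type*} (s : Finset ι) (f : ι → Fn D M) (p : M) :
    (∑ i ∈ s, f i) p = ∑ i ∈ s, f i p := map_sum (evalHom p) f s

theorem Fn.mul_apply (f g : Fn D M) (p : M) : (f * g) p = f p * g p := rfl

theorem Fn.algebraMap_apply (c : ℂ) (p : M) : (algebraMap ℂ (Fn D M) c) p = c := rfl

variable (D M) in
/-- The ideal of compactly supported functions. -/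
def compactIdeal : Ideal (Fn D M) where
  carrier := {f | HasCompactSupport (f : M → ℂ)}
  add_mem' hf hg := HasCompactSupport.add hf hg
  zero_mem' := HasCompactSupport.zero
  smul_mem' f _ hg := HasCompactSupport.mul_left (f := f.1) hg

/-- The partial derivatives of a function in a chart. -/
def partialDeriv (e : OpenPartialHomeomorph M (EuclideanSpace ℝ (Fin D))) (q : M) (k : Fin D)
    (f : M → ℂ) : ℂ :=
  fderiv ℝ (f ∘ e.symm) (e q) (EuclideanSpace.single k 1)

theorem partialDeriv_congr {e : OpenPartialHomeomorph M (EuclideanSpace ℝ (Fin D))} {q : M}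
    (hq : q ∈ e.source) (k : Fin D) {f g : M → ℂ} (h : f =ᶠ[𝓝 q] g) :
    partialDeriv e q k f = partialDeriv e q k g := by
  have h1 : Filter.Tendsto e.symm (𝓝 (e q)) (𝓝 q) := by
    have := e.continuousAt_symm (e.map_source hq)
    rwa [ContinuousAt, e.left_inv hq] at this
  have : f ∘ e.symm =ᶠ[𝓝 (e q)] g ∘ e.symm := h1.eventually h
  rw [partialDeriv, this.fderiv_eq, partialDeriv]

theorem partialDeriv_coord {e : OpenPartialHomeomorph M (EuclideanSpace ℝ (Fin D))} {q : M}
    (hq : q ∈ e.source) (k j : Fin D) {x : M → ℂ} (h : ∀ᶠ p in 𝓝 q, x p = ((e p j : ℝ) : ℂ)) :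
    partialDeriv e q k x = if k = j then 1 else 0 := by
  have h1 : Filter.Tendsto e.symm (𝓝 (e q)) (𝓝 q) := by
    have := e.continuousAt_symm (e.map_source hq)
    rwa [ContinuousAt, e.left_inv hq] at this
  let L : EuclideanSpace ℝ (Fin D) →L[ℝ] ℂ := Complex.ofRealCLM.comp (EuclideanSpace.proj j)
  have h2 : x ∘ e.symm =ᶠ[𝓝 (e q)] L := by
    filter_upwards [h1.eventually h, e.open_target.mem_nhds (e.map_source hq)] with y hy hy'
    simp only [Function.comp_apply, hy, e.right_inv hy', L]
    rfl
  rw [partialDeriv, h2.fderiv_eq, L.fderiv]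
  by_cases hkj : k = j <;> simp [L, hkj, eq_comm]

variable [IsManifold (𝓡 D) ∞ M]

theorem contDiffOn_comp_symm {e : OpenPartialHomeomorph M (EuclideanSpace ℝ (Fin D))}
    (he : e ∈ atlas (EuclideanSpace ℝ (Fin D)) M) (f : Fn D M) :
    ContDiffOn ℝ ∞ (f ∘ e.symm) e.target := by
  have h1 := contMDiffOn_symm_of_mem_maximalAtlas (I := 𝓡 D) (n := ∞)
    (IsManifold.subset_maximalAtlas he)
  exact contMDiffOn_iff_contDiffOn.mp (ContMDiff.comp_contMDiffOn f.2 h1)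

/-- The extension by zero of a function in a chart, multiplied by a bump function. -/
def bumpExtend (b : C^∞⟮𝓡 D, M; 𝓘(ℝ), ℝ⟯) {e : OpenPartialHomeomorph M (EuclideanSpace ℝ (Fin D))}
    (he : e ∈ atlas (EuclideanSpace ℝ (Fin D)) M) (hb : tsupport b ⊆ e.source)
    {g : EuclideanSpace ℝ (Fin D) → ℂ} (hg : ContDiffOn ℝ ∞ g e.target) : Fn D M :=
  ⟨fun q => (b q : ℂ) * g (e q), by
    have hbs : ContMDiff (𝓡 D) 𝓘(ℝ, ℂ) ∞ fun q => (b q : ℂ) :=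
      (Complex.ofRealCLM.contDiff (n := ∞)).comp_contMDiff b.contMDiff
    refine contMDiff_of_tsupport fun q hq => ?_
    have hq' : q ∈ e.source := by
      refine hb (closure_mono ?_ hq)
      intro p hp
      rw [Function.mem_support] at hp ⊢
      intro h0
      exact hp (by rw [h0]; simp)
    have h1 : ContMDiffOn (𝓡 D) 𝓘(ℝ, ℂ) ∞ (fun q => g (e q)) e.source :=
      (contMDiffOn_iff_contDiffOn.mpr hg).comp
        (contMDiffOn_of_mem_maximalAtlas (I := 𝓡 D) (n := ∞) (IsManifold.subset_maximalAtlas he))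
        fun p hp => e.map_source hp
    have h2 := h1.contMDiffAt (e.open_source.mem_nhds hq')
    exact (contDiff_fst.mul contDiff_snd :
      ContDiff ℝ ∞ fun p : ℂ × ℂ => p.1 * p.2).contMDiff.contMDiffAt.comp q
        ((hbs q).prodMk_space h2)⟩

theorem bumpExtend_apply (b : C^∞⟮𝓡 D, M; 𝓘(ℝ), ℝ⟯)
    {e : OpenPartialHomeomorph M (EuclideanSpace ℝ (Fin D))}
    (he : e ∈ atlas (EuclideanSpace ℝ (Fin D)) M) (hb : tsupport b ⊆ e.source)
    {g : EuclideanSpace ℝ (Fin D) → ℂ} (hg : ContDiffOn ℝ ∞ g e.target) (q : M) :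
    bumpExtend b he hb hg q = (b q : ℂ) * g (e q) := rfl

theorem contDiffOn_fderiv_comp_symm {e : OpenPartialHomeomorph M (EuclideanSpace ℝ (Fin D))}
    (he : e ∈ atlas (EuclideanSpace ℝ (Fin D)) M) (f : Fn D M) (v : EuclideanSpace ℝ (Fin D)) :
    ContDiffOn ℝ ∞ (fun y => fderiv ℝ (f ∘ e.symm) y v) e.target := by
  have h := (contDiffOn_comp_symm he f).fderiv_of_isOpen (m := ∞) e.open_target (by simp)
  exact h.clm_apply contDiffOn_const

/-- The coordinate vector fields of a chart, multiplied by a bump function. -/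
def bumpPartial (b : C^∞⟮𝓡 D, M; 𝓘(ℝ), ℝ⟯) {e : OpenPartialHomeomorph M (EuclideanSpace ℝ (Fin D))}
    (he : e ∈ atlas (EuclideanSpace ℝ (Fin D)) M) (hb : tsupport b ⊆ e.source) (k : Fin D) :
    VF (Fn D M) :=
  Derivation.mk'
    { toFun := fun f => bumpExtend b he hb
        (contDiffOn_fderiv_comp_symm he f (EuclideanSpace.single k 1))
      map_add' := fun f g => Fn.ext fun q => by
        -- Outside the chart domain the derivative of `f ∘ e.symm` is meaningless, but the bump
        -- function vanishes there. The same split is used for scalars and for the product rule.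
        by_cases hq : q ∈ e.source
        · have hd : ∀ f : Fn D M, DifferentiableAt ℝ (f ∘ e.symm) (e q) := fun f =>
            ((contDiffOn_comp_symm he f).contDiffAt
              (e.open_target.mem_nhds (e.map_source hq))).differentiableAt (by simp)
          change (b q : ℂ) * fderiv ℝ ((f ∘ e.symm) + (g ∘ e.symm)) (e q) _ = (b q : ℂ) * _ + (b q : ℂ) * _
          rw [fderiv_add (hd f) (hd g), ← mul_add]
          rfl
        · have hb0 : b q = 0 := image_eq_zero_of_notMem_tsupport fun h => hq (hb h)
          change (b q : ℂ) * _ = (b q : ℂ) * _ + (b q : ℂ) * _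
          simp [hb0]
      map_smul' := fun c f => Fn.ext fun q => by
        by_cases hq : q ∈ e.source
        · have hd : DifferentiableAt ℝ (f ∘ e.symm) (e q) :=
            ((contDiffOn_comp_symm he f).contDiffAt
              (e.open_target.mem_nhds (e.map_source hq))).differentiableAt (by simp)
          change (b q : ℂ) * fderiv ℝ (c • (f ∘ e.symm)) (e q) _ = c * ((b q : ℂ) * _)
          rw [fderiv_const_smul hd c, mul_left_comm]
          rfl
        · have hb0 : b q = 0 := image_eq_zero_of_notMem_tsupport fun h => hq (hb h)
          change (b q : ℂ) * _ = c * ((b q : ℂ) * _)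
          simp [hb0] }
    fun f g => Fn.ext fun q => by
      by_cases hq : q ∈ e.source
      · have hd : ∀ f : Fn D M, DifferentiableAt ℝ (f ∘ e.symm) (e q) := fun f =>
          ((contDiffOn_comp_symm he f).contDiffAt
            (e.open_target.mem_nhds (e.map_source hq))).differentiableAt (by simp)
        change (b q : ℂ) * fderiv ℝ ((f ∘ e.symm) * (g ∘ e.symm)) (e q) _ =
          f q * ((b q : ℂ) * fderiv ℝ (g ∘ e.symm) (e q) _) +
          g q * ((b q : ℂ) * fderiv ℝ (f ∘ e.symm) (e q) _)
        rw [fderiv_mul (hd f) (hd g)]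
        simp only [Function.comp_apply, e.left_inv hq, add_apply,
          smul_apply, smul_eq_mul]
        ring
      · have hb0 : b q = 0 := image_eq_zero_of_notMem_tsupport fun h => hq (hb h)
        change (b q : ℂ) * _ = f q * ((b q : ℂ) * _) + g q * ((b q : ℂ) * _)
        simp [hb0]

theorem bumpPartial_apply (b : C^∞⟮𝓡 D, M; 𝓘(ℝ), ℝ⟯)
    {e : OpenPartialHomeomorph M (EuclideanSpace ℝ (Fin D))}
    (he : e ∈ atlas (EuclideanSpace ℝ (Fin D)) M) (hb : tsupport b ⊆ e.source) (k : Fin D)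
    (f : Fn D M) (q : M) :
    bumpPartial b he hb k f q = (b q : ℂ) * partialDeriv e q k f := rfl

variable [T2Space M] [SigmaCompactSpace M]

theorem exists_bump {e : OpenPartialHomeomorph M (EuclideanSpace ℝ (Fin D))} {C : Set M}
    (hC : IsCompact C) (hCe : C ⊆ e.source) :
    ∃ b : C^∞⟮𝓡 D, M; 𝓘(ℝ), ℝ⟯, tsupport b ⊆ e.source ∧ ∀ᶠ q in 𝓝ˢ C, b q = 1 := by
  have : LocallyCompactSpace M := Manifold.locallyCompact_of_finiteDimensional (𝓡 D)
  obtain ⟨b, h0, h1, -⟩ := exists_contMDiffMap_zero_one_nhds_of_isClosed (𝓡 D) (n := (⊤ : ℕ∞))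
    (s := e.sourceᶜ) (t := C) e.open_source.isClosed_compl hC.isClosed
    (Set.disjoint_compl_left_iff_subset.mpr hCe)
  refine ⟨b, ?_, h1⟩
  intro q hq
  by_contra hqe
  have : ∀ᶠ p in 𝓝 q, b p = 0 := Filter.eventually_of_mem
    (nhds_le_nhdsSet (show q ∈ e.sourceᶜ from hqe) h0) fun p hp => hp
  exact (notMem_tsupport_iff_eventuallyEq.mpr this) hq

/-- Global representatives, over an open set `O` in the domain of a chart, of the coordinate
functions and coordinate vector fields. -/
structure IsCoord (e : OpenPartialHomeomorph M (EuclideanSpace ℝ (Fin D))) (O : Set M)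
    (x : Fin D → Fn D M) (d : Fin D → VF (Fn D M)) : Prop where
  isOpen : IsOpen O
  subset : O ⊆ e.source
  coord : ∀ q ∈ O, ∀ j, x j q = ((e q j : ℝ) : ℂ)
  deriv : ∀ q ∈ O, ∀ k f, d k f q = partialDeriv e q k f

/-- A bump function equal to 1 on a neighbourhood of C lets coordinates and coordinate fields extend
by zero to all of M without being changed near C. -/
theorem exists_isCoord {e : OpenPartialHomeomorph M (EuclideanSpace ℝ (Fin D))}
    (he : e ∈ atlas (EuclideanSpace ℝ (Fin D)) M) {C : Set M} (hC : IsCompact C)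
    (hCe : C ⊆ e.source) : ∃ O x d, C ⊆ O ∧ IsCoord e O x d := by
  obtain ⟨b, hb, hb1⟩ := exists_bump hC hCe
  obtain ⟨O, hO, hCO, hO1⟩ := mem_nhdsSet_iff_exists.mp hb1
  have hx : ∀ j : Fin D, ContDiffOn ℝ ∞ (fun y : EuclideanSpace ℝ (Fin D) => ((y j : ℝ) : ℂ))
      e.target := fun j =>
    (Complex.ofRealCLM.comp (EuclideanSpace.proj (𝕜 := ℝ) j)).contDiff.contDiffOn
  refine ⟨O, fun j => bumpExtend b he hb (hx j), fun k => bumpPartial b he hb k, hCO, hO, ?_, ?_,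
    ?_⟩
  · intro q hq
    refine hb (subset_tsupport _ ?_)
    rw [Function.mem_support, show b q = 1 from hO1 hq]
    exact one_ne_zero
  · intro q hq j
    rw [bumpExtend_apply, show b q = 1 from hO1 hq]
    simp
  · intro q hq k f
    rw [bumpPartial_apply, show b q = 1 from hO1 hq]
    simp

theorem IsCoord.eventually_coord {e : OpenPartialHomeomorph M (EuclideanSpace ℝ (Fin D))}
    {O : Set M} {x : Fin D → Fn D M} {d : Fin D → VF (Fn D M)} (h : IsCoord e O x d) {q : M}
    (hq : q ∈ O) (j : Fin D) : ∀ᶠ p in 𝓝 q, x j p = ((e p j : ℝ) : ℂ) :=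
  Filter.eventually_of_mem (h.isOpen.mem_nhds hq) fun p hp => h.coord p hp j

section Frame

variable {θ : Fin D → Form (Fn D M) 1} {E : Fin D → VF (Fn D M)} (hE : IsInverseFrame θ E)
include hE

/-- The basis of vector fields given by a frame. -/
def IsInverseFrame.basis : Module.Basis (Fin D) (Fn D M) (VF (Fn D M)) :=
  Module.Basis.ofEquivFun
    { toFun := fun Y a => contr Y (θ a)
      invFun := fun f => ∑ a, f a • E a
      map_add' := fun Y Y' => funext fun a => contr_add_left Y Y' (θ a)
      map_smul' := fun f Y => funext fun a => contr_smul_left f Y (θ a)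
      left_inv := fun Y => (hE.2 Y).symm
      right_inv := fun f => funext fun b => by
        have h : ∀ s : Finset (Fin D), contr (∑ a ∈ s, f a • E a) (θ b) =
            ∑ a ∈ s, contr (f a • E a) (θ b) := fun s =>
          map_sum (AddMonoidHom.mk' (fun Y => contr Y (θ b))
            fun Y Y' => contr_add_left Y Y' (θ b)) _ s
        refine (h Finset.univ).trans ?_
        simp [contr_smul_left, hE.1] }

theorem IsInverseFrame.basis_apply (a : Fin D) : hE.basis a = E a := by
  simp [IsInverseFrame.basis, Pi.single_apply, ite_smul]

theorem IsInverseFrame.form_apply (α : Form (Fn D M) D) (Y : Fin D → VF (Fn D M)) :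
    α Y = α E * Matrix.det (Matrix.of fun i a => contr (Y i) (θ a)) := by
  have h := α.eq_smul_basis_det hE.basis
  have h' : α Y = α hE.basis * hE.basis.det Y := congrArg (fun β : Form (Fn D M) D => β Y) h
  rw [h', Module.Basis.det_apply, ← Matrix.det_transpose]
  congr 1
  exact congrArg α (funext hE.basis_apply)

theorem IsInverseFrame.form_ext {α β : Form (Fn D M) D} (h : α E = β E) : α = β := by
  ext Y
  rw [hE.form_apply α Y, hE.form_apply β Y, h]

theorem IsInverseFrame.apply_eq_sum (Y : VF (Fn D M)) (f : Fn D M) :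
    Y f = ∑ a, contr Y (θ a) * E a f := by
  conv_lhs => rw [hE.2 Y]
  have h : ∀ s : Finset (Fin D), (∑ a ∈ s, contr Y (θ a) • E a) f =
      ∑ a ∈ s, (contr Y (θ a) • E a) f := fun s =>
    map_sum (AddMonoidHom.mk' (fun Z : VF (Fn D M) => Z f) fun _ _ => rfl) _ s
  rw [h]
  rfl

variable {e : OpenPartialHomeomorph M (EuclideanSpace ℝ (Fin D))} {O : Set M}
  {x : Fin D → Fn D M} {d : Fin D → VF (Fn D M)} (h : IsCoord e O x d) {q : M} (hq : q ∈ O)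
include h hq

/-- Expanding d_k in the frame and applying it to x^j gives the identity, because d_k(x^j) = δ_k^j
on O. -/
theorem IsInverseFrame.coord_mul :
    (Matrix.of fun k a => contr (d k) (θ a) q) * (Matrix.of fun a j => E a (x j) q) = 1 := by
  ext k j
  have h1 : d k (x j) q = if k = j then 1 else 0 := by
    rw [h.deriv q hq, partialDeriv_coord (h.subset hq) k j (h.eventually_coord hq j)]
  rw [hE.apply_eq_sum, Fn.sum_apply] at h1
  rw [Matrix.mul_apply, Matrix.one_apply, ← h1]
  rfl

theorem IsInverseFrame.mul_coord :
    (Matrix.of fun a j => E a (x j) q) * (Matrix.of fun k a => contr (d k) (θ a) q) = 1 :=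
  mul_eq_one_comm.mp (hE.coord_mul h hq)

/-- Every derivation is a first-order differential operator in a chart. -/
theorem IsInverseFrame.apply_eq_partialDeriv (Y : VF (Fn D M)) (f : Fn D M) :
    Y f q = ∑ k, Y (x k) q * partialDeriv e q k f := by
  -- An abstract derivation is known only through the global frame. Since the coordinate fields are
  -- derivations too, inverting their frame components expresses E_a, and with it Y, by partial
  -- derivatives.
  have hE' : ∀ a, E a f q = ∑ k, E a (x k) q * partialDeriv e q k f := by
    intro a
    have h1 : ∀ k, partialDeriv e q k f = ∑ b, contr (d k) (θ b) q * E b f q := by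
      intro k
      rw [← h.deriv q hq, hE.apply_eq_sum, Fn.sum_apply]
      rfl
    simp only [h1, Finset.mul_sum]
    rw [Finset.sum_comm]
    have h2 : ∀ b, ∑ k, E a (x k) q * (contr (d k) (θ b) q * E b f q) =
        (if a = b then 1 else 0) * E b f q := by
      intro b
      have h3 := congrFun (congrFun (hE.mul_coord h hq) a) b
      rw [Matrix.mul_apply, Matrix.one_apply] at h3
      rw [← h3, Finset.sum_mul]
      exact Finset.sum_congr rfl fun k _ => (mul_assoc _ _ _).symm
    simp [h2]
  rw [hE.apply_eq_sum, Fn.sum_apply]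
  simp only [Fn.mul_apply, hE']
  have h4 : ∀ k, Y (x k) q = ∑ a, contr Y (θ a) q * E a (x k) q := by
    intro k
    rw [hE.apply_eq_sum, Fn.sum_apply]
    rfl
  simp only [h4, Finset.mul_sum, Finset.sum_mul]
  rw [Finset.sum_comm]
  simp only [mul_assoc]

theorem IsInverseFrame.apply_congr (Y : VF (Fn D M)) {f g : Fn D M}
    (hfg : ∀ᶠ p in 𝓝 q, f p = g p) : Y f q = Y g q := by
  rw [hE.apply_eq_partialDeriv h hq, hE.apply_eq_partialDeriv h hq]
  exact Finset.sum_congr rfl fun k _ => by rw [partialDeriv_congr (h.subset hq) k hfg]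

/-- Both sides are α(E) times determinants of frame components; the matrix Y_i(x^j) factors through
the frame, and `coord_mul` supplies the inverse determinant of the coordinate fields. -/
theorem IsInverseFrame.form_apply_coord (α : Form (Fn D M) D) (Y : Fin D → VF (Fn D M)) :
    α Y q = α d q * Matrix.det (Matrix.of fun i j => Y i (x j) q) := by
  have hdet : ∀ Y : Fin D → VF (Fn D M),
      (Matrix.det (Matrix.of fun i a => contr (Y i) (θ a))) q =
        Matrix.det (Matrix.of fun i a => contr (Y i) (θ a) q) := by
    intro Y
    rw [← evalHom_apply, RingHom.map_det]
    rfl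
  have hmul : (Matrix.of fun i j => Y i (x j) q) =
      (Matrix.of fun i a => contr (Y i) (θ a) q) * (Matrix.of fun a j => E a (x j) q) := by
    ext i j
    rw [Matrix.mul_apply, Matrix.of_apply, hE.apply_eq_sum, Fn.sum_apply]
    rfl
  have h1 := congrArg Matrix.det (hE.coord_mul h hq)
  rw [Matrix.det_mul, Matrix.det_one] at h1
  rw [hE.form_apply α Y, hE.form_apply α d, Fn.mul_apply, Fn.mul_apply, hdet, hdet, hmul,
    Matrix.det_mul]
  linear_combination (-(α E q) * Matrix.det (Matrix.of fun i a => contr (Y i) (θ a) q)) * h1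

-- The property in the definition of `chartCoeff` is attained by α(d) at q. That value serves all
-- coordinate representatives because derivations are local.
omit h hq in
theorem IsInverseFrame.chartCoeff_spec (he : e ∈ atlas (EuclideanSpace ℝ (Fin D)) M)
    (hq : q ∈ e.source) (α : Form (Fn D M) D) (Y : Fin D → VF (Fn D M)) (x : Fin D → Fn D M)
    (hx : ∀ j, ∀ᶠ p in 𝓝 q, x j p = ((e p j : ℝ) : ℂ)) :
    α Y q = chartCoeff e α q * Matrix.det (Matrix.of fun i j => Y i (x j) q) := by
  obtain ⟨O, x', d, hO, h⟩ := exists_isCoord he (isCompact_singleton (x := q))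
    (Set.singleton_subset_iff.mpr hq)
  have hqO : q ∈ O := hO rfl
  refine Classical.epsilon_spec (p := fun z : ℂ => ∀ (Y : Fin D → VF (Fn D M))
    (x : Fin D → Fn D M), (∀ j, ∀ᶠ q in 𝓝 q, x j q = ((e q j : ℝ) : ℂ)) →
      α Y q = z * Matrix.det (Matrix.of fun i j => (Y i (x j)) q)) ⟨α d q, ?_⟩ Y x hx
  intro Y x hx
  rw [hE.form_apply_coord h hqO α Y]
  congr 3
  funext i j
  refine hE.apply_congr h hqO (Y i) ?_
  filter_upwards [hx j, h.eventually_coord hqO j] with p h1 h2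
  rw [h1, h2]

theorem IsInverseFrame.chartCoeff_eq (he : e ∈ atlas (EuclideanSpace ℝ (Fin D)) M)
    (α : Form (Fn D M) D) : chartCoeff e α q = α d q := by
  rw [hE.chartCoeff_spec he (h.subset hq) α d x fun j => h.eventually_coord hq j]
  have : (Matrix.of fun i j => d i (x j) q) = 1 := by
    ext i j
    rw [Matrix.of_apply, h.deriv q hq,
      partialDeriv_coord (h.subset hq) i j (h.eventually_coord hq j), Matrix.one_apply]
  rw [this, Matrix.det_one, mul_one]

end Frame

end SmoothFunctions

/-! ### Stokes' theorem and change of variables in a chart -/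

section ChartIntegral

variable {D : ℕ} {M : Type u} [TopologicalSpace M] [ChartedSpace (EuclideanSpace ℝ (Fin D)) M]

open Classical in
/-- The local representative of a function in a chart, extended by zero. -/
def chartExt (e : OpenPartialHomeomorph M (EuclideanSpace ℝ (Fin D))) (f : M → ℂ)
    (y : EuclideanSpace ℝ (Fin D)) : ℂ :=
  if y ∈ e.target then f (e.symm y) else 0

theorem chartExt_of_mem {e : OpenPartialHomeomorph M (EuclideanSpace ℝ (Fin D))} (f : M → ℂ)
    {y : EuclideanSpace ℝ (Fin D)} (hy : y ∈ e.target) : chartExt e f y = f (e.symm y) :=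
  if_pos hy

theorem chartExt_of_notMem {e : OpenPartialHomeomorph M (EuclideanSpace ℝ (Fin D))} (f : M → ℂ)
    {y : EuclideanSpace ℝ (Fin D)} (hy : y ∉ e.target) : chartExt e f y = 0 :=
  if_neg hy

theorem chartExt_eventuallyEq {e : OpenPartialHomeomorph M (EuclideanSpace ℝ (Fin D))} (f : M → ℂ)
    {y : EuclideanSpace ℝ (Fin D)} (hy : y ∈ e.target) : chartExt e f =ᶠ[𝓝 y] f ∘ e.symm :=
  Filter.eventually_of_mem (e.open_target.mem_nhds hy) fun _ hz => chartExt_of_mem f hz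

theorem chartExt_eq_zero {e : OpenPartialHomeomorph M (EuclideanSpace ℝ (Fin D))} {f : M → ℂ}
    {C : Set M} (hf : ∀ p, p ∉ C → f p = 0) {y : EuclideanSpace ℝ (Fin D)} (hy : y ∉ e '' C) :
    chartExt e f y = 0 := by
  by_cases h : y ∈ e.target
  · rw [chartExt_of_mem f h]
    exact hf _ fun hC => hy ⟨_, hC, e.right_inv h⟩
  · exact chartExt_of_notMem f h

theorem isCompact_image_chart {e : OpenPartialHomeomorph M (EuclideanSpace ℝ (Fin D))} {C : Set M}
    (hC : IsCompact C) (hCe : C ⊆ e.source) : IsCompact (e '' C) :=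
  hC.image_of_continuousOn (e.continuousOn.mono hCe)

theorem hasCompactSupport_chartExt {e : OpenPartialHomeomorph M (EuclideanSpace ℝ (Fin D))}
    {f : M → ℂ} {C : Set M} (hC : IsCompact C) (hCe : C ⊆ e.source)
    (hf : ∀ p, p ∉ C → f p = 0) : HasCompactSupport (chartExt e f) :=
  HasCompactSupport.intro (isCompact_image_chart hC hCe) fun _ hy => chartExt_eq_zero hf hy

/-- The integral of a top-degree form over a chart. -/
def chartInt (e : OpenPartialHomeomorph M (EuclideanSpace ℝ (Fin D))) (α : Form (Fn D M) D) : ℂ :=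
  ∫ y, chartExt e (chartCoeff e α) y

/-- A differential form vanishes outside of a set. -/
def SuppIn (C : Set M) {k : ℕ} (α : Form (Fn D M) k) : Prop := ∀ Y p, p ∉ C → α Y p = 0

theorem SuppIn.mono {C C' : Set M} (h : C ⊆ C') {k : ℕ} {α : Form (Fn D M) k} (hα : SuppIn C α) :
    SuppIn C' α := fun Y p hp => hα Y p fun hC => hp (h hC)

theorem SuppIn.smul {C : Set M} {k : ℕ} {α : Form (Fn D M) k} (hα : SuppIn C α) (f : Fn D M) :
    SuppIn C (f • α) := fun Y p hp => by
  change f p * α Y p = 0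
  rw [hα Y p hp, mul_zero]

theorem SuppIn.smul_inter {C C' : Set M} {k : ℕ} {α : Form (Fn D M) k} (hα : SuppIn C α)
    {f : Fn D M} (hf : ∀ p, p ∉ C' → f p = 0) : SuppIn (C ∩ C') (f • α) := fun Y p hp => by
  change f p * α Y p = 0
  by_cases hC : p ∈ C
  · rw [hf p fun h => hp ⟨hC, h⟩, zero_mul]
  · rw [hα Y p hC, mul_zero]

variable [IsManifold (𝓡 D) ∞ M]

/-- On the target this is the smooth local representative. A point outside the target has a
neighbourhood missing the compact, hence closed, image of C, where the extension vanishes. -/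
theorem contDiff_chartExt {e : OpenPartialHomeomorph M (EuclideanSpace ℝ (Fin D))}
    (he : e ∈ atlas (EuclideanSpace ℝ (Fin D)) M) {f : Fn D M} {C : Set M} (hC : IsCompact C)
    (hCe : C ⊆ e.source) (hf : ∀ p, p ∉ C → f p = 0) : ContDiff ℝ ∞ (chartExt e f) := by
  rw [contDiff_iff_contDiffAt]
  intro y
  by_cases hy : y ∈ e.target
  · exact ((contDiffOn_comp_symm he f).contDiffAt (e.open_target.mem_nhds hy)).congr_of_eventuallyEq
      (chartExt_eventuallyEq f hy)
  · have hy' : y ∈ (e '' C)ᶜ := by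
      rintro ⟨p, hp, rfl⟩
      exact hy (e.map_source (hCe hp))
    have h0 : chartExt e f =ᶠ[𝓝 y] fun _ => 0 :=
      Filter.eventually_of_mem
        ((isCompact_image_chart hC hCe).isClosed.isOpen_compl.mem_nhds hy')
        fun z hz => chartExt_eq_zero hf hz
    exact contDiffAt_const.congr_of_eventuallyEq h0

variable [T2Space M] [SigmaCompactSpace M]

variable {θ : Fin D → Form (Fn D M) 1} {E : Fin D → VF (Fn D M)} (hE : IsInverseFrame θ E)
include hE

theorem IsInverseFrame.chartCoeff_add {e : OpenPartialHomeomorph M (EuclideanSpace ℝ (Fin D))}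
    (he : e ∈ atlas (EuclideanSpace ℝ (Fin D)) M) {q : M} (hq : q ∈ e.source)
    (α β : Form (Fn D M) D) : chartCoeff e (α + β) q = chartCoeff e α q + chartCoeff e β q := by
  obtain ⟨O, x, d, hO, h⟩ := exists_isCoord he (isCompact_singleton (x := q))
    (Set.singleton_subset_iff.mpr hq)
  simp only [hE.chartCoeff_eq h (hO rfl) he]
  rfl

theorem IsInverseFrame.chartCoeff_smul {e : OpenPartialHomeomorph M (EuclideanSpace ℝ (Fin D))}
    (he : e ∈ atlas (EuclideanSpace ℝ (Fin D)) M) {q : M} (hq : q ∈ e.source) (f : Fn D M)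
    (α : Form (Fn D M) D) : chartCoeff e (f • α) q = f q * chartCoeff e α q := by
  obtain ⟨O, x, d, hO, h⟩ := exists_isCoord he (isCompact_singleton (x := q))
    (Set.singleton_subset_iff.mpr hq)
  simp only [hE.chartCoeff_eq h (hO rfl) he]
  rfl

theorem IsInverseFrame.chartCoeff_eq_zero {e : OpenPartialHomeomorph M (EuclideanSpace ℝ (Fin D))}
    (he : e ∈ atlas (EuclideanSpace ℝ (Fin D)) M) {q : M} (hq : q ∈ e.source) {C : Set M}
    {α : Form (Fn D M) D} (hα : SuppIn C α) (hqC : q ∉ C) : chartCoeff e α q = 0 := by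
  obtain ⟨O, x, d, hO, h⟩ := exists_isCoord he (isCompact_singleton (x := q))
    (Set.singleton_subset_iff.mpr hq)
  rw [hE.chartCoeff_eq h (hO rfl) he, hα _ _ hqC]

variable {e : OpenPartialHomeomorph M (EuclideanSpace ℝ (Fin D))}
  (he : e ∈ atlas (EuclideanSpace ℝ (Fin D)) M)
include he

/-- Replaces the pointwise chosen coefficient by one global smooth function, the value of α on
coordinate fields valid near C. Regularity and integrability are read off from it. -/
theorem IsInverseFrame.chartExt_chartCoeff {C O : Set M} {x : Fin D → Fn D M}
    {d : Fin D → VF (Fn D M)} (h : IsCoord e O x d) (hCO : C ⊆ O) {α : Form (Fn D M) D}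
    (hα : SuppIn C α) : chartExt e (chartCoeff e α) = chartExt e (α d) := by
  funext y
  by_cases hy : y ∈ e.target
  · rw [chartExt_of_mem _ hy, chartExt_of_mem _ hy]
    by_cases hq : e.symm y ∈ O
    · exact hE.chartCoeff_eq h hq he α
    · have hq' : e.symm y ∉ C := fun hC => hq (hCO hC)
      rw [hE.chartCoeff_eq_zero he (e.map_target hy) hα hq', hα _ _ hq']
  · rw [chartExt_of_notMem _ hy, chartExt_of_notMem _ hy]

theorem IsInverseFrame.integrable_chartExt {C : Set M} (hC : IsCompact C) (hCe : C ⊆ e.source)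
    {α : Form (Fn D M) D} (hα : SuppIn C α) :
    MeasureTheory.Integrable (chartExt e (chartCoeff e α)) := by
  obtain ⟨O, x, d, hO, h⟩ := exists_isCoord he hC hCe
  rw [hE.chartExt_chartCoeff he h hO hα]
  exact (contDiff_chartExt he hC hCe (hα d)).continuous.integrable_of_hasCompactSupport
    (hasCompactSupport_chartExt hC hCe (hα d))

theorem IsInverseFrame.chartInt_add {C : Set M} (hC : IsCompact C) (hCe : C ⊆ e.source)
    {α β : Form (Fn D M) D} (hα : SuppIn C α) (hβ : SuppIn C β) :
    chartInt e (α + β) = chartInt e α + chartInt e β := by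
  rw [chartInt, chartInt, chartInt, ← MeasureTheory.integral_add
    (hE.integrable_chartExt he hC hCe hα) (hE.integrable_chartExt he hC hCe hβ)]
  congr 1
  funext y
  by_cases hy : y ∈ e.target
  · simp only [chartExt_of_mem _ hy, hE.chartCoeff_add he (e.map_target hy)]
  · simp only [chartExt_of_notMem _ hy, add_zero]

theorem IsInverseFrame.chartInt_smul (c : ℂ) (α : Form (Fn D M) D) :
    chartInt e (c • α) = c * chartInt e α := by
  rw [chartInt, chartInt, ← MeasureTheory.integral_const_mul]
  congr 1
  funext y
  by_cases hy : y ∈ e.target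
  · simp only [chartExt_of_mem _ hy]
    have : c • α = algebraMap ℂ (Fn D M) c • α := (form_smul_algebraMap _ _).symm
    rw [this, hE.chartCoeff_smul he (e.map_target hy), Fn.algebraMap_apply]
  · simp only [chartExt_of_notMem _ hy, mul_zero]

omit he in
theorem IsInverseFrame.apply_eq_zero (X : VF (Fn D M)) {C : Set M} (hC : IsClosed C) {f : Fn D M}
    (hf : ∀ p, p ∉ C → f p = 0) {q : M} (hq : q ∉ C) : X f q = 0 := by
  obtain ⟨O, x, d, hO, h⟩ := exists_isCoord (chart_mem_atlas (EuclideanSpace ℝ (Fin D)) q)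
    (isCompact_singleton (x := q)) (Set.singleton_subset_iff.mpr (mem_chart_source _ q))
  have := hE.apply_congr h (hO rfl) X (f := f) (g := 0) (by
    filter_upwards [hC.isOpen_compl.mem_nhds hq] with p hp
    exact hf p hp)
  rw [this, map_zero]
  rfl

omit he in
theorem IsInverseFrame.suppIn_lieForm (X : VF (Fn D M)) {C : Set M} (hC : IsClosed C) {k : ℕ}
    {α : Form (Fn D M) k} (hα : SuppIn C α) : SuppIn C (lieForm X α) := fun Y p hp => by
  rw [lieForm_apply]
  change (X (α Y)) p - (∑ i, α (Function.update Y i ⁅X, Y i⁆)) p = 0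
  rw [hE.apply_eq_zero X hC (hα Y) hp, Fn.sum_apply]
  simp [hα _ _ hp]

/-- The Lie derivative of a top-degree form is a divergence. -/
theorem IsInverseFrame.lieForm_coord {O : Set M} {x : Fin D → Fn D M} {d : Fin D → VF (Fn D M)}
    (h : IsCoord e O x d) {q : M} (hq : q ∈ O) (X : VF (Fn D M)) (α : Form (Fn D M) D) :
    lieForm X α d q = ∑ k, d k (X (x k) * α d) q := by
  have hdx : ∀ i j : Fin D, ∀ p ∈ O, d i (x j) p = if i = j then 1 else 0 := fun i j p hp => by
    rw [h.deriv p hp, partialDeriv_coord (h.subset hp) i j (h.eventually_coord hp j)]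
  -- On O the function d_i(x^i) is constant, so X annihilates it and only the second half of the
  -- commutator is left.
  have hlie : ∀ i, ⁅X, d i⁆ (x i) q = -(d i (X (x i)) q) := by
    intro i
    rw [Derivation.commutator_apply]
    change X (d i (x i)) q - d i (X (x i)) q = _
    have h1 : X (d i (x i)) q = X (1 : Fn D M) q :=
      hE.apply_congr h hq X (Filter.eventually_of_mem (h.isOpen.mem_nhds hq) fun p hp => by
        rw [hdx i i p hp, if_pos rfl]; rfl)
    rw [h1, Derivation.map_one_eq_zero]
    exact zero_sub _
  -- Replacing one coordinate field changes one row of the identity matrix, so the determinant is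
  -- the diagonal component of the bracket.
  have hupd : ∀ i, α (Function.update d i ⁅X, d i⁆) q = α d q * ⁅X, d i⁆ (x i) q := by
    intro i
    rw [hE.form_apply_coord h hq]
    congr 1
    have hm : (Matrix.of fun k j => Function.update d i ⁅X, d i⁆ k (x j) q) =
        Matrix.updateRow 1 i (∑ j, (⁅X, d i⁆ (x j) q) • (1 : Matrix (Fin D) (Fin D) ℂ) j) := by
      ext k j
      rw [Matrix.of_apply, Matrix.updateRow_apply]
      by_cases hk : k = i
      · subst hk
        rw [Function.update_self, if_pos rfl, Finset.sum_apply]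
        simp [Matrix.one_apply]
      · rw [Function.update_of_ne hk, if_neg hk, hdx k j q hq, Matrix.one_apply]
    rw [hm, Matrix.det_updateRow_sum, Matrix.det_one, smul_eq_mul, mul_one]
  rw [lieForm_apply]
  change (X (α d)) q - (∑ i, α (Function.update d i ⁅X, d i⁆)) q = _
  rw [Fn.sum_apply]
  simp only [hupd, hlie, Derivation.leibniz, smul_eq_mul]
  rw [hE.apply_eq_partialDeriv h hq X (α d), ← Finset.sum_sub_distrib]
  refine Finset.sum_congr rfl fun k _ => ?_
  rw [← h.deriv q hq k]
  change _ = X (x k) q * d k (α d) q + α d q * d k (X (x k)) q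
  ring

/-- By `lieForm_coord` the integrand is the divergence of the compactly supported vector with
components X(x^k) α(d). -/
theorem IsInverseFrame.chartInt_lieForm {C : Set M} (hC : IsCompact C) (hCe : C ⊆ e.source)
    (X : VF (Fn D M)) {α : Form (Fn D M) D} (hα : SuppIn C α) :
    chartInt e (lieForm X α) = 0 := by
  obtain ⟨O, x, d, hO, h⟩ := exists_isCoord he hC hCe
  obtain ⟨F, hFd⟩ : ∃ F : Fin D → Fn D M, ∀ k, F k = X (x k) * α d := ⟨_, fun _ => rfl⟩
  have hF : ∀ k, ∀ p, p ∉ C → F k p = 0 := fun k p hp => by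
    rw [hFd, Fn.mul_apply, hα d p hp, mul_zero]
  have hsm := fun k => contDiff_chartExt he hC hCe (hF k)
  have hcs := fun k => hasCompactSupport_chartExt hC hCe (hF k)
  have hi : ∀ k, MeasureTheory.Integrable
      (fun y => fderiv ℝ (chartExt e (F k)) y (EuclideanSpace.single k 1)) := fun k =>
    Continuous.integrable_of_hasCompactSupport
      (((hsm k).continuous_fderiv (by simp)).clm_apply continuous_const)
      ((hcs k).fderiv_apply ℝ _)
  have hint : ∀ k, ∫ y, fderiv ℝ (chartExt e (F k)) y (EuclideanSpace.single k 1) = 0 := by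
    intro k
    -- Integration by parts against the constant function 1, whose derivative is zero.
    have := integral_mul_fderiv_eq_neg_fderiv_mul_of_integrable (𝕜 := ℂ)
      (μ := MeasureTheory.volume) (f := fun _ => (1 : ℂ))
      (g := chartExt e (F k)) (v := EuclideanSpace.single k 1)
      (by simp) (by simpa using hi k)
      (by simpa using (hsm k).continuous.integrable_of_hasCompactSupport (hcs k))
      (fun _ _ => differentiableAt_const _)
      (fun y _ => ((hsm k).differentiable (by simp)) y)
    simpa using this
  have hsum : chartExt e (chartCoeff e (lieForm X α)) = fun y =>
      ∑ k, fderiv ℝ (chartExt e (F k)) y (EuclideanSpace.single k 1) := by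
    rw [hE.chartExt_chartCoeff he h hO (hE.suppIn_lieForm X hC.isClosed hα)]
    funext y
    by_cases hy : y ∈ e '' C
    · obtain ⟨q, hq, rfl⟩ := hy
      have ht := e.map_source (hCe hq)
      rw [chartExt_of_mem _ ht, e.left_inv (hCe hq), hE.lieForm_coord he h (hO hq)]
      refine Finset.sum_congr rfl fun k _ => ?_
      rw [← hFd, h.deriv q (hO hq), partialDeriv, (chartExt_eventuallyEq _ ht).fderiv_eq]
    · rw [chartExt_eq_zero (hE.suppIn_lieForm X hC.isClosed hα d) hy]
      refine (Finset.sum_eq_zero fun k _ => ?_).symm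
      have h0 : chartExt e (F k) =ᶠ[𝓝 y] fun _ => 0 :=
        Filter.eventually_of_mem
          ((isCompact_image_chart hC hCe).isClosed.isOpen_compl.mem_nhds hy)
          fun z hz => chartExt_eq_zero (hF k) hz
      rw [h0.fderiv_eq]
      simp
  rw [chartInt, hsum, MeasureTheory.integral_finsetSum _ fun k _ => hi k]
  exact Finset.sum_eq_zero fun k _ => hint k

/-- The change of variables formula for top-degree forms, pointwise. -/
theorem IsInverseFrame.chartCoeff_change {e' : OpenPartialHomeomorph M (EuclideanSpace ℝ (Fin D))}
    (he' : e' ∈ atlas (EuclideanSpace ℝ (Fin D)) M) {q : M} (hq : q ∈ e.source)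
    (hq' : q ∈ e'.source) (α : Form (Fn D M) D) :
    chartCoeff e α q = ((fderiv ℝ (e.symm.trans e') (e q)).det : ℂ) * chartCoeff e' α q := by
  obtain ⟨O, x, d, hO, h⟩ := exists_isCoord he (isCompact_singleton (x := q))
    (Set.singleton_subset_iff.mpr hq)
  obtain ⟨O', x', d', hO', h'⟩ := exists_isCoord he' (isCompact_singleton (x := q))
    (Set.singleton_subset_iff.mpr hq')
  have hqO : q ∈ O := hO rfl
  have hqO' : q ∈ O' := hO' rfl
  rw [hE.chartCoeff_eq h hqO he, hE.chartCoeff_spec he' hq' α d x' fun j =>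
    h'.eventually_coord hqO' j, mul_comm]
  congr 1
  have hy : e q ∈ (e.symm.trans e').source := by
    simp [e.map_source hq, e.left_inv hq, hq']
  have hdiff : DifferentiableAt ℝ (e.symm.trans e') (e q) := by
    have h1 : ContDiffOn ℝ ∞ (e.symm.trans e') (e.symm.trans e').source := by
      have := (contMDiffOn_of_mem_maximalAtlas (I := 𝓡 D) (n := ∞)
        (IsManifold.subset_maximalAtlas he')).comp'
        (contMDiffOn_symm_of_mem_maximalAtlas (I := 𝓡 D) (n := ∞)
        (IsManifold.subset_maximalAtlas he))
      exact contMDiffOn_iff_contDiffOn.mp this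
    exact (h1.contDiffAt ((e.symm.trans e').open_source.mem_nhds hy)).differentiableAt (by simp)
  have hentry : ∀ i j, d i (x' j) q =
      ((fderiv ℝ (e.symm.trans e') (e q) (EuclideanSpace.single i 1) j : ℝ) : ℂ) := by
    intro i j
    rw [h.deriv q hqO, partialDeriv]
    let L : EuclideanSpace ℝ (Fin D) →L[ℝ] ℂ := Complex.ofRealCLM.comp (EuclideanSpace.proj j)
    have h1 : Filter.Tendsto e.symm (𝓝 (e q)) (𝓝 q) := by
      have := e.continuousAt_symm (e.map_source hq)
      rwa [ContinuousAt, e.left_inv hq] at this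
    have h2 : x' j ∘ e.symm =ᶠ[𝓝 (e q)] L ∘ (e.symm.trans e') := by
      filter_upwards [h1.eventually (h'.eventually_coord hqO' j)] with y hy
      simp only [Function.comp_apply, hy, L]
      rfl
    rw [h2.fderiv_eq, fderiv_comp _ L.differentiableAt hdiff, L.fderiv]
    rfl
  -- Rows are directions and columns are components, so this is the transposed Jacobian matrix.
  have hM : (Matrix.of fun i j => d i (x' j) q) =
      ((LinearMap.toMatrix (EuclideanSpace.basisFun (Fin D) ℝ).toBasis
        (EuclideanSpace.basisFun (Fin D) ℝ).toBasis
        (fderiv ℝ (e.symm.trans e') (e q) : _ →ₗ[ℝ] _)).map Complex.ofRealHom).transpose := by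
    ext i j
    rw [Matrix.of_apply, hentry, Matrix.transpose_apply, Matrix.map_apply, LinearMap.toMatrix_apply]
    simp
  rw [hM, Matrix.det_transpose]
  change Matrix.det (Complex.ofRealHom.mapMatrix _) = _
  rw [← RingHom.map_det, LinearMap.det_toMatrix]
  rfl

/-- The integral of a top-degree form over a chart does not depend on the chart. -/
theorem IsInverseFrame.chartInt_eq (hor : IsOriented D M)
    {e' : OpenPartialHomeomorph M (EuclideanSpace ℝ (Fin D))}
    (he' : e' ∈ atlas (EuclideanSpace ℝ (Fin D)) M) {C : Set M} (hCe : C ⊆ e.source)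
    (hCe' : C ⊆ e'.source) {α : Form (Fn D M) D} (hα : SuppIn C α) :
    chartInt e α = chartInt e' α := by
  set S := (e.symm.trans e').source with hS
  have hvan : ∀ {e : OpenPartialHomeomorph M (EuclideanSpace ℝ (Fin D))},
      e ∈ atlas (EuclideanSpace ℝ (Fin D)) M → ∀ y, y ∉ e '' C →
      chartExt e (chartCoeff e α) y = 0 := by
    intro e he y hy
    by_cases ht : y ∈ e.target
    · rw [chartExt_of_mem _ ht]
      exact hE.chartCoeff_eq_zero he (e.map_target ht) hα fun hC => hy ⟨_, hC, e.right_inv ht⟩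
    · exact chartExt_of_notMem _ ht
  have hmem : ∀ q ∈ C, e q ∈ S := fun q hq => by
    simp [hS, e.map_source (hCe hq), e.left_inv (hCe hq), hCe' hq]
  have h1 : chartInt e α = ∫ y in S, chartExt e (chartCoeff e α) y := by
    rw [chartInt]
    refine (MeasureTheory.setIntegral_eq_integral_of_forall_compl_eq_zero fun y hy => ?_).symm
    refine hvan he y ?_
    rintro ⟨q, hq, rfl⟩
    exact hy (hmem q hq)
  have h2 : chartInt e' α = ∫ y in (e.symm.trans e') '' S, chartExt e' (chartCoeff e' α) y := by
    rw [chartInt]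
    refine (MeasureTheory.setIntegral_eq_integral_of_forall_compl_eq_zero fun y hy => ?_).symm
    refine hvan he' y ?_
    rintro ⟨q, hq, rfl⟩
    refine hy ⟨e q, hmem q hq, ?_⟩
    simp [e.left_inv (hCe hq)]
  have hdiff : ∀ y ∈ S, HasFDerivWithinAt (e.symm.trans e') (fderiv ℝ (e.symm.trans e') y) S y := by
    intro y hy
    have h1 : ContDiffOn ℝ ∞ (e.symm.trans e') (e.symm.trans e').source := by
      have := (contMDiffOn_of_mem_maximalAtlas (I := 𝓡 D) (n := ∞)
        (IsManifold.subset_maximalAtlas he')).comp'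
        (contMDiffOn_symm_of_mem_maximalAtlas (I := 𝓡 D) (n := ∞)
        (IsManifold.subset_maximalAtlas he))
      exact contMDiffOn_iff_contDiffOn.mp this
    exact ((h1.contDiffAt ((e.symm.trans e').open_source.mem_nhds hy)).differentiableAt
      (by simp)).hasFDerivAt.hasFDerivWithinAt
  rw [h1, h2, MeasureTheory.integral_image_eq_integral_abs_det_fderiv_smul MeasureTheory.volume
    (e.symm.trans e').open_source.measurableSet hdiff (e.symm.trans e').injOn]
  refine MeasureTheory.setIntegral_congr_fun (e.symm.trans e').open_source.measurableSet
    fun y hy => ?_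
  have hy' := hy
  rw [hS, OpenPartialHomeomorph.trans_source] at hy'
  obtain ⟨hyt, hys⟩ := hy'
  rw [OpenPartialHomeomorph.symm_source] at hyt
  -- The substitution formula has |det|, forms transform with det; orientation identifies the two.
  have hpos := hor e he e' he' y hy
  have ht' : (e.symm.trans e') y ∈ e'.target := e'.map_source hys
  change chartExt e (chartCoeff e α) y = _ • chartExt e' (chartCoeff e' α) ((e.symm.trans e') y)
  rw [chartExt_of_mem _ hyt, chartExt_of_mem _ ht', abs_of_pos hpos,
    hE.chartCoeff_change he he' (e.map_target hyt) hys, e.right_inv hyt]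
  have : e'.symm ((e.symm.trans e') y) = e.symm y := e'.left_inv hys
  rw [this, Complex.real_smul]

end ChartIntegral

/-! ### The global integral through a partition of unity -/

section GlobalIntegral

variable {D : ℕ} {M : Type u} [TopologicalSpace M] [ChartedSpace (EuclideanSpace ℝ (Fin D)) M]

/-- A real smooth function, as an element of the algebra of complex smooth functions. -/
def ofRealFn {f : M → ℝ} (hf : ContMDiff (𝓡 D) 𝓘(ℝ, ℝ) ∞ f) : Fn D M :=
  ⟨fun q => (f q : ℂ), (Complex.ofRealCLM.contDiff (n := ∞)).comp_contMDiff hf⟩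

variable [IsManifold (𝓡 D) ∞ M] [T2Space M] [SigmaCompactSpace M]

variable (D) in
/-- The functions of the partition of unity. -/
def partFn (i : M) : Fn D M := ofRealFn (chartPartition D M i).contMDiff

theorem partFn_apply (i q : M) : partFn D i q = (chartPartition D M i q : ℂ) := rfl

theorem tsupport_chartPartition (i : M) :
    tsupport (chartPartition D M i) ⊆ (chartAt (EuclideanSpace ℝ (Fin D)) i).source :=
  (SmoothPartitionOfUnity.exists_isSubordinate_chartAt_source (𝓡 D) M).choose_spec i

theorem partFn_eq_zero (i : M) {q : M} (hq : q ∉ tsupport (chartPartition D M i)) :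
    partFn D i q = 0 := by
  rw [partFn_apply, image_eq_zero_of_notMem_tsupport hq, Complex.ofReal_zero]

variable (D) in
/-- The finitely many members of the partition of unity which do not vanish on a compact set. -/
theorem exists_finset_partition {C : Set M} (hC : IsCompact C) :
    ∃ s : Finset M, ∀ i, i ∉ s → ∀ q ∈ C, partFn D i q = 0 := by
  have h := (chartPartition D M).locallyFinite.finite_nonempty_inter_compact hC
  refine ⟨h.toFinset, fun i hi q hq => ?_⟩
  by_contra hne
  refine hi (h.mem_toFinset.mpr ⟨q, ?_, hq⟩)
  rw [Function.mem_support]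
  intro h0
  exact hne (by rw [partFn_apply, h0, Complex.ofReal_zero])

theorem sum_partFn {C : Set M} {s : Finset M} (hs : ∀ i, i ∉ s → ∀ q ∈ C, partFn D i q = 0)
    {q : M} (hq : q ∈ C) : ∑ i ∈ s, partFn D i q = 1 := by
  have h := (chartPartition D M).sum_finsupport' q (Set.mem_univ q) (show _ ⊆ s by
    intro i hi
    rw [SmoothPartitionOfUnity.mem_finsupport, Function.mem_support] at hi
    by_contra his
    exact hi (Complex.ofReal_eq_zero.mp (hs i his q hq)))
  simp only [partFn_apply]
  rw [← Complex.ofReal_sum, h, Complex.ofReal_one]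

theorem sum_partFn_smul {C : Set M} {s : Finset M}
    (hs : ∀ i, i ∉ s → ∀ q ∈ C, partFn D i q = 0) {k : ℕ} {α : Form (Fn D M) k}
    (hα : SuppIn C α) : ∑ i ∈ s, partFn D i • α = α := by
  rw [← Finset.sum_smul]
  ext Y
  refine Fn.ext fun q => ?_
  change (∑ i ∈ s, partFn D i) q * α Y q = α Y q
  by_cases hq : q ∈ C
  · rw [Fn.sum_apply, sum_partFn hs hq, one_mul]
  · rw [hα Y q hq, mul_zero]

theorem suppIn_partFn_smul (i : M) {C : Set M} {k : ℕ} {α : Form (Fn D M) k} (hα : SuppIn C α) :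
    SuppIn (C ∩ tsupport (chartPartition D M i)) (partFn D i • α) :=
  hα.smul_inter fun _ hp => partFn_eq_zero i hp

theorem inter_tsupport_subset (i : M) (C : Set M) :
    C ∩ tsupport (chartPartition D M i) ⊆ (chartAt (EuclideanSpace ℝ (Fin D)) i).source :=
  fun _ hp => tsupport_chartPartition i hp.2

theorem isCompact_inter_tsupport (i : M) {C : Set M} (hC : IsCompact C) :
    IsCompact (C ∩ tsupport (chartPartition D M i)) :=
  hC.inter_right (isClosed_tsupport _)

variable {θ : Fin D → Form (Fn D M) 1} {E : Fin D → VF (Fn D M)} (hE : IsInverseFrame θ E)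
include hE

theorem IsInverseFrame.integral_eq_finsum (α : Form (Fn D M) D) :
    integral α = ∑ᶠ i : M, chartInt (chartAt (EuclideanSpace ℝ (Fin D)) i) (partFn D i • α) := by
  refine finsum_congr fun i => ?_
  rw [chartInt, ← MeasureTheory.setIntegral_eq_integral_of_forall_compl_eq_zero
    (s := (chartAt (EuclideanSpace ℝ (Fin D)) i).target) fun y hy => chartExt_of_notMem _ hy]
  refine MeasureTheory.setIntegral_congr_fun
    (chartAt (EuclideanSpace ℝ (Fin D)) i).open_target.measurableSet fun y hy => ?_
  rw [chartExt_of_mem _ hy, hE.chartCoeff_smul (chart_mem_atlas _ i)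
    ((chartAt (EuclideanSpace ℝ (Fin D)) i).map_target hy)]
  rfl

/-- Outside the finite set s the partition function vanishes on C while α vanishes off C, so their
product is zero. -/
theorem IsInverseFrame.integral_eq_sum {C : Set M} {s : Finset M}
    (hs : ∀ i, i ∉ s → ∀ q ∈ C, partFn D i q = 0) {α : Form (Fn D M) D} (hα : SuppIn C α) :
    integral α = ∑ i ∈ s, chartInt (chartAt (EuclideanSpace ℝ (Fin D)) i) (partFn D i • α) := by
  rw [hE.integral_eq_finsum]
  refine finsum_eq_sum_of_support_subset _ fun i hi => ?_
  by_contra his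
  apply hi
  change chartInt (chartAt (EuclideanSpace ℝ (Fin D)) i) (partFn D i • α) = 0
  have h0 : partFn D i • α = (0 : ℂ) • α := by
    ext Y
    refine Fn.ext fun q => ?_
    change partFn D i q * α Y q = 0 * α Y q
    by_cases hq : q ∈ C
    · rw [hs i his q hq]
    · rw [hα Y q hq, mul_zero, mul_zero]
  rw [h0, hE.chartInt_smul (chart_mem_atlas _ i), zero_mul]

theorem IsInverseFrame.integral_add {C : Set M} (hC : IsCompact C) {α β : Form (Fn D M) D}
    (hα : SuppIn C α) (hβ : SuppIn C β) : integral (α + β) = integral α + integral β := by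
  obtain ⟨s, hs⟩ := exists_finset_partition D hC
  have hαβ : SuppIn C (α + β) := fun Y p hp => by
    change α Y p + β Y p = 0
    rw [hα Y p hp, hβ Y p hp, add_zero]
  rw [hE.integral_eq_sum hs hα, hE.integral_eq_sum hs hβ, hE.integral_eq_sum hs hαβ,
    ← Finset.sum_add_distrib]
  refine Finset.sum_congr rfl fun i _ => ?_
  rw [smul_add, hE.chartInt_add (chart_mem_atlas _ i) (isCompact_inter_tsupport i hC)
    (inter_tsupport_subset i C) (suppIn_partFn_smul i hα) (suppIn_partFn_smul i hβ)]

theorem IsInverseFrame.integral_smul (c : ℂ) (α : Form (Fn D M) D) :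
    integral (c • α) = c * integral α := by
  rw [hE.integral_eq_finsum, hE.integral_eq_finsum, ← smul_eq_mul, smul_finsum]
  refine finsum_congr fun i => ?_
  rw [← form_smul_algebraMap, smul_comm, form_smul_algebraMap,
    hE.chartInt_smul (chart_mem_atlas _ i), smul_eq_mul]

theorem IsInverseFrame.chartInt_sum {e : OpenPartialHomeomorph M (EuclideanSpace ℝ (Fin D))}
    (he : e ∈ atlas (EuclideanSpace ℝ (Fin D)) M) {C : Set M} (hC : IsCompact C)
    (hCe : C ⊆ e.source) {ι : Type*} (s : Finset ι) {α : ι → Form (Fn D M) D}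
    (hα : ∀ i, SuppIn C (α i)) : chartInt e (∑ i ∈ s, α i) = ∑ i ∈ s, chartInt e (α i) := by
  classical
  have hsum : ∀ s : Finset ι, SuppIn C (∑ i ∈ s, α i) := fun s Y p hp => by
    rw [form_sum_apply, Fn.sum_apply]
    exact Finset.sum_eq_zero fun i _ => hα i Y p hp
  induction s using Finset.induction_on with
  | empty =>
    have := hE.chartInt_smul he 0 0
    simpa using this
  | insert i s hi ih =>
    rw [Finset.sum_insert hi, Finset.sum_insert hi, hE.chartInt_add he hC hCe (hα i) (hsum s), ih]

theorem IsInverseFrame.integral_sum {C : Set M} (hC : IsCompact C) {ι : Type*} (s : Finset ι)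
    {α : ι → Form (Fn D M) D} (hα : ∀ i, SuppIn C (α i)) :
    integral (∑ i ∈ s, α i) = ∑ i ∈ s, integral (α i) := by
  classical
  have hsum : ∀ s : Finset ι, SuppIn C (∑ i ∈ s, α i) := fun s Y p hp => by
    rw [form_sum_apply, Fn.sum_apply]
    exact Finset.sum_eq_zero fun i _ => hα i Y p hp
  induction s using Finset.induction_on with
  | empty =>
    have := hE.integral_smul 0 0
    simpa using this
  | insert i s hi ih =>
    rw [Finset.sum_insert hi, Finset.sum_insert hi, hE.integral_add hC (hα i) (hsum s), ih]

variable (hor : IsOriented D M)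
include hor

/-- Each piece of the partition has support in two charts at once, its own and the one at j; chart
independence moves every piece to the latter, where they sum to α. -/
theorem IsInverseFrame.integral_eq_chartInt (j : M) {C : Set M} (hC : IsCompact C)
    (hCe : C ⊆ (chartAt (EuclideanSpace ℝ (Fin D)) j).source) {α : Form (Fn D M) D}
    (hα : SuppIn C α) : integral α = chartInt (chartAt (EuclideanSpace ℝ (Fin D)) j) α := by
  obtain ⟨s, hs⟩ := exists_finset_partition D hC
  rw [hE.integral_eq_sum hs hα]
  conv_rhs => rw [← sum_partFn_smul hs hα]
  rw [hE.chartInt_sum (chart_mem_atlas _ j) hC hCe s fun i => hα.smul _]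
  refine Finset.sum_congr rfl fun i _ => ?_
  exact hE.chartInt_eq (chart_mem_atlas _ i) hor (chart_mem_atlas _ j) (inter_tsupport_subset i C)
    (Set.inter_subset_left.trans hCe) (suppIn_partFn_smul i hα)

/-- Cut α, not its Lie derivative, into pieces supported in charts: the Lie derivative of each piece
stays in the same chart and has zero integral there. -/
theorem IsInverseFrame.integral_lieForm (X : VF (Fn D M)) {C : Set M} (hC : IsCompact C)
    {α : Form (Fn D M) D} (hα : SuppIn C α) : integral (lieForm X α) = 0 := by
  obtain ⟨s, hs⟩ := exists_finset_partition D hC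
  have h1 : lieForm X α = ∑ i ∈ s, lieForm X (partFn D i • α) := by
    conv_lhs => rw [← sum_partFn_smul hs hα]
    exact map_sum (AddMonoidHom.mk' (fun β : Form (Fn D M) D => lieForm X β)
      fun β β' => lieForm_add X β β') _ s
  rw [h1, hE.integral_sum hC s fun i => hE.suppIn_lieForm X hC.isClosed (hα.smul _)]
  refine Finset.sum_eq_zero fun i _ => ?_
  have hsupp := suppIn_partFn_smul i hα
  rw [hE.integral_eq_chartInt hor i (isCompact_inter_tsupport i hC) (inter_tsupport_subset i C)
    (hE.suppIn_lieForm X (isCompact_inter_tsupport i hC).isClosed hsupp)]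
  exact hE.chartInt_lieForm (chart_mem_atlas _ i) (isCompact_inter_tsupport i hC)
    (inter_tsupport_subset i C) X hsupp

/-- With d the coordinate fields near p and χ a bump function, take the test function f = conj(α(d))
χ. The integrand is |α(d)|² χ, continuous and nonnegative, so zero integral forces α(d) = 0 at p. -/
theorem IsInverseFrame.integral_nondegenerate {α : Form (Fn D M) D}
    (h : ∀ f ∈ compactIdeal D M, integral (f • α) = 0) : α = 0 := by
  ext Y
  refine Fn.ext fun p => ?_
  change α Y p = 0
  obtain ⟨χ⟩ : Nonempty (SmoothBumpFunction (𝓡 D) p) := inferInstance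
  have hC : IsCompact (tsupport χ) := χ.hasCompactSupport
  have hCe : tsupport χ ⊆ (chartAt (EuclideanSpace ℝ (Fin D)) p).source :=
    χ.tsupport_subset_chartAt_source
  have he := chart_mem_atlas (EuclideanSpace ℝ (Fin D)) p
  set e := chartAt (EuclideanSpace ℝ (Fin D)) p with he_def
  obtain ⟨O, x, d, hO, hd⟩ := exists_isCoord he hC hCe
  have hpO : p ∈ O := hO (subset_tsupport _ χ.c_mem_support)
  let b : Fn D M := ofRealFn χ.contMDiff
  have hb0 : ∀ q, q ∉ tsupport χ → b q = 0 := fun q hq => by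
    rw [show b q = ((χ q : ℝ) : ℂ) from rfl, image_eq_zero_of_notMem_tsupport hq,
      Complex.ofReal_zero]
  let f : Fn D M := conjFn (α d) * b
  have hf0 : ∀ q, q ∉ tsupport χ → f q = 0 := fun q hq => by
    rw [show f q = conjFn (α d) q * b q from rfl, hb0 q hq, mul_zero]
  have hfK : f ∈ compactIdeal D M := HasCompactSupport.intro hC hf0
  have hfα : SuppIn (tsupport χ) (f • α) := fun Y q hq => by
    change f q * α Y q = 0
    rw [hf0 q hq, zero_mul]
  have h0 := h f hfK
  rw [hE.integral_eq_chartInt hor p hC hCe hfα, chartInt,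
    hE.chartExt_chartCoeff he hd hO hfα] at h0
  have hval : ∀ q, (f • α) d q = ((Complex.normSq (α d q) * χ q : ℝ) : ℂ) := fun q => by
    change (starRingEnd ℂ) (α d q) * ((χ q : ℝ) : ℂ) * α d q = _
    rw [Complex.ofReal_mul, Complex.normSq_eq_conj_mul_self]
    ring
  have hreal : ∀ y, chartExt e ((f • α) d) y =
      (((chartExt e ((f • α) d) y).re : ℝ) : ℂ) := fun y => by
    by_cases hy : y ∈ e.target
    · rw [chartExt_of_mem _ hy, hval, Complex.ofReal_re]
    · rw [chartExt_of_notMem _ hy]; simp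
  have hnonneg : 0 ≤ fun y => (chartExt e ((f • α) d) y).re := fun y => by
    change 0 ≤ (chartExt e ((f • α) d) y).re
    by_cases hy : y ∈ e.target
    · rw [chartExt_of_mem _ hy, hval, Complex.ofReal_re]
      exact mul_nonneg (Complex.normSq_nonneg _) χ.nonneg
    · rw [chartExt_of_notMem _ hy]; simp
  have hcont : Continuous fun y => (chartExt e ((f • α) d) y).re :=
    Complex.continuous_re.comp (contDiff_chartExt he hC hCe (hfα d)).continuous
  have hcs : HasCompactSupport fun y => (chartExt e ((f • α) d) y).re :=
    (hasCompactSupport_chartExt hC hCe (hfα d)).comp_left Complex.zero_re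
  have hint : ∫ y, (chartExt e ((f • α) d) y).re = 0 := by
    have h1 : ∫ y, (((chartExt e ((f • α) d) y).re : ℝ) : ℂ) = 0 := by
      rw [← h0]
      exact MeasureTheory.integral_congr_ae (Filter.Eventually.of_forall fun y => (hreal y).symm)
    rw [integral_complex_ofReal] at h1
    exact Complex.ofReal_eq_zero.mp h1
  have hp0 : (chartExt e ((f • α) d) (e p)).re = 0 := by
    by_contra hne
    exact (hcont.integral_pos_of_hasCompactSupport_nonneg_nonzero hcs hnonneg hne).ne' hint
  have hps : p ∈ e.source := hd.subset hpO
  rw [chartExt_of_mem _ (e.map_source hps), e.left_inv hps, hval, Complex.ofReal_re, χ.eq_one,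
    mul_one, Complex.normSq_eq_zero] at hp0
  rw [hE.form_apply_coord hd hpO, hp0, zero_mul]

-- All values of a top form are multiples of its value on E, so the support of that one function
-- works for every argument.
omit hor in
theorem IsInverseFrame.exists_suppIn {α : Form (Fn D M) D}
    (hα : α ∈ formsIn (compactIdeal D M) D) : ∃ C, IsCompact C ∧ SuppIn C α := by
  refine ⟨tsupport (α E : M → ℂ), hα E, fun Y p hp => ?_⟩
  rw [hE.form_apply α Y, Fn.mul_apply, image_eq_zero_of_notMem_tsupport hp, zero_mul]

/-- The integral over an oriented parallelizable manifold is a trace for every twist. -/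
theorem IsInverseFrame.isIntegral (T : Twist (Fn D M)) :
    T.IsIntegral (compactIdeal D M) (integral : Form (Fn D M) D → ℂ) where
  mem α f hf := by
    refine HasCompactSupport.intro (K := tsupport (f : M → ℂ)) hf fun q hq => ?_
    exact hE.apply_eq_zero _ (isClosed_tsupport _)
      (fun p hp => image_eq_zero_of_notMem_tsupport hp) hq
  add α β hα hβ := by
    obtain ⟨C, hC, h⟩ := hE.exists_suppIn hα
    obtain ⟨C', hC', h'⟩ := hE.exists_suppIn hβ
    exact hE.integral_add (hC.union hC') (h.mono Set.subset_union_left)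
      (h'.mono Set.subset_union_right)
  smul c α _ := hE.integral_smul c α
  lie γ α hα := by
    obtain ⟨C, hC, h⟩ := hE.exists_suppIn hα
    exact hE.integral_lieForm hor _ hC h
  nondegenerate _ h := hE.integral_nondegenerate hor h

end GlobalIntegral

/-! ### Values on the frame at order λ⁰ -/

section ClassicalLimit

variable {A : Type u} [CommRing A] [Algebra ℂ A] {T : Twist A} {D N : ℕ}

/-- At order `λ⁰`, a matrix-valued form takes the constant values `F` on the frame `E`. -/
def HasFrameValues (E : Fin D → VF A) {k : ℕ} (P : MForm A k N N)
    (F : (Fin k → Fin D) → Matrix (Fin N) (Fin N) ℂ) : Prop :=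
  ∀ (I : Fin k → Fin D) i j, P i j 0 (fun a => E (I a)) = algebraMap ℂ A (F I i j)

/-- The values of the product of a matrix-valued form with a matrix-valued one-form. -/
def antiMul (γ : Fin D → Matrix (Fin N) (Fin N) ℂ) {k : ℕ}
    (F : (Fin k → Fin D) → Matrix (Fin N) (Fin N) ℂ) (I : Fin (k + 1) → Fin D) :
    Matrix (Fin N) (Fin N) ℂ :=
  (-1 : ℂ) ^ k • ∑ p : Fin (k + 1), (-1 : ℂ) ^ (p : ℕ) • (F (fun i => I (p.succAbove i)) * γ (I p))

/-- At order λ⁰ the product is the ordinary wedge product, and the Laplace expansion along its last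
factor is `antiMul`, now with constant matrices. -/
theorem HasFrameValues.mmul {E : Fin D → VF A} {k : ℕ} {P : MForm A k N N} {V : MForm A 1 N N}
    {F : (Fin k → Fin D) → Matrix (Fin N) (Fin N) ℂ} {γ : Fin D → Matrix (Fin N) (Fin N) ℂ}
    (hP : HasFrameValues E P F) (hV : HasFrameValues E V fun I => γ (I 0)) :
    HasFrameValues E (T.mmul P V) (antiMul γ F) := by
  intro I i j
  have hV' : ∀ a t, contr (E a) (V t j 0) = algebraMap ℂ A (γ a t j) := fun a t => by
    rw [← hV (fun _ => a) t j, contr]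
    congr 1
    funext b
    fin_cases b
    rfl
  rw [Twist.mmul, Matrix.of_apply, Finset.sum_apply, form_sum_apply]
  have h : ∀ t, T.starWedge (P i t) (V t j) 0 (fun a => E (I a)) = algebraMap ℂ A
      ((-1) ^ k * ∑ p : Fin (k + 1), (-1) ^ (p : ℕ) *
        (F (fun i => I (p.succAbove i)) i t * γ (I p) t j)) := fun t => by
    rw [Twist.starWedge, Twist.deform_zero, wedge_one_right_apply]
    simp only [hP (fun a => I (Fin.succAbove _ a)) i t, hV', map_mul, map_pow, map_neg, map_one,
      map_sum]
  simp only [h, ← map_sum]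
  congr 1
  simp only [antiMul, Matrix.smul_apply, Matrix.sum_apply, Matrix.mul_apply, smul_eq_mul,
    Finset.mul_sum]
  rw [Finset.sum_comm]

theorem HasFrameValues.mmul_constM {E : Fin D → VF A} {k : ℕ} {P : MForm A k N N}
    {F : (Fin k → Fin D) → Matrix (Fin N) (Fin N) ℂ} (hP : HasFrameValues E P F)
    (C : Matrix (Fin N) (Fin N) ℂ) :
    HasFrameValues E (k := k) (T.mmul P (constM C)) (fun I => F I * C) := by
  intro I i j
  have h : ∀ t, T.starWedge (P i t) (constM (A := A) C t j) 0 (fun a => E (I a)) =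
      algebraMap ℂ A (F I i t * C t j) := fun t => by
    rw [Twist.starWedge, Twist.deform_zero, constM, Matrix.of_apply, Pi.single_eq_same,
      wedge_zeroForm_right, map_mul, mul_comm, ← hP I i t]
    rfl
  rw [Twist.mmul, Matrix.of_apply, Finset.sum_apply, form_sum_apply]
  refine (Finset.sum_congr rfl fun t _ => h t).trans ?_
  rw [← map_sum, ← Matrix.mul_apply]

end ClassicalLimit

/-! ### The solution operator and its classical limit -/

section Solution

variable {n N : ℕ} {M : Type u} [TopologicalSpace M]
  [ChartedSpace (EuclideanSpace ℝ (Fin (n + 1))) M]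

/-- Operators defined by an equation equivalent to `c W ⋆ D ψ = c' U ∧_⋆ d_Ω ψ`. -/
theorem IsInverseFrame.existsUnique_operator [IsManifold (𝓡 (n + 1)) ∞ M] [T2Space M]
    [SigmaCompactSpace M] {θ : Fin (n + 1) → Form (Fn (n + 1) M) 1}
    {E : Fin (n + 1) → VF (Fn (n + 1) M)} (hE : IsInverseFrame θ E) {T : Twist (Fn (n + 1) M)}
    {W : MForm (Fn (n + 1) M) (n + 1) N N} {U : MForm (Fn (n + 1) M) n N N}
    (Om : MForm (Fn (n + 1) M) 1 N N) {w c c' : ℂ} (hw : w ≠ 0) (hc : c ≠ 0)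
    (hW : ∀ i j, W i j 0 E = algebraMap ℂ (Fn (n + 1) M) (if i = j then w else 0))
    {γ : Fin (n + 1) → Matrix (Fin N) (Fin N) ℂ}
    {u : Fin (n + 1) → Matrix (Fin N) (Fin N) ℂ}
    (hU : ∀ p i j, U i j 0 (fun a => E (p.succAbove a)) = algebraMap ℂ (Fn (n + 1) M) (u p i j))
    (hu : ∀ (p : Fin (n + 1)) i j, c' * (-1) ^ n * (-1) ^ (p : ℕ) * u p i j =
      c * w * (Complex.I * ∑ b, eta p b * γ b i j))
    {AC : Spinor (Fn (n + 1) M) N → Spinor (Fn (n + 1) M) N → Prop}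
    (hAC : ∀ χ ψ, AC χ ψ ↔ ∀ j, c • T.matMul W χ j = c' • T.matWedge U (T.covD Om ψ) j) :
    (∃! Dop : Spinor (Fn (n + 1) M) N → Spinor (Fn (n + 1) M) N, ∀ ψ, AC (Dop ψ) ψ) ∧
    ∀ Dop : Spinor (Fn (n + 1) M) N → Spinor (Fn (n + 1) M) N, (∀ ψ, AC (Dop ψ) ψ) →
      IsFirstOrderNC T Dop ∧ UniqueSymbol T Dop ∧ (∀ χ ψ, AC χ ψ ↔ χ = Dop ψ) ∧
      ∀ ψ, (fun i => Dop ψ i 0) = classicalDirac γ E (fun i j => Om i j 0) (fun i => ψ i 0) := by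
  have hext : ∀ α β : Form (Fn (n + 1) M) (n + 1), α E = β E → α = β := fun α β h => hE.form_ext h
  obtain ⟨H, hH⟩ := exists_series_solution (T := T) hext hw hW U Om hc c'
  have hsol : ∀ χ ψ, AC χ ψ ↔ χ = serOp H ψ := fun χ ψ => (hAC χ ψ).trans (hH χ ψ)
  refine ⟨⟨serOp H, fun ψ => (hsol _ ψ).mpr rfl, fun D' hD' => funext fun ψ =>
    (hsol _ ψ).mp (hD' ψ)⟩, fun Dop hDop => ?_⟩
  obtain rfl : Dop = serOp H := funext fun ψ => (hsol _ ψ).mp (hDop ψ)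
  have hD : ∀ ψ j, c • T.matMul W (serOp H ψ) j = c' • T.matWedge U (T.covD Om ψ) j := fun ψ =>
    (hAC _ ψ).mp (hDop ψ)
  have hQ := exists_symbol (T := T) hext hw hW hE.1 hE.2 U Om hc c' hD
  refine ⟨⟨serOp_isDiffOp H, hQ⟩, fun ψ => ?_, hsol, fun ψ => funext fun j => ?_⟩
  · obtain ⟨Q, hQ⟩ := hQ ψ
    refine ⟨Q, hQ, fun Q' hQ' => funext fun i => starContr_dFn_injective (T := T) fun a => ?_⟩
    have h := (hQ' a).symm.trans (hQ a)
    exact congrFun (add_left_cancel h) i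
  -- Evaluate the strong equation on E at order λ⁰. The left side is c w Dψ; the Laplace expansion
  -- on the right gives a sum over p, and `hu` identifies its coefficients with c w times iγ^p.
  · have h0 := congrArg (fun F : FS (Form (Fn (n + 1) M) (n + 1)) => F 0 E) (hD ψ j)
    simp only [Pi.smul_apply, Twist.matMul, Twist.matWedge, Finset.sum_apply, Twist.starR,
      Twist.starWedge, Twist.deform_zero, Twist.covD, Pi.sub_apply] at h0
    change c • (∑ k, serOp H ψ k 0 • W j k 0 : Form (Fn (n + 1) M) (n + 1)) E =
      c' • (∑ k, wedge (U j k 0) (dFn (ψ k 0) - ∑ l, ψ l 0 • Om k l 0) :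
        Form (Fn (n + 1) M) (n + 1)) E at h0
    rw [form_sum_apply, form_sum_apply] at h0
    have hleft : ∑ k, (serOp H ψ k 0 • W j k 0) E = w • serOp H ψ j 0 := by
      have : ∀ k, (serOp H ψ k 0 • W j k 0) E = if j = k then w • serOp H ψ k 0 else 0 := by
        intro k
        change serOp H ψ k 0 * W j k 0 E = _
        rw [hW]
        split_ifs
        · rw [Algebra.smul_def, mul_comm]
        · simp
      simp [this]
    have hcontr : ∀ p k, contr (E p) (dFn (ψ k 0) - ∑ l, ψ l 0 • Om k l 0) =
        E p (ψ k 0) - ∑ l, contr (E p) (Om k l 0) * ψ l 0 := by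
      intro p k
      rw [contr, AlternatingMap.sub_apply, form_sum_apply]
      congr 1
      refine Finset.sum_congr rfl fun l _ => ?_
      exact mul_comm _ _
    have hright : ∀ k, c' • wedge (U j k 0) (dFn (ψ k 0) - ∑ l, ψ l 0 • Om k l 0) E =
        ∑ p, (c * w) • ((Complex.I * ∑ b, eta p b * γ b j k) •
          (E p (ψ k 0) - ∑ l, contr (E p) (Om k l 0) * ψ l 0)) := by
      intro k
      rw [wedge_one_right_apply, Finset.mul_sum, Finset.smul_sum]
      refine Finset.sum_congr rfl fun p _ => ?_
      rw [hU, hcontr, smul_smul, ← hu, Algebra.smul_def, Algebra.smul_def]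
      simp only [map_mul, map_pow, map_neg, map_one]
      ring
    rw [hleft, Finset.smul_sum, Finset.sum_congr rfl fun k _ => hright k, smul_smul,
      Finset.sum_comm] at h0
    simp only [← Finset.smul_sum] at h0
    have hcw : c * w ≠ 0 := mul_ne_zero hc hw
    have h1 := congrArg (fun f : Fn (n + 1) M => (c * w)⁻¹ • f) h0
    simp only [smul_smul, inv_mul_cancel₀ hcw, one_smul] at h1
    exact h1

end Solution

/-! ### Dirac adjoints as test rows -/

section Adjoint

variable {D N : ℕ} {M : Type u} [TopologicalSpace M] [ChartedSpace (EuclideanSpace ℝ (Fin D)) M]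

/-- The components of the Dirac adjoint. -/
def adjFn (g0 : Matrix (Fin N) (Fin N) ℂ) (φ : Spinor (Fn D M) N) : Spinor (Fn D M) N :=
  fun j m => ∑ i, g0 i j • conjFn (φ i m)

/-- A row of functions, as a row of `0`-forms. -/
def row {A : Type u} [CommRing A] [Algebra ℂ A] (ξ : Spinor A N) : MForm A 0 1 N :=
  Matrix.of fun _ j m => zeroForm (ξ j m)

theorem conjFn_mem {f : Fn D M} (hf : f ∈ compactIdeal D M) : conjFn f ∈ compactIdeal D M :=
  HasCompactSupport.comp_left (g := starRingEnd ℂ) hf (map_zero _)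

theorem smul_mem_compactIdeal (c : ℂ) {f : Fn D M} (hf : f ∈ compactIdeal D M) :
    c • f ∈ compactIdeal D M := by
  rw [Algebra.smul_def]
  exact Ideal.mul_mem_left _ _ hf

theorem conjFn_conjFn (f : Fn D M) : conjFn (conjFn f) = f :=
  Fn.ext fun x => Complex.conj_conj (f x)

/-- Every row ξ is an adjoint: conjugating ξ γ₀ gives φ, and γ₀² = 1 makes the adjoint of φ equal to
ξ again. Neither step enlarges supports beyond compact ones. -/
theorem forall_compactSpinor_iff {g0 : Matrix (Fin N) (Fin N) ℂ} (h0 : g0 * g0 = 1)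
    {P : Spinor (Fn D M) N → Prop} :
    (∀ φ, CompactSpinor φ → P (adjFn g0 φ)) ↔
      ∀ ξ : Spinor (Fn D M) N, (∀ j m, ξ j m ∈ compactIdeal D M) → P ξ := by
  constructor
  · intro h ξ hξ
    have hφ : CompactSpinor fun i m => conjFn (∑ j, g0 j i • ξ j m) := fun i m =>
      conjFn_mem (Ideal.sum_mem _ fun j _ => smul_mem_compactIdeal _ (hξ j m))
    have hadj : adjFn g0 (fun i m => conjFn (∑ j, g0 j i • ξ j m)) = ξ := by
      funext j m
      simp only [adjFn, conjFn_conjFn, Finset.smul_sum, smul_smul]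
      rw [Finset.sum_comm]
      simp only [← Finset.sum_smul]
      have : ∀ l, ∑ i, g0 i j * g0 l i = if l = j then 1 else 0 := fun l => by
        rw [← Matrix.one_apply, ← h0, Matrix.mul_apply]
        exact Finset.sum_congr rfl fun i _ => mul_comm _ _
      simp [this]
    exact hadj ▸ h _ hφ
  · intro h φ hφ
    exact h _ fun j m => Ideal.sum_mem _ fun i _ => smul_mem_compactIdeal _ (conjFn_mem (hφ i m))

end Adjoint

/-! ### Traces in the form needed for cyclicity -/

section Degrees

variable {A : Type u} [CommRing A] [Algebra ℂ A] {T : Twist A} {N : ℕ}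

/-- Bridges the degrees 1 + n and n + 1: the Laplace expansions of ϑ ∧ β and β ∧ ϑ differ exactly by
the sign built into `oneWedge`. -/
theorem Twist.starWedge_one_left_apply {n : ℕ} (ϑ : FS (Form A 1)) (β : FS (Form A n)) (m : ℕ)
    (Y : Fin (n + 1) → VF A) :
    T.starWedge ϑ β m (fun i => Y (Fin.cast (add_comm 1 n) i)) = T.starOneWedge ϑ β m Y := by
  have h := Twist.map_deform (T := T) (actP := fun X α => lieForm X α)
    (actQ := fun X α => lieForm X α) (actP' := fun X α => lieForm X α)
    (actQ' := fun X α => lieForm X α) (fun (α : Form A 1) (β : Form A n) => wedge α β)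
    (fun (α : Form A 1) (β : Form A n) => oneWedge α β) id id
    ({ toFun := fun α => α.domDomCongr (finCongr (add_comm 1 n))
       map_add' := fun _ _ => rfl
       map_smul' := fun _ _ => rfl } : Form A (1 + n) →ₗ[ℂ] Form A (n + 1))
    (fun _ _ => rfl) (fun _ _ => rfl)
    (fun p q => by
      ext Y
      refine (wedge_one_left_apply p q Y).trans ?_
      rw [oneWedge, AlternatingMap.smul_apply, wedge_one_right_apply, Algebra.smul_def, ← mul_assoc,
        map_pow, map_neg, map_one, ← mul_pow]
      simp) ϑ β m
  exact congrArg (fun F : Form A (n + 1) => F Y) h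

theorem Twist.covDiff_col (Om : MForm A 1 N N) (ψ : Spinor A N) (i : Fin N) :
    T.covDiff Om (col ψ) i 0 = T.covD Om ψ i := by
  have h : ∀ j, T.starWedge (Om i j) (col ψ j 0) = T.starR (Om i j) (ψ j) := fun j =>
    Twist.starWedge_zeroForm_right (Om i j) (ψ j)
  rw [Twist.covD, ← Finset.sum_congr rfl fun j _ => h j]
  rfl

theorem Twist.mmul_apply {k l r s c : ℕ} (P : MForm A k r s) (Q : MForm A l s c) (i : Fin r)
    (j : Fin c) : T.mmul P Q i j = ∑ t, T.starWedge (P i t) (Q t j) := rfl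

theorem Twist.mmul_col_row {k l r c : ℕ} (P : MForm A k r 1) (Q : MForm A l 1 c) (i : Fin r)
    (j : Fin c) : T.mmul P Q i j = T.starWedge (P i 0) (Q 0 j) := by
  rw [Twist.mmul, Matrix.of_apply, Fin.sum_univ_one]

/-- For literal degrees 0 + (0 + 2) computes to 2, so both sides can be compared as 2-forms; this is
why the degrees 2 and 4 are treated separately. -/
theorem Twist.trace_col_row_two (χ ξ : Spinor A N) (W : MForm A 2 N N) :
    (Matrix.trace (T.mmul (col χ) (T.mmul (row ξ) W)) : FS (Form A 2)) =
      ∑ i, T.starL (χ i) (∑ j, T.starL (ξ j) (W j i)) := by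
  have hL : ∀ (f : FS A) (β : FS (Form A 2)),
      (T.starWedge (fun m => zeroForm (f m)) β : FS (Form A 2)) = T.starL f β := fun f β =>
    funext fun m => AlternatingMap.ext fun Y => Twist.starWedge_zeroForm_left_apply f β m Y
  refine Finset.sum_congr rfl fun i _ => ?_
  refine (Twist.mmul_col_row _ _ i i).trans ?_
  refine (hL (χ i) _).trans ?_
  congr 1
  exact (Twist.mmul_apply (row ξ) W 0 i).trans (Finset.sum_congr rfl fun j _ => hL (ξ j) (W j i))

theorem Twist.trace_row_two (ϑ : MForm A 1 N 1) (ξ : Spinor A N) (U : MForm A 1 N N) :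
    (Matrix.trace (T.mmul ϑ (T.mmul (row ξ) U)) : FS (Form A 2)) =
      ∑ i, T.starOneWedge (ϑ i 0) (∑ j, T.starL (ξ j) (U j i)) := by
  have hL : ∀ (f : FS A) (β : FS (Form A 1)),
      (T.starWedge (fun m => zeroForm (f m)) β : FS (Form A 1)) = T.starL f β := fun f β =>
    funext fun m => AlternatingMap.ext fun Y => Twist.starWedge_zeroForm_left_apply f β m Y
  have hO : ∀ (α : FS (Form A 1)) (β : FS (Form A 1)),
      (T.starWedge α β : FS (Form A 2)) = T.starOneWedge α β := fun α β =>
    funext fun m => AlternatingMap.ext fun Y => Twist.starWedge_one_left_apply α β m Y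
  refine Finset.sum_congr rfl fun i _ => ?_
  refine (Twist.mmul_col_row _ _ i i).trans ?_
  refine (hO (ϑ i 0) _).trans ?_
  congr 1
  exact (Twist.mmul_apply (row ξ) U 0 i).trans (Finset.sum_congr rfl fun j _ => hL (ξ j) (U j i))

theorem Twist.trace_col_row_four (χ ξ : Spinor A N) (W : MForm A 4 N N) :
    (Matrix.trace (T.mmul (col χ) (T.mmul (row ξ) W)) : FS (Form A 4)) =
      ∑ i, T.starL (χ i) (∑ j, T.starL (ξ j) (W j i)) := by
  have hL : ∀ (f : FS A) (β : FS (Form A 4)),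
      (T.starWedge (fun m => zeroForm (f m)) β : FS (Form A 4)) = T.starL f β := fun f β =>
    funext fun m => AlternatingMap.ext fun Y => Twist.starWedge_zeroForm_left_apply f β m Y
  refine Finset.sum_congr rfl fun i _ => ?_
  refine (Twist.mmul_col_row _ _ i i).trans ?_
  refine (hL (χ i) _).trans ?_
  congr 1
  exact (Twist.mmul_apply (row ξ) W 0 i).trans (Finset.sum_congr rfl fun j _ => hL (ξ j) (W j i))

theorem Twist.trace_row_four (ϑ : MForm A 1 N 1) (ξ : Spinor A N) (U : MForm A 3 N N) :
    (Matrix.trace (T.mmul ϑ (T.mmul (row ξ) U)) : FS (Form A 4)) =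
      ∑ i, T.starOneWedge (ϑ i 0) (∑ j, T.starL (ξ j) (U j i)) := by
  have hL : ∀ (f : FS A) (β : FS (Form A 3)),
      (T.starWedge (fun m => zeroForm (f m)) β : FS (Form A 3)) = T.starL f β := fun f β =>
    funext fun m => AlternatingMap.ext fun Y => Twist.starWedge_zeroForm_left_apply f β m Y
  have hO : ∀ (α : FS (Form A 1)) (β : FS (Form A 3)),
      (T.starWedge α β : FS (Form A 4)) = T.starOneWedge α β := fun α β =>
    funext fun m => AlternatingMap.ext fun Y => Twist.starWedge_one_left_apply α β m Y
  refine Finset.sum_congr rfl fun i _ => ?_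
  refine (Twist.mmul_col_row _ _ i i).trans ?_
  refine (hO (ϑ i 0) _).trans ?_
  congr 1
  exact (Twist.mmul_apply (row ξ) U 0 i).trans (Finset.sum_congr rfl fun j _ => hL (ξ j) (U j i))

end Degrees

/-! ### Gamma matrix identities -/

section Clifford

variable {N : ℕ} {D : ℕ} {γ : Fin D → Matrix (Fin N) (Fin N) ℂ}

/-- For distinct indices the gammas anticommute, so every signed reordering equals the ordered
product. Iterating gives the factors 2!, 3! and 4! here and in the next two lemmas. -/
theorem antiMul_two {I : Fin 2 → Fin D} (hI : Function.Injective I)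
    (h : ∀ a b, a ≠ b → γ b * γ a = -(γ a * γ b)) :
    antiMul γ (fun J : Fin 1 → Fin D => γ (J 0)) I = (2 : ℂ) • (γ (I 0) * γ (I 1)) := by
  have h10 := h (I 0) (I 1) fun h => absurd (hI h) (by decide)
  simp [antiMul, Fin.sum_univ_two, h10, Fin.succAbove]
  module

theorem antiMul_three {I : Fin 3 → Fin D} (hI : Function.Injective I)
    (h : ∀ a b, a ≠ b → γ b * γ a = -(γ a * γ b)) :
    antiMul γ (antiMul γ (fun J : Fin 1 → Fin D => γ (J 0))) I =
      (6 : ℂ) • (γ (I 0) * γ (I 1) * γ (I 2)) := by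
  have h10 := h (I 0) (I 1) fun h => absurd (hI h) (by decide)
  have h20 := h (I 0) (I 2) fun h => absurd (hI h) (by decide)
  have h21 := h (I 1) (I 2) fun h => absurd (hI h) (by decide)
  have h2 : ∀ p : Fin 3, antiMul γ (fun J : Fin 1 → Fin D => γ (J 0)) (fun i => I (p.succAbove i)) =
      (2 : ℂ) • (γ (I (p.succAbove 0)) * γ (I (p.succAbove 1))) := fun p =>
    antiMul_two (hI.comp (Fin.succAbove_right_injective (p := p))) h
  have e0 : γ (I 1) * γ (I 2) * γ (I 0) = γ (I 0) * γ (I 1) * γ (I 2) := by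
    rw [mul_assoc, h20, mul_neg, ← mul_assoc, h10, neg_mul, neg_neg]
  have e1 : γ (I 0) * γ (I 2) * γ (I 1) = -(γ (I 0) * γ (I 1) * γ (I 2)) := by
    rw [mul_assoc, h21, mul_neg, ← mul_assoc]
  rw [antiMul]
  simp only [h2]
  refine (congrArg _ (Fin.sum_univ_three _)).trans ?_
  change (-1 : ℂ) ^ 2 • ((-1 : ℂ) ^ 0 • ((2 : ℂ) • (γ (I 1) * γ (I 2)) * γ (I 0)) +
    (-1 : ℂ) ^ 1 • ((2 : ℂ) • (γ (I 0) * γ (I 2)) * γ (I 1)) +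
    (-1 : ℂ) ^ 2 • ((2 : ℂ) • (γ (I 0) * γ (I 1)) * γ (I 2))) = _
  simp only [smul_mul_assoc, e0, e1]
  norm_num
  module

theorem antiMul_four {I : Fin 4 → Fin D} (hI : Function.Injective I)
    (h : ∀ a b, a ≠ b → γ b * γ a = -(γ a * γ b)) :
    antiMul γ (antiMul γ (antiMul γ (fun J : Fin 1 → Fin D => γ (J 0)))) I =
      (24 : ℂ) • (γ (I 0) * γ (I 1) * γ (I 2) * γ (I 3)) := by
  have h10 := h (I 0) (I 1) fun h => absurd (hI h) (by decide)
  have h20 := h (I 0) (I 2) fun h => absurd (hI h) (by decide)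
  have h30 := h (I 0) (I 3) fun h => absurd (hI h) (by decide)
  have h21 := h (I 1) (I 2) fun h => absurd (hI h) (by decide)
  have h31 := h (I 1) (I 3) fun h => absurd (hI h) (by decide)
  have h32 := h (I 2) (I 3) fun h => absurd (hI h) (by decide)
  have h3 : ∀ p : Fin 4, antiMul γ (antiMul γ (fun J : Fin 1 → Fin D => γ (J 0)))
      (fun i => I (p.succAbove i)) =
      (6 : ℂ) • (γ (I (p.succAbove 0)) * γ (I (p.succAbove 1)) * γ (I (p.succAbove 2))) := fun p =>
    antiMul_three (hI.comp (Fin.succAbove_right_injective (p := p))) h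
  have e2 : γ (I 0) * γ (I 1) * γ (I 3) * γ (I 2) =
      -(γ (I 0) * γ (I 1) * γ (I 2) * γ (I 3)) := by
    rw [mul_assoc _ (γ (I 3)), h32, mul_neg, ← mul_assoc]
  have e1 : γ (I 0) * γ (I 2) * γ (I 3) * γ (I 1) = γ (I 0) * γ (I 1) * γ (I 2) * γ (I 3) := by
    rw [mul_assoc _ (γ (I 3)), h31, mul_neg, ← mul_assoc, mul_assoc _ (γ (I 2)), h21, mul_neg,
      neg_mul, neg_neg, ← mul_assoc]
  have e0 : γ (I 1) * γ (I 2) * γ (I 3) * γ (I 0) =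
      -(γ (I 0) * γ (I 1) * γ (I 2) * γ (I 3)) := by
    rw [mul_assoc _ (γ (I 3)), h30, mul_neg, ← mul_assoc, mul_assoc _ (γ (I 2)), h20, mul_neg,
      neg_mul, neg_neg, ← mul_assoc, h10, neg_mul, neg_mul]
  rw [antiMul]
  simp only [h3]
  refine (congrArg _ (Fin.sum_univ_four _)).trans ?_
  change (-1 : ℂ) ^ 3 • ((-1 : ℂ) ^ 0 • ((6 : ℂ) • (γ (I 1) * γ (I 2) * γ (I 3)) * γ (I 0)) +
    (-1 : ℂ) ^ 1 • ((6 : ℂ) • (γ (I 0) * γ (I 2) * γ (I 3)) * γ (I 1)) +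
    (-1 : ℂ) ^ 2 • ((6 : ℂ) • (γ (I 0) * γ (I 1) * γ (I 3)) * γ (I 2)) +
    (-1 : ℂ) ^ 3 • ((6 : ℂ) • (γ (I 0) * γ (I 1) * γ (I 2)) * γ (I 3))) = _
  simp only [smul_mul_assoc, e0, e1, e2]
  norm_num
  module

theorem gamma2_zero_sq : gamma2 0 * gamma2 0 = 1 := by
  ext i j
  fin_cases i <;> fin_cases j <;> simp [gamma2]

theorem gamma2_anticomm (a b : Fin 2) (h : a ≠ b) :
    gamma2 b * gamma2 a = -(gamma2 a * gamma2 b) := by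
  ext i j
  fin_cases a <;> fin_cases b <;> first | exact absurd rfl h | skip
  all_goals fin_cases i <;> fin_cases j <;> simp [gamma2]

theorem gamma2chir_sq : gamma2 0 * gamma2 1 * gamma2chir = 1 := by
  ext i j
  fin_cases i <;> fin_cases j <;> simp [gamma2, gamma2chir]

/-- Contracting with γ₃ turns the gamma matrix left after omitting γ_p into γ^p, up to the Laplace
sign. -/
theorem gamma2_mul_chir (p : Fin 2) (i j : Fin 2) :
    (-1) ^ (p : ℕ) * (gamma2 (p.succAbove 0) * gamma2chir) i j = ∑ b, eta p b * gamma2 b i j := by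
  fin_cases p <;> fin_cases i <;> fin_cases j <;>
    simp [gamma2, gamma2chir, eta, Fin.succAbove]

variable (g : Gamma4)

theorem Gamma4.anticomm (a b : Fin 4) (h : a ≠ b) : g.γ b * g.γ a = -(g.γ a * g.γ b) := by
  have := g.clifford a b
  rw [eta, if_neg h, mul_zero, zero_smul] at this
  exact eq_neg_of_add_eq_zero_right this

theorem Gamma4.sq (a : Fin 4) : g.γ a * g.γ a = (eta a a) • 1 := by
  have := g.clifford a a
  rw [← two_smul ℂ, mul_smul] at this
  exact smul_right_injective _ (two_ne_zero' ℂ) this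

theorem Gamma4.sq_zero : g.γ 0 * g.γ 0 = 1 := by
  rw [g.sq, eta, if_pos rfl, if_pos (by rfl), one_smul]

theorem Gamma4.sq_of_ne {a : Fin 4} (h : a.val ≠ 0) : g.γ a * g.γ a = -1 := by
  rw [g.sq, eta, if_pos rfl, if_neg h, neg_smul, one_smul]

theorem Gamma4.mul_chir :
    g.γ 0 * g.γ 1 * g.γ 2 * g.γ 3 * g.chir = (-Complex.I) • 1 ∧
    g.γ 1 * g.γ 2 * g.γ 3 * g.chir = (-Complex.I) • g.γ 0 ∧
    g.γ 0 * g.γ 2 * g.γ 3 * g.chir = (-Complex.I) • g.γ 1 ∧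
    g.γ 0 * g.γ 1 * g.γ 3 * g.chir = Complex.I • g.γ 2 ∧
    g.γ 0 * g.γ 1 * g.γ 2 * g.chir = (-Complex.I) • g.γ 3 := by
  have h00 := g.sq_zero
  have h11 := g.sq_of_ne (a := 1) (by decide)
  have h22 := g.sq_of_ne (a := 2) (by decide)
  have h33 := g.sq_of_ne (a := 3) (by decide)
  have h10 := g.anticomm 0 1 (by decide)
  have h20 := g.anticomm 0 2 (by decide)
  have h30 := g.anticomm 0 3 (by decide)
  have h21 := g.anticomm 1 2 (by decide)
  have h31 := g.anticomm 1 3 (by decide)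
  have h32 := g.anticomm 2 3 (by decide)
  -- Extends each relation to right-nested words, so that the rewriting sorts the gammas and cancels
  -- squares.
  have assoc : ∀ {x y z : Matrix (Fin 4) (Fin 4) ℂ}, x * y = z → ∀ t, x * (y * t) = z * t :=
    fun h t => by rw [← mul_assoc, h]
  rw [Gamma4.chir]
  simp only [mul_smul_comm, mul_assoc, h00, h11, h22, h33,
    assoc h00, assoc h11, assoc h22, assoc h10, assoc h20, assoc h30, assoc h21,
    assoc h31, assoc h32, neg_mul, mul_neg, one_mul, mul_one, neg_neg, smul_neg, neg_smul, and_self]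

/-- Removing γ_p from γ₀γ₁γ₂γ₃ and multiplying by γ₅ leaves γ_p up to a phase; the Laplace sign and
η_pp make that phase -i for all p. -/
theorem Gamma4.succAbove_mul_chir (p i j : Fin 4) :
    (-1) ^ (p : ℕ) * (g.γ (p.succAbove 0) * g.γ (p.succAbove 1) * g.γ (p.succAbove 2) * g.chir) i j =
      -Complex.I * ∑ b, eta p b * g.γ b i j := by
  obtain ⟨-, h0, h1, h2, h3⟩ := g.mul_chir
  have hsum : ∑ b, eta p b * g.γ b i j = eta p p * g.γ p i j := by
    refine Finset.sum_eq_single p (fun b _ hb => ?_) (by simp)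
    rw [eta, if_neg hb.symm, zero_mul]
  rw [hsum]
  fin_cases p
  · change (-1) ^ 0 * (g.γ 1 * g.γ 2 * g.γ 3 * g.chir) i j = -Complex.I * (eta 0 0 * g.γ 0 i j)
    rw [h0]; simp [eta]
  · change (-1) ^ 1 * (g.γ 0 * g.γ 2 * g.γ 3 * g.chir) i j = -Complex.I * (eta 1 1 * g.γ 1 i j)
    rw [h1]; simp [eta]
  · change (-1) ^ 2 * (g.γ 0 * g.γ 1 * g.γ 3 * g.chir) i j = -Complex.I * (eta 2 2 * g.γ 2 i j)
    rw [h2]; simp [eta]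
  · change (-1) ^ 3 * (g.γ 0 * g.γ 1 * g.γ 2 * g.chir) i j = -Complex.I * (eta 3 3 * g.γ 3 i j)
    rw [h3]; simp [eta, pow_succ]

end Clifford

/-! ### Vielbein values on the frame -/

section Frames

variable {D N : ℕ} {M : Type u} [TopologicalSpace M] [ChartedSpace (EuclideanSpace ℝ (Fin D)) M]

theorem IsInverseFrame.hasFrameValues {Vc : Fin D → FS (Form (Fn D M) 1)}
    {E : Fin D → VF (Fn D M)} (hE : IsInverseFrame (fun a => Vc a 0) E) {V : MForm (Fn D M) 1 N N}
    {γ : Fin D → Matrix (Fin N) (Fin N) ℂ} (hV : ∀ i j, V i j 0 = ∑ a, γ a i j • Vc a 0) :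
    HasFrameValues E V fun I => γ (I 0) := by
  intro I i j
  have h : ∀ a, Vc a 0 (fun b => E (I b)) = if I 0 = a then 1 else 0 := fun a => by
    rw [← hE.1 (I 0) a, contr]
    congr 1
    funext b
    fin_cases b
    rfl
  rw [hV, form_sum_apply]
  simp only [AlternatingMap.smul_apply, h, smul_ite, smul_zero, Finset.sum_ite_eq,
    Finset.mem_univ, if_true]
  rw [Algebra.smul_def, mul_one]

theorem integralFS_smul [IsManifold (𝓡 D) ∞ M] [T2Space M] [SigmaCompactSpace M]
    {θ : Fin D → Form (Fn D M) 1} {E : Fin D → VF (Fn D M)} (hE : IsInverseFrame θ E) (c : ℂ)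
    (α : FS (Form (Fn D M) D)) : integralFS (c • α) = c • integralFS α :=
  funext fun m => hE.integral_smul c (α m)

end Frames

/-! ### The operator in two dimensions -/

section Two

variable {M : Type u} [TopologicalSpace M] [ChartedSpace (EuclideanSpace ℝ (Fin 2)) M]

theorem Cartan2.hasFrameValues (G : Cartan2 M) :
    HasFrameValues G.E G.V fun I => gamma2 (I 0) :=
  G.inverse.hasFrameValues fun i j => by
    simp [Cartan2.V, formTimes, Matrix.sum_apply]

variable [IsManifold (𝓡 2) ∞ M] [T2Space M] [SigmaCompactSpace M]

/-- The Aschieri–Castellani equation for the value `χ` of the operator on `ψ`. -/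
def ACEquation2 (T : ManifoldTwist 2 M) (G : Cartan2 M) (χ ψ : Spinor (Fn 2 M) 2) : Prop :=
  ∀ φ, CompactSpinor φ → inner2 T G φ χ =
    (2 * Complex.I) • integralFS (D := 2) (Matrix.trace (T.mmul (T.covDiff G.Om (col ψ))
      (T.mmul (diracAdjoint (gamma2 0) (col φ)) (T.mmul G.V (constM gamma2chir)))))

theorem isAC2_iff (T : ManifoldTwist 2 M) (G : Cartan2 M)
    (Dop : Spinor (Fn 2 M) 2 → Spinor (Fn 2 M) 2) :
    IsAC2 T G Dop ↔ ∀ ψ, ACEquation2 T G (Dop ψ) ψ :=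
  ⟨fun h ψ φ hφ => h φ ψ hφ, fun h φ ψ hφ => h ψ φ hφ⟩

/-- The matrix-valued two-form `V ∧_⋆ V γ₃`. -/
def Cartan2.W (T : ManifoldTwist 2 M) (G : Cartan2 M) : MForm (Fn 2 M) 2 2 2 :=
  T.mmul (T.mmul G.V G.V) (constM gamma2chir)

/-- The matrix-valued one-form `V γ₃`. -/
def Cartan2.U (T : ManifoldTwist 2 M) (G : Cartan2 M) : MForm (Fn 2 M) 1 2 2 :=
  T.mmul G.V (constM gamma2chir)

/-- The factor 2i is that of the weak equation; (-1)^1 comes from moving the one-form d_Ω ψ past the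
one-form V γ₃. -/
theorem acEquation2_iff (hor : IsOriented 2 M) (T : ManifoldTwist 2 M) (G : Cartan2 M)
    (χ ψ : Spinor (Fn 2 M) 2) :
    ACEquation2 T G χ ψ ↔ ∀ j, (1 : ℂ) • T.matMul (G.W T) χ j =
      (2 * Complex.I * (-1) ^ 1) • T.matWedge (G.U T) (T.covD G.Om ψ) j := by
  rw [← (G.inverse.isIntegral hor T.toTwist).weak_iff_strong (G.W T) (G.U T) (T.covD G.Om ψ) χ 1
    (2 * Complex.I), ← forall_compactSpinor_iff gamma2_zero_sq]
  refine forall_congr' fun φ => imp_congr_right fun _ => ?_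
  have h1 := Twist.trace_col_row_two (T := T.toTwist) χ (adjFn (gamma2 0) φ) (G.W T)
  have h2 := Twist.trace_row_two (T := T.toTwist) (T.covDiff G.Om (col ψ)) (adjFn (gamma2 0) φ)
    (G.U T)
  simp only [Twist.covDiff_col] at h2
  rw [funext_iff]
  refine forall_congr' fun m => ?_
  rw [one_mul, ← h1, ← h2]
  rfl

/-- The system of equations which defines the operator in two dimensions. -/
def geoSystem2 : GeoSystem 2 2 where
  p := 0
  sh := Fin.elim0
  eqs := [.integrated
    (.tr (.mul .val (.mul (.adj .test) (.mul (.mul .vielbein .vielbein) (.cliff gamma2chir)))))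
    (.smul (2 * Complex.I)
      (.tr (.mul (.cov .arg) (.mul (.adj .test) (.mul .vielbein (.cliff gamma2chir))))))]

theorem geoSystem2_holds (T : ManifoldTwist 2 M) (G : Cartan2 M) (χ ψ : Spinor (Fn 2 M) 2)
    (Q : ∀ i, Matrix (Fin (geoSystem2.sh i).1) (Fin (geoSystem2.sh i).2) (FS (VF (Fn 2 M)))) :
    (∀ φ, CompactSpinor φ → ∀ e ∈ geoSystem2.eqs, e.Holds T (gamma2 0) G.V G.Om ψ χ φ Q) ↔
      ACEquation2 T G χ ψ := by
  refine forall_congr' fun φ => imp_congr_right fun _ => ?_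
  refine List.forall_mem_singleton.trans ?_
  rw [← integralFS_smul G.inverse]
  rfl

theorem geoSystem2_constructs (T : ManifoldTwist 2 M) (G : Cartan2 M)
    {Dop : Spinor (Fn 2 M) 2 → Spinor (Fn 2 M) 2}
    (h : ∀ χ ψ, ACEquation2 T G χ ψ ↔ χ = Dop ψ) :
    geoSystem2.Constructs T (gamma2 0) G.V G.Om Dop := by
  intro ψ
  -- The system has no unknown vector fields, so Q is the empty family and is trivially unique.
  refine ⟨fun i => i.elim0, fun Q' χ => ?_⟩
  rw [geoSystem2_holds, h]
  exact ⟨fun h => ⟨funext fun i => i.elim0, h⟩, fun h => h.2⟩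

/-- On the frame V ∧ V γ₃ equals 2 γ₀γ₁γ₃ = 2 γ₃² = 2. -/
theorem Cartan2.W_apply (T : ManifoldTwist 2 M) (G : Cartan2 M) (i j : Fin 2) :
    G.W T i j 0 G.E = algebraMap ℂ (Fn 2 M) (if i = j then 2 else 0) := by
  have hVV : HasFrameValues (k := 2) G.E (T.mmul G.V G.V) (antiMul gamma2 fun I => gamma2 (I 0)) :=
    G.hasFrameValues.mmul G.hasFrameValues
  have hW : HasFrameValues G.E (G.W T) fun I =>
      antiMul gamma2 (fun I : Fin 1 → Fin 2 => gamma2 (I 0)) I * gamma2chir :=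
    hVV.mmul_constM gamma2chir
  have h : antiMul gamma2 (fun I : Fin 1 → Fin 2 => gamma2 (I 0)) id * gamma2chir =
      (2 : ℂ) • (1 : Matrix (Fin 2) (Fin 2) ℂ) := by
    rw [antiMul_two Function.injective_id gamma2_anticomm, smul_mul_assoc]
    exact congrArg _ gamma2chir_sq
  refine (hW id i j).trans (congrArg (algebraMap ℂ (Fn 2 M)) ?_)
  refine (congrFun (congrFun h i) j).trans ?_
  simp [Matrix.one_apply]

theorem exists_operator2 (hor : IsOriented 2 M) (T : ManifoldTwist 2 M) (G : Cartan2 M) :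
    (∃! Dop, IsAC2 T G Dop) ∧
    ∀ Dop, IsAC2 T G Dop →
      IsNCDirac T gamma2 G.V G.Om G.E Dop ∧ UniqueSymbol T.toTwist Dop ∧
      geoSystem2.Constructs T (gamma2 0) G.V G.Om Dop := by
  have key := G.inverse.existsUnique_operator (T := T.toTwist) (W := G.W T) (U := G.U T) G.Om
    (w := 2) (c := 1) (c' := 2 * Complex.I * (-1) ^ 1) two_ne_zero one_ne_zero (G.W_apply T)
    (γ := gamma2) (u := fun p => gamma2 (p.succAbove 0) * gamma2chir)
    (fun p i j => (G.hasFrameValues.mmul_constM (T := T.toTwist) gamma2chir) p.succAbove i j)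
    -- The two signs -1 cancel, so both sides carry the constant 2i = 1 · 2 · i.
    (fun p i j => by
      rw [← gamma2_mul_chir]
      ring)
    (acEquation2_iff hor T G)
  simp only [← isAC2_iff] at key
  refine ⟨key.1, fun Dop hDop => ?_⟩
  obtain ⟨h1, h2, h3, h4⟩ := key.2 Dop hDop
  have hS := geoSystem2_constructs T G h3
  exact ⟨⟨h1, ⟨h1.1, _, hS⟩, h4⟩, h2, hS⟩

end Two

/-! ### The operator in four dimensions -/

section Four

variable {g : Gamma4} {M : Type u} [TopologicalSpace M]
  [ChartedSpace (EuclideanSpace ℝ (Fin 4)) M]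

theorem Cartan4.hasFrameValues (G : Cartan4 M g) :
    HasFrameValues G.E G.V fun I => g.γ (I 0) :=
  G.inverse.hasFrameValues fun i j => by
    simp [Cartan4.V, vielbein4, formTimes, Matrix.sum_apply, G.limit_Vt]

variable [IsManifold (𝓡 4) ∞ M] [T2Space M] [SigmaCompactSpace M]

/-- The Aschieri–Castellani equation for the value `χ` of the operator on `ψ`. -/
def ACEquation4 (T : ManifoldTwist 4 M) (G : Cartan4 M g) (χ ψ : Spinor (Fn 4 M) 4) : Prop :=
  ∀ φ, CompactSpinor φ → inner4 T G φ χ =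
    (-4 : ℂ) • integralFS (D := 4) (Matrix.trace (T.mmul (T.covDiff G.Om (col ψ))
      (T.mmul (diracAdjoint (g.γ 0) (col φ))
        (T.mmul (T.mmul (T.mmul G.V G.V) G.V) (constM g.chir)))))

theorem isAC4_iff (T : ManifoldTwist 4 M) (G : Cartan4 M g)
    (Dop : Spinor (Fn 4 M) 4 → Spinor (Fn 4 M) 4) :
    IsAC4 T G Dop ↔ ∀ ψ, ACEquation4 T G (Dop ψ) ψ :=
  ⟨fun h ψ φ hφ => h φ ψ hφ, fun h φ ψ hφ => h ψ φ hφ⟩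

/-- The matrix-valued four-form `V ∧_⋆ V ∧_⋆ V ∧_⋆ V γ₅`. -/
def Cartan4.W (T : ManifoldTwist 4 M) (G : Cartan4 M g) : MForm (Fn 4 M) 4 4 4 :=
  T.mmul (T.mmul (T.mmul (T.mmul G.V G.V) G.V) G.V) (constM g.chir)

/-- The matrix-valued three-form `V ∧_⋆ V ∧_⋆ V γ₅`. -/
def Cartan4.U (T : ManifoldTwist 4 M) (G : Cartan4 M g) : MForm (Fn 4 M) 3 4 4 :=
  T.mmul (T.mmul (T.mmul G.V G.V) G.V) (constM g.chir)

/-- Here i and -4 are the constants of the weak equation, and (-1)^3 is the price of moving d_Ω ψ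
past a three-form. -/
theorem acEquation4_iff (hor : IsOriented 4 M) (T : ManifoldTwist 4 M) (G : Cartan4 M g)
    (χ ψ : Spinor (Fn 4 M) 4) :
    ACEquation4 T G χ ψ ↔ ∀ j, Complex.I • T.matMul (G.W T) χ j =
      (-4 * (-1) ^ 3 : ℂ) • T.matWedge (G.U T) (T.covD G.Om ψ) j := by
  rw [← (G.inverse.isIntegral hor T.toTwist).weak_iff_strong (G.W T) (G.U T) (T.covD G.Om ψ) χ
    Complex.I (-4), ← forall_compactSpinor_iff g.sq_zero]
  refine forall_congr' fun φ => imp_congr_right fun _ => ?_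
  have h1 := Twist.trace_col_row_four (T := T.toTwist) χ (adjFn (g.γ 0) φ) (G.W T)
  have h2 := Twist.trace_row_four (T := T.toTwist) (T.covDiff G.Om (col ψ)) (adjFn (g.γ 0) φ)
    (G.U T)
  simp only [Twist.covDiff_col] at h2
  rw [funext_iff]
  refine forall_congr' fun m => ?_
  rw [← h1, ← h2]
  rfl

/-- The system of equations which defines the operator in four dimensions. -/
def geoSystem4 (g : Gamma4) : GeoSystem 4 4 where
  p := 0
  sh := Fin.elim0
  eqs := [.integrated
    (.smul Complex.I (.tr (.mul .val (.mul (.adj .test)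
      (.mul (.mul (.mul (.mul .vielbein .vielbein) .vielbein) .vielbein) (.cliff g.chir))))))
    (.smul (-4) (.tr (.mul (.cov .arg) (.mul (.adj .test)
      (.mul (.mul (.mul .vielbein .vielbein) .vielbein) (.cliff g.chir))))))]

theorem geoSystem4_holds (T : ManifoldTwist 4 M) (G : Cartan4 M g) (χ ψ : Spinor (Fn 4 M) 4)
    (Q : ∀ i, Matrix (Fin ((geoSystem4 g).sh i).1) (Fin ((geoSystem4 g).sh i).2)
      (FS (VF (Fn 4 M)))) :
    (∀ φ, CompactSpinor φ → ∀ e ∈ (geoSystem4 g).eqs, e.Holds T (g.γ 0) G.V G.Om ψ χ φ Q) ↔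
      ACEquation4 T G χ ψ := by
  refine forall_congr' fun φ => imp_congr_right fun _ => ?_
  refine List.forall_mem_singleton.trans ?_
  rw [inner4, ← integralFS_smul G.inverse,
    ← integralFS_smul G.inverse]
  rfl

theorem geoSystem4_constructs (T : ManifoldTwist 4 M) (G : Cartan4 M g)
    {Dop : Spinor (Fn 4 M) 4 → Spinor (Fn 4 M) 4}
    (h : ∀ χ ψ, ACEquation4 T G χ ψ ↔ χ = Dop ψ) :
    (geoSystem4 g).Constructs T (g.γ 0) G.V G.Om Dop := by
  intro ψ
  refine ⟨fun i => i.elim0, fun Q' χ => ?_⟩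
  rw [geoSystem4_holds, h]
  exact ⟨fun h => ⟨funext fun i => i.elim0, h⟩, fun h => h.2⟩

theorem Cartan4.hasFrameValues_three (T : ManifoldTwist 4 M) (G : Cartan4 M g) :
    HasFrameValues (k := 3) G.E (T.mmul (T.mmul G.V G.V) G.V)
      (antiMul g.γ (antiMul g.γ fun I : Fin 1 → Fin 4 => g.γ (I 0))) :=
  (G.hasFrameValues.mmul G.hasFrameValues).mmul G.hasFrameValues

/-- On the frame the four-form equals 4! γ₀γ₁γ₂γ₃γ₅ = -24i. -/
theorem Cartan4.W_apply (T : ManifoldTwist 4 M) (G : Cartan4 M g) (i j : Fin 4) :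
    G.W T i j 0 G.E = algebraMap ℂ (Fn 4 M) (if i = j then -24 * Complex.I else 0) := by
  have hW : HasFrameValues G.E (G.W T) fun I => antiMul g.γ (antiMul g.γ
      (antiMul g.γ fun I : Fin 1 → Fin 4 => g.γ (I 0))) I * g.chir :=
    ((G.hasFrameValues_three T).mmul G.hasFrameValues).mmul_constM g.chir
  have h : antiMul g.γ (antiMul g.γ (antiMul g.γ fun I : Fin 1 → Fin 4 => g.γ (I 0))) id * g.chir =
      (-24 * Complex.I) • (1 : Matrix (Fin 4) (Fin 4) ℂ) := by
    rw [antiMul_four Function.injective_id g.anticomm, smul_mul_assoc]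
    refine (congrArg _ g.mul_chir.1).trans ?_
    rw [smul_smul]
    congr 1
    ring
  have hij := hW id i j
  simp only [h] at hij
  rw [Matrix.smul_apply, Matrix.one_apply, smul_eq_mul, mul_ite, mul_one, mul_zero] at hij
  rw [show (fun a => G.E (id a)) = G.E from rfl] at hij
  rw [hij]

theorem Cartan4.U_apply (T : ManifoldTwist 4 M) (G : Cartan4 M g) (p i j : Fin 4) :
    G.U T i j 0 (fun a => G.E (p.succAbove a)) = algebraMap ℂ (Fn 4 M)
      (((6 : ℂ) • (g.γ (p.succAbove 0) * g.γ (p.succAbove 1) * g.γ (p.succAbove 2) * g.chir))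
        i j) := by
  have hU : HasFrameValues G.E (G.U T) fun I => antiMul g.γ
      (antiMul g.γ fun I : Fin 1 → Fin 4 => g.γ (I 0)) I * g.chir :=
    (G.hasFrameValues_three T).mmul_constM g.chir
  have h : antiMul g.γ (antiMul g.γ fun I : Fin 1 → Fin 4 => g.γ (I 0)) p.succAbove * g.chir =
      (6 : ℂ) • (g.γ (p.succAbove 0) * g.γ (p.succAbove 1) * g.γ (p.succAbove 2) * g.chir) := by
    rw [antiMul_three (Fin.succAbove_right_injective (p := p)) g.anticomm, smul_mul_assoc]
  refine (hU p.succAbove i j).trans (congrArg (algebraMap ℂ (Fn 4 M)) ?_)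
  exact congrFun (congrFun h i) j

theorem exists_operator4 (hor : IsOriented 4 M) (T : ManifoldTwist 4 M) (G : Cartan4 M g) :
    (∃! Dop, IsAC4 T G Dop) ∧
    ∀ Dop, IsAC4 T G Dop →
      IsNCDirac T g.γ G.V G.Om G.E Dop ∧ UniqueSymbol T.toTwist Dop ∧
      (geoSystem4 g).Constructs T (g.γ 0) G.V G.Om Dop := by
  have key := G.inverse.existsUnique_operator (T := T.toTwist) (W := G.W T) (U := G.U T) G.Om
    (w := -24 * Complex.I) (c := Complex.I) (c' := -4 * (-1) ^ 3) (by simp) Complex.I_ne_zero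
    (G.W_apply T) (γ := g.γ) (G.U_apply T)
    -- Both constants are 24i: on the left (-4)(-1)^3 (-1)^3 · 6 · (-i), on the right i · (-24i) ·
    -- i.
    (fun p i j => by
      have h := g.succAbove_mul_chir p i j
      rw [Matrix.smul_apply, smul_eq_mul]
      linear_combination (-24 : ℂ) * h + 24 * (Complex.I * ∑ b, eta p b * g.γ b i j) *
        Complex.I_mul_I)
    (acEquation4_iff hor T G)
  simp only [← isAC4_iff] at key
  refine ⟨key.1, fun Dop hDop => ?_⟩
  obtain ⟨h1, h2, h3, h4⟩ := key.2 Dop hDop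
  have hS := geoSystem4_constructs T G h3
  exact ⟨⟨h1, ⟨h1.1, _, hS⟩, h4⟩, h2, hS⟩

end Four

end TwistedDirac

end

universe u

open TwistedDirac in
theorem mainTheorem1 :
    (∃ S : GeoSystem 2 2,
      ∀ (M : Type u) [TopologicalSpace M] [ChartedSpace (EuclideanSpace ℝ (Fin 2)) M]
        [IsManifold (𝓡 2) ∞ M] [T2Space M] [SigmaCompactSpace M], IsOriented 2 M →
      ∀ (T : ManifoldTwist 2 M) (G : Cartan2 M),
        (∃! Dop, IsAC2 T G Dop) ∧
        ∀ Dop, IsAC2 T G Dop →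
          IsNCDirac T gamma2 G.V G.Om G.E Dop ∧
          UniqueSymbol T.toTwist Dop ∧
          S.Constructs T (gamma2 0) G.V G.Om Dop) ∧
    (∀ g : Gamma4, ∃ S : GeoSystem 4 4,
      ∀ (M : Type u) [TopologicalSpace M] [ChartedSpace (EuclideanSpace ℝ (Fin 4)) M]
        [IsManifold (𝓡 4) ∞ M] [T2Space M] [SigmaCompactSpace M], IsOriented 4 M →
      ∀ (T : ManifoldTwist 4 M) (G : Cartan4 M g),
        (∃! Dop, IsAC4 T G Dop) ∧
        ∀ Dop, IsAC4 T G Dop →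
          IsNCDirac T g.γ G.V G.Om G.E Dop ∧
          UniqueSymbol T.toTwist Dop ∧
          S.Constructs T (g.γ 0) G.V G.Om Dop) := by
  -- The systems contain only numbers and the chirality matrix, so they can be fixed before the
  -- manifold, the twist and the geometry.
  exact ⟨⟨geoSystem2, fun M _ _ _ _ _ hor T G => exists_operator2 hor T G⟩,
    fun g => ⟨geoSystem4 g, fun M _ _ _ _ _ hor T G => exists_operator4 hor T G⟩⟩
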